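/- Let $d_1,d_2,p$ be positive integers varying (for instance along a sequence) so that $d_1\to\infty$, $d_2\to\infty$ and $p/(d_1d_2)\to c$ for some $0<c<\infty$. Let $G_1,\dots,G_{d_1}$ be random $d_2\times p$ matrices all of whose entries are independent real Gaussian random variables with mean $0$ and variance $1$, and let $$W=\frac1{d_1d_2}\bigl(G_iG_j^{\mathrm T}\bigr)_{i,j=1}^{d_1}$$ be the corresponding $d_1d_2\times d_1d_2$ real Wishart matrix. For a $d_1\times d_1$ block matrix $A=(A(i,j))_{i,j}$ with blocks $A(i,j)$ of size $d_2\times d_2$, write $A^{\Gamma}=(A(i,j)^{\mathrm T})_{i,j}$ for its right partial transpose and $(A(j,i))_{i,j}$ for its left partial transpose. Then $W=W^{\mathrm T}$, the left partial transpose of $W$ equals $W^\Gamma$, and the pair $\{W,W^\Gamma\}$ is asymptotically free. That is, with $\operatorname{tr}$ the normalized trace, and $W^{(1)}=W$, $W^{(2)}=W^\Gamma$: all mixed moments $\mathrm E\bigl(\operatorname{tr}(W^{(\epsilon_1)}\cdots W^{(\epsilon_n)})\bigr)$, with $n\ge 0$ and $\epsilon_1,\dots,\epsilon_n\in\{1,2\}$,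 exist, and there are a unital complex algebra $\mathcal A$, a linear functional $\varphi:\mathcal A\to\mathbb C$ with $\varphi(1)=1$, and elements $a_1,a_2\in\mathcal A$ such that $$\lim\,\mathrm E\bigl(\operatorname{tr}(W^{(\epsilon_1)}\cdots W^{(\epsilon_n)})\bigr)=\varphi(a_{\epsilon_1}\cdots a_{\epsilon_n})\qquad\text{for all } n\ge 0,\ \epsilon_1,\dots,\epsilon_n\in\{1,2\},$$ and $a_1,a_2$ are free: $\varphi(x_1\cdots x_m)=0$ whenever $m\ge1$, each $x_k$ lies in the unital subalgebra generated by $a_{i_k}$, $\varphi(x_k)=0$ for all $k$, and $i_k\ne i_{k+1}$ for $1\le k<m$. -/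

import Mathlib

open MeasureTheory ProbabilityTheory Filter Topology

/-- The real Wishart matrix `W = (d₁ d₂)⁻¹ (Gᵢ Gⱼᵀ)ᵢⱼ`, a `d₁ × d₁` block matrix with blocks of
size `d₂ × d₂`, built from the `d₂ × p` matrices `G₁, …, G_{d₁}`. Position `(i, k)` is
row `k` of block row `i`. -/
noncomputable def wishart {d₁ d₂ p : ℕ} (G : Fin d₁ → Matrix (Fin d₂) (Fin p) ℝ) :
    Matrix (Fin d₁ × Fin d₂) (Fin d₁ × Fin d₂) ℝ :=
  ((d₁ : ℝ) * (d₂ : ℝ))⁻¹ • Matrix.of fun a b => (G a.1 * (G b.1).transpose) a.2 b.2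

/-- The right partial transpose `(A(i,j))ᵢⱼ ↦ (A(i,j)ᵀ)ᵢⱼ`: every block is transposed. -/
def rightPartialTranspose {m n R : Type*} (A : Matrix (m × n) (m × n) R) :
    Matrix (m × n) (m × n) R :=
  Matrix.of fun a b => A (a.1, b.2) (b.1, a.2)

/-- The left partial transpose `(A(i,j))ᵢⱼ ↦ (A(j,i))ᵢⱼ`: the blocks are permuted. -/
def leftPartialTranspose {m n R : Type*} (A : Matrix (m × n) (m × n) R) :
    Matrix (m × n) (m × n) R :=
  Matrix.of fun a b => A (b.1, a.2) (a.1, b.2)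

/-- The normalized trace. -/
noncomputable def normTrace {n : Type*} [Fintype n] (A : Matrix n n ℂ) : ℂ :=
  (Fintype.card n : ℂ)⁻¹ * A.trace

/-- Freeness of a family of unital subalgebras with respect to a linear functional `φ`: the value
of `φ` is `0` on every nonempty product of centred elements in which neighbouring factors
come from different subalgebras. A factor `x ∈ S j` is recorded as the pair `(j, x)`. -/
def FreeSubalgebras {J A : Type*} [Ring A] [Algebra ℂ A] (φ : A →ₗ[ℂ] ℂ)
    (S : J → Subalgebra ℂ A) : Prop :=
  ∀ L : List (J × A), L ≠ [] → L.IsChain (fun u v => u.1 ≠ v.1) →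
    (∀ u ∈ L, u.2 ∈ S u.1 ∧ φ u.2 = 0) → φ (L.map Prod.snd).prod = 0

/-- Freeness of a family of elements: the unital subalgebras that they generate are free. -/
def FreeElements {J A : Type*} [Ring A] [Algebra ℂ A] (φ : A →ₗ[ℂ] ℂ) (a : J → A) : Prop :=
  FreeSubalgebras φ fun j => Algebra.adjoin ℂ {a j}

/-- Asymptotic freeness of random matrices `(X N j)_{j ∈ J}` along a filter `l`, with respect to the
expectation of the normalized trace: all mixed moments exist, and in the limit they are the mixed
moments of a family of free elements `(a j)_{j ∈ J}` in a noncommutative probability space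
`(A, φ)`, that is, a unital complex algebra `A` with a linear functional `φ` with `φ 1 = 1`. -/
def AsymptoticallyFree {ι : Type*} (l : Filter ι) {Ω : ι → Type*} [∀ N, MeasurableSpace (Ω N)]
    (P : ∀ N, Measure (Ω N)) {n : ι → Type*} [∀ N, Fintype (n N)] [∀ N, DecidableEq (n N)]
    {J : Type} (X : ∀ N, J → Ω N → Matrix (n N) (n N) ℂ) : Prop :=
  (∀ (w : List J) (N : ι),
    Integrable (fun ω => normTrace (w.map fun j => X N j ω).prod) (P N)) ∧
  ∃ (A : Type) (_ : Ring A) (_ : Algebra ℂ A) (φ : A →ₗ[ℂ] ℂ) (a : J → A),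
    φ 1 = 1 ∧
    (∀ w : List J,
      Tendsto (fun N => ∫ ω, normTrace (w.map fun j => X N j ω).prod ∂(P N)) l
        (𝓝 (φ (w.map a).prod))) ∧
    FreeElements φ a

/-! Write N = d₁d₂ and stack the Gaussian matrices into an N × p matrix X, so that W = N⁻¹XXᵀ. The
vector field D_ab = Σ_s X_as ∂_bs acts on W by D_ab W_xy = δ_xb W_ay + δ_yb W_ax
(`isLieAction_wishartPoly`), and Gaussian integration by parts becomes N E(W_ab F) = p δ_ab E(F) +
E(D_ab F) (`isStein_wishartPoly`). Apply this to the first letter of a word inside a trace. If that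
letter is W, a derivative that hits a later W cuts the trace into tr(u) tr(Wv), and a hit on W^Γ
leaves only contracted partial traces, which vanish in the limit. If it is W^Γ, hits on W vanish,
while a hit on W^Γ leaves W contracted with a partial trace of u over the first factor and one of v
over the second. A second integration by parts turns this into (p/N) tr(u) tr(v). The limits m
therefore satisfy m(1) = 1 and

m(W w) = c m(w) + Σ m(u) m(W v) over w = u W v, m(W^Γ w) = c m(w) + c Σ m(u) m(v) over w = u W^Γ v.

These equations determine m by induction on length. They also hold for an explicit pair on the full
Fock space over two letters: a free Poisson element of rate c on one letter and a semicircular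
element of mean c and variance c on the other (`Fock.state_word_zero`, `Fock.state_word_one`). Since
different letters are used, the pair is free (`Fock.free_elt`).

Three estimates justify the limit. Every error term is a tensor network, and Cauchy–Schwarz bounds
its square by a product of squared Hilbert–Schmidt norms (`sum_triangle_sq_le`,
`sum_tetrahedron_sq_le`); for a word w such a norm is N tr(w wᵀ), and a partial trace costs one
factor d₁ or d₂. The normalized traces have bounded moments: tr(w) to the power 2^k is at most the
trace of a longer word, and expectations of traces are bounded by counting pairings
(`expect_trace_wordMat_le`). Finally, products of traces must factor. Instead of estimating
variances, `WishartRegime.factors` proves E(tr(w) Q) - m(w) E(Q) → 0 for all test functions Q in a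
class that contains the traces of words and is closed under products. -/

/-- All ways to write a word as `u ++ e :: v`. -/
def splits {J : Type*} : List J → List (List J × J × List J)
  | [] => []
  | e :: w => ([], e, w) :: (splits w).map fun t => (e :: t.1, t.2.1, t.2.2)

/-! ### The limit pair on the full Fock space: recursion and freeness. -/

namespace Fock

/-- The (completed) full Fock space over two letters. -/
abbrev Space : Type := List (Fin 2) → ℂ

/-- The vacuum vector. -/
def vac : Space := fun w => if w = [] then 1 else 0

/-- Left creation by the letter `j`. -/
def create (j : Fin 2) : Module.End ℂ Space where
  toFun f w := match w with
    | [] => 0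
    | i :: v => if i = j then f v else 0
  map_add' f g := by
    funext w
    rcases w with _ | ⟨i, v⟩
    · simp
    · by_cases h : i = j <;> simp [h]
  map_smul' z f := by
    funext w
    rcases w with _ | ⟨i, v⟩
    · simp
    · by_cases h : i = j <;> simp [h]

/-- Left annihilation by the letter `j`. -/
def annih (j : Fin 2) : Module.End ℂ Space where
  toFun f w := f (j :: w)
  map_add' _ _ := rfl
  map_smul' _ _ := rfl

/-- Right annihilation by the letter `j`. -/
def annihRight (j : Fin 2) : Module.End ℂ Space where
  toFun f w := f (w ++ [j])
  map_add' _ _ := rfl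
  map_smul' _ _ := rfl

@[simp] lemma create_nil (j : Fin 2) (f : Space) : create j f [] = 0 := rfl
@[simp] lemma create_cons (j i : Fin 2) (f : Space) (v : List (Fin 2)) :
    create j f (i :: v) = if i = j then f v else 0 := rfl
@[simp] lemma annih_apply (j : Fin 2) (f : Space) (w : List (Fin 2)) :
    annih j f w = f (j :: w) := rfl
@[simp] lemma annihRight_apply (j : Fin 2) (f : Space) (w : List (Fin 2)) :
    annihRight j f w = f (w ++ [j]) := rfl

/-- The vacuum state. -/
def state : Module.End ℂ Space →ₗ[ℂ] ℂ where
  toFun T := T vac []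
  map_add' _ _ := rfl
  map_smul' _ _ := rfl

lemma state_apply (T : Module.End ℂ Space) : state T = T vac [] := rfl

lemma annihRight_vac (j : Fin 2) : annihRight j vac = 0 := by
  funext w; simp [vac]

/-- The two operators act at opposite ends of a word, so they commute except where the created
letter is itself the last one. This happens only on the vacuum component, which leaves a multiple of
`vac`. -/
lemma annihRight_create (j i : Fin 2) (f : Space) :
    annihRight j (create i f) =
      create i (annihRight j f) + (if i = j then f [] else 0) • vac := by
  funext w
  have hv : ∀ (z : ℂ) (w : List (Fin 2)), (z • vac) w = if w = [] then z else 0 := by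
    intro z w; simp [vac]
  rcases w with _ | ⟨k, v⟩
  · by_cases h : i = j
    · simp [hv, h]
    · simp [h, Ne.symm h]
  · rw [Pi.add_apply, hv]; simp

lemma annihRight_annih (j i : Fin 2) (f : Space) :
    annihRight j (annih i f) = annih i (annihRight j f) := rfl

/-- The free Poisson element (letter `0`) and the shifted semicircular element (letter `1`),
with `s ^ 2` the rate. -/
noncomputable def elt (s : ℂ) (j : Fin 2) : Module.End ℂ Space :=
  (s ^ 2) • 1 + s • (create j + annih j) +
    (if j = 0 then create j * annih j else 0)

lemma elt_zero_apply (s : ℂ) (f : Space) : elt s 0 f =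
    s ^ 2 • f + s • (create 0 f + annih 0 f) + create 0 (annih 0 f) := by
  simp [elt]

lemma elt_one_apply (s : ℂ) (f : Space) : elt s 1 f =
    s ^ 2 • f + s • (create 1 f + annih 1 f) := by
  simp [elt]

/-- The product of the elements along a word. -/
noncomputable def word (s : ℂ) (w : List (Fin 2)) : Module.End ℂ Space := (w.map (elt s)).prod

/-- The number `κ` with `[annihRight j, elt s e] f = κ • vac`. -/
noncomputable def defect (s : ℂ) (j e : Fin 2) (f : Space) : ℂ :=
  if e = j then s * f [] + (if e = 0 then f [0] else 0) else 0

lemma annihRight_elt (s : ℂ) (j e : Fin 2) (f : Space) :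
    annihRight j (elt s e f) = elt s e (annihRight j f) + defect s j e f • vac := by
  fin_cases e
  · show annihRight j (elt s 0 f) = elt s 0 (annihRight j f) + defect s j 0 f • vac
    rw [elt_zero_apply, elt_zero_apply]
    simp only [map_add, map_smul, annihRight_create, annihRight_annih, defect, annih_apply]
    by_cases h : (0 : Fin 2) = j
    · simp only [h, if_true]; subst h; module
    · simp only [h, if_false]; module
  · show annihRight j (elt s 1 f) = elt s 1 (annihRight j f) + defect s j 1 f • vac
    rw [elt_one_apply, elt_one_apply]
    simp only [map_add, map_smul, annihRight_create, annihRight_annih, defect]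
    by_cases h : (1 : Fin 2) = j
    · simp only [h, if_true]; subst h; simp; module
    · simp only [h, if_false]; module

lemma word_cons (s : ℂ) (e : Fin 2) (w : List (Fin 2)) (f : Space) :
    word s (e :: w) f = elt s e (word s w f) := by
  simp [word]

/-- Move the right annihilation through the word towards the vacuum, which it kills. Each letter
that is passed leaves a multiple of `vac`, and the letters to its left still act on it. The word is
thereby cut in two, which makes the recursion for the state quadratic. -/
lemma annihRight_word (s : ℂ) (j : Fin 2) (w : List (Fin 2)) :
    annihRight j (word s w vac) =
      ((splits w).map fun t => defect s j t.2.1 (word s t.2.2 vac) • word s t.1 vac).sum := by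
  induction w with
  | nil => simp [word, splits, annihRight_vac]
  | cons e w ih =>
    rw [word_cons, annihRight_elt, ih, splits, List.map_cons, List.sum_cons, add_comm]
    congr 1
    · rw [map_list_sum, List.map_map, List.map_map]
      congr 1
      apply List.map_congr_left
      intro t _
      simp [word_cons]

/-- On a one-letter word, right and left annihilation read off the same coefficient, so
`annihRight_word` applies. The recursion closes because `s` times the defect at a cut is the vacuum
coefficient of `elt s 0` applied to the right part; hence the letter `0` survives in the second
factor. -/
lemma state_word_zero (s : ℂ) (w : List (Fin 2)) :
    state (word s (0 :: w)) = s ^ 2 * state (word s w) +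
      ((splits w).map fun t => if t.2.1 = 0 then
        state (word s t.1) * state (word s (0 :: t.2.2)) else 0).sum := by
  have key : (word s w vac) [0] = annihRight 0 (word s w vac) [] := rfl
  have h1 : ∀ f : Space, elt s 0 f [] = s ^ 2 * f [] + s * f [0] := by
    intro f; rw [elt_zero_apply]; simp
  have hsum : ∀ l : List Space, l.sum [] = (l.map fun f => f []).sum := by
    intro l; induction l with
    | nil => rfl
    | cons a l ih => simp [ih]
  rw [state_apply, word_cons, h1, key, annihRight_word, hsum, List.map_map, ← List.sum_map_mul_left]
  congr 2
  apply List.map_congr_left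
  intro t _
  by_cases h : t.2.1 = 0
  · simp only [Function.comp, defect, h, if_true, Pi.smul_apply, smul_eq_mul, state_apply,
      word_cons, h1]
    ring
  · simp [Function.comp, defect, h]

/-- Without the term `create j * annih j` the defect is just `s * f []`, so the letter at the cut
disappears and leaves the factor `s ^ 2`. -/
lemma state_word_one (s : ℂ) (w : List (Fin 2)) :
    state (word s (1 :: w)) = s ^ 2 * state (word s w) +
      ((splits w).map fun t => if t.2.1 = 1 then
        s ^ 2 * (state (word s t.1) * state (word s t.2.2)) else 0).sum := by
  have key : (word s w vac) [1] = annihRight 1 (word s w vac) [] := rfl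
  have h1 : ∀ f : Space, elt s 1 f [] = s ^ 2 * f [] + s * f [1] := by
    intro f; rw [elt_one_apply]; simp
  have hsum : ∀ l : List Space, l.sum [] = (l.map fun f => f []).sum := by
    intro l; induction l with
    | nil => rfl
    | cons a l ih => simp [ih]
  rw [state_apply, word_cons, h1, key, annihRight_word, hsum, List.map_map, ← List.sum_map_mul_left]
  congr 2
  apply List.map_congr_left
  intro t _
  by_cases h : t.2.1 = 1
  · simp [Function.comp, defect, h, state_apply]
    ring
  · simp [Function.comp, defect, h]

lemma state_one : state 1 = 1 := by simp [state_apply, vac]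

/-- The operators acting on `ℂ[create j] f`, for `f` without words that start with `j`, by
polynomials in `create j` that do not depend on `f`. -/
def polyAct (j : Fin 2) : Subalgebra ℂ (Module.End ℂ Space) where
  carrier := {x | ∀ q : Polynomial ℂ, ∃ q' : Polynomial ℂ, ∀ f : Space, annih j f = 0 →
    x (Polynomial.aeval (create j) q f) = Polynomial.aeval (create j) q' f}
  mul_mem' := by
    intro x y hx hy q
    obtain ⟨q₁, h₁⟩ := hy q
    obtain ⟨q₂, h₂⟩ := hx q₁
    exact ⟨q₂, fun f hf => by rw [Module.End.mul_apply, h₁ f hf, h₂ f hf]⟩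
  add_mem' := by
    intro x y hx hy q
    obtain ⟨q₁, h₁⟩ := hy q
    obtain ⟨q₂, h₂⟩ := hx q
    exact ⟨q₂ + q₁, fun f hf => by simp [h₁ f hf, h₂ f hf]⟩
  algebraMap_mem' := by
    intro z q
    exact ⟨z • q, fun f hf => by simp [Module.algebraMap_end_apply]⟩

lemma create_mem_polyAct (j : Fin 2) : create j ∈ polyAct j := by
  intro q
  exact ⟨Polynomial.X * q, fun f _ => by simp⟩

lemma annih_create (j : Fin 2) (f : Space) : annih j (create j f) = f := by
  funext w; simp

lemma aeval_create (j : Fin 2) (q : Polynomial ℂ) (f : Space) :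
    Polynomial.aeval (create j) q f =
      create j (Polynomial.aeval (create j) q.divX f) + q.coeff 0 • f := by
  have h := congrArg (fun r => Polynomial.aeval (create j) r f) (Polynomial.X_mul_divX_add q)
  simp only [map_add, map_mul, Polynomial.aeval_X, Polynomial.aeval_C] at h
  rw [← h, LinearMap.add_apply, Module.End.mul_apply, Module.algebraMap_end_apply]

/-- Split off the constant term of the polynomial: annihilation undoes one creation in the remainder
and kills the multiple of `f`. -/
lemma annih_mem_polyAct (j : Fin 2) : annih j ∈ polyAct j := by
  intro q
  refine ⟨q.divX, fun f hf => ?_⟩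
  rw [aeval_create, map_add, annih_create, map_smul, hf, smul_zero, add_zero]

lemma elt_mem_polyAct (s : ℂ) (j : Fin 2) : elt s j ∈ polyAct j := by
  unfold elt
  refine add_mem (add_mem (Subalgebra.smul_mem _ (one_mem _) _) (Subalgebra.smul_mem _
    (add_mem (create_mem_polyAct j) (annih_mem_polyAct j)) _)) ?_
  split_ifs
  · exact mul_mem (create_mem_polyAct j) (annih_mem_polyAct j)
  · exact zero_mem _

/-- The polynomial that describes `x` does not depend on the vector, so it can be read off at `vac`,
where its constant coefficient is `state x = 0`. Hence it is divisible by the variable, for every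
admissible `f`. -/
lemma centred_apply {j : Fin 2} {x : Module.End ℂ Space} (hx : x ∈ polyAct j)
    (h0 : state x = 0) {f : Space} (hf : annih j f = 0) : ∃ g, x f = create j g := by
  obtain ⟨q, hq⟩ := hx 1
  have hv : annih j vac = 0 := by funext w; simp [vac]
  have hc : q.coeff 0 = 0 := by
    have h1 := hq vac hv
    rw [map_one, Module.End.one_apply, aeval_create] at h1
    have h2 := congrFun h1 []
    simp only [Pi.add_apply, create_nil, Pi.smul_apply,
      smul_eq_mul, zero_add] at h2
    rw [state_apply] at h0
    rw [h0] at h2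
    simpa [vac] using h2.symm
  refine ⟨Polynomial.aeval (create j) q.divX f, ?_⟩
  have h1 := hq f hf
  rw [map_one, Module.End.one_apply, aeval_create j q, hc] at h1
  simpa using h1

lemma annih_create_of_ne {i j : Fin 2} (h : j ≠ i) (f : Space) : annih j (create i f) = 0 := by
  funext w; simp [h]

/-- Let the alternating product act on the vacuum from right to left. Every centred factor sends its
argument into the range of its own creation operator, and vectors of that range have no vacuum
coefficient. -/
theorem free_elt (s : ℂ) : FreeElements state (elt s) := by
  intro L hL hchain hmem
  have hsub : ∀ j, Algebra.adjoin ℂ {elt s j} ≤ polyAct j := fun j =>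
    Algebra.adjoin_le (by simpa using elt_mem_polyAct s j)
  have main : ∀ L : List (Fin 2 × Module.End ℂ Space), ∀ u, (u :: L).IsChain
      (fun u v => u.1 ≠ v.1) → (∀ v ∈ u :: L, v.2 ∈ Algebra.adjoin ℂ {elt s v.1} ∧ state v.2 = 0) →
      ∃ g, ((u :: L).map Prod.snd).prod vac = create u.1 g := by
    intro L
    induction L with
    | nil =>
      intro u _ h
      obtain ⟨h1, h2⟩ := h u (by simp)
      obtain ⟨g, hg⟩ := centred_apply (hsub _ h1) h2 (f := vac) (by funext w; simp [vac])
      exact ⟨g, by simpa using hg⟩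
    | cons v L ih =>
      intro u hc h
      rw [List.isChain_cons_cons] at hc
      obtain ⟨g, hg⟩ := ih v hc.2 fun x hx => h x (List.mem_cons_of_mem _ hx)
      obtain ⟨h1, h2⟩ := h u (by simp)
      -- Neighbouring letters differ, so a vector created by the previous letter has no component
      -- starting with the present one.
      obtain ⟨g', hg'⟩ := centred_apply (hsub _ h1) h2 (annih_create_of_ne hc.1 g)
      refine ⟨g', ?_⟩
      rw [List.map_cons, List.prod_cons, Module.End.mul_apply, hg, hg']
  obtain ⟨u, L, rfl⟩ := List.exists_cons_of_ne_nil hL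
  obtain ⟨g, hg⟩ := main L u hchain hmem
  rw [state_apply, hg, create_nil]

end Fock

/-! ### Moments of one Gaussian variable. -/

/-- The moments of the standard Gaussian law. -/
noncomputable def gaussMoment (k : ℕ) : ℝ := ∫ x, x ^ k ∂(gaussianReal 0 1)

lemma integrable_pow_gaussianReal (k : ℕ) :
    Integrable (fun x : ℝ => x ^ k) (gaussianReal 0 1) := by
  have h : MemLp id (k : ENNReal) (gaussianReal 0 1) := memLp_id_gaussianReal' _ (by simp)
  have := h.integrable_norm_pow'
  refine this.mono' (by fun_prop) (ae_of_all _ fun x => by simp)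

lemma gaussMoment_zero : gaussMoment 0 = 1 := by simp [gaussMoment]

/-- The derivative of the density times `x ^ k` has integral zero. For `k = 0` the truncated
exponent `k - 1` is harmless because of the factor `k`. -/
lemma gaussMoment_succ (k : ℕ) : gaussMoment (k + 1) = k * gaussMoment (k - 1) := by
  have hint : ∀ m : ℕ, Integrable (fun x : ℝ => gaussianPDFReal 0 1 x * x ^ m) := by
    intro m
    have h := integrable_pow_gaussianReal m
    rw [gaussianReal_of_var_ne_zero _ one_ne_zero,
      integrable_withDensity_iff (measurable_gaussianPDF _ _)
        (ae_of_all _ fun x => by simp [gaussianPDF])] at h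
    refine h.congr (ae_of_all _ fun x => ?_)
    simp [gaussianPDF, ENNReal.toReal_ofReal (gaussianPDFReal_nonneg 0 1 x), mul_comm]
  have hd : ∀ x : ℝ, HasDerivAt (gaussianPDFReal 0 1) (-x * gaussianPDFReal 0 1 x) x := by
    intro x
    rw [gaussianPDFReal_def]
    have h1 : HasDerivAt (fun y : ℝ => -(y - 0) ^ 2 / (2 * ((1 : NNReal) : ℝ))) (-x) x :=
      (((hasDerivAt_id x).sub_const 0).pow 2).neg.div_const (2 * ((1 : NNReal) : ℝ))
        |>.congr_deriv (by simp; ring)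
    exact (h1.exp.const_mul (√(2 * Real.pi * ((1 : NNReal) : ℝ)))⁻¹).congr_deriv
      (by simp only []; ring)
  have hderiv : ∀ x : ℝ, HasDerivAt (fun x => gaussianPDFReal 0 1 x * x ^ k)
      (k * (gaussianPDFReal 0 1 x * x ^ (k - 1)) - gaussianPDFReal 0 1 x * x ^ (k + 1)) x :=
    fun x => ((hd x).mul (hasDerivAt_pow k x)).congr_deriv (by ring)
  have h0 := integral_eq_zero_of_hasDerivAt_of_integrable hderiv
    (((hint (k - 1)).const_mul _).sub (hint (k + 1))) (hint k)
  rw [integral_sub ((hint (k - 1)).const_mul _) (hint (k + 1)), integral_const_mul] at h0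
  have hm : ∀ m, gaussMoment m = ∫ x, gaussianPDFReal 0 1 x * x ^ m := by
    intro m
    rw [gaussMoment, integral_gaussianReal_eq_integral_smul one_ne_zero]
    simp
  rw [hm, hm]
  linarith

lemma gaussMoment_nonneg_le (k : ℕ) :
    0 ≤ gaussMoment k ∧ gaussMoment k ≤ k.factorial := by
  induction k using Nat.strong_induction_on with
  | _ k ih =>
    rcases k with _ | k
    · simp [gaussMoment_zero]
    · rw [gaussMoment_succ]
      obtain ⟨h1, h2⟩ := ih (k - 1) (by omega)
      refine ⟨by positivity, ?_⟩
      have h3 : ((k - 1).factorial : ℝ) ≤ k.factorial := by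
        exact_mod_cast Nat.factorial_le (by omega)
      rw [Nat.factorial_succ]
      push_cast
      have : (0 : ℝ) ≤ k.factorial := by positivity
      nlinarith [mul_le_mul_of_nonneg_left (h2.trans h3) (Nat.cast_nonneg (α := ℝ) k)]

lemma gaussMoment_odd (k : ℕ) (hk : Odd k) : gaussMoment k = 0 := by
  induction k using Nat.strong_induction_on with
  | _ k ih =>
    rcases k with _ | _ | k
    · simp at hk
    · rw [gaussMoment_succ]; simp
    · rw [gaussMoment_succ]
      have : Odd k := by
        rcases hk with ⟨m, hm⟩
        exact ⟨m - 1, by omega⟩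
      simp [ih k (by omega) this]

/-! ### Expectation of polynomials in independent Gaussian variables. -/

section Expect
variable {σ : Type*} [Fintype σ]

/-- The standard Gaussian measure on `ℝ^σ`. -/
noncomputable def gaussPi (σ : Type*) [Fintype σ] : Measure (σ → ℝ) :=
  Measure.pi fun _ => gaussianReal 0 1

instance : IsProbabilityMeasure (gaussPi σ) := by unfold gaussPi; infer_instance

lemma integrable_monomial (s : σ →₀ ℕ) :
    Integrable (fun x : σ → ℝ => ∏ i, x i ^ s i) (gaussPi σ) :=
  Integrable.fintype_prod (f := fun i (x : ℝ) => x ^ s i) fun _ => integrable_pow_gaussianReal _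

lemma eval_monomial_eq (s : σ →₀ ℕ) (a : ℝ) (x : σ → ℝ) :
    MvPolynomial.eval x (MvPolynomial.monomial s a) = a * ∏ i, x i ^ s i := by
  rw [MvPolynomial.eval_monomial, Finsupp.prod_fintype _ _ (by simp)]

lemma integrable_eval (F : MvPolynomial σ ℝ) :
    Integrable (fun x => MvPolynomial.eval x F) (gaussPi σ) := by
  induction F using MvPolynomial.induction_on' with
  | monomial s a =>
    simp only [eval_monomial_eq]
    exact (integrable_monomial s).const_mul a
  | add F G hF hG =>
    simp only [map_add]
    exact hF.add hG

/-- The expectation of a polynomial in independent standard Gaussian variables. -/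
noncomputable def expect : MvPolynomial σ ℝ →ₗ[ℝ] ℝ where
  toFun F := ∫ x, MvPolynomial.eval x F ∂(gaussPi σ)
  map_add' F G := by
    simp only [map_add]
    exact integral_add (integrable_eval F) (integrable_eval G)
  map_smul' a F := by
    simp only [MvPolynomial.smul_eval, RingHom.id_apply, smul_eq_mul]
    exact integral_const_mul _ _

lemma expect_def (F : MvPolynomial σ ℝ) :
    expect F = ∫ x, MvPolynomial.eval x F ∂(gaussPi σ) := rfl

lemma expect_mono {F G : MvPolynomial σ ℝ}
    (h : ∀ x, MvPolynomial.eval x F ≤ MvPolynomial.eval x G) : expect F ≤ expect G :=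
  integral_mono (integrable_eval F) (integrable_eval G) h

lemma expect_nonneg {F : MvPolynomial σ ℝ} (h : ∀ x, 0 ≤ MvPolynomial.eval x F) :
    0 ≤ expect F := integral_nonneg h

lemma expect_C (a : ℝ) : expect (MvPolynomial.C a : MvPolynomial σ ℝ) = a := by
  simp [expect_def]

lemma expect_monomial (s : σ →₀ ℕ) (a : ℝ) :
    expect (MvPolynomial.monomial s a) = a * ∏ i, gaussMoment (s i) := by
  simp only [expect_def, eval_monomial_eq]
  rw [integral_const_mul, gaussPi,
    integral_fintype_prod_eq_prod (fun i (x : ℝ) => x ^ s i)]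
  rfl

/-- Gaussian integration by parts. -/
theorem expect_X_mul (q : σ) (F : MvPolynomial σ ℝ) :
    expect (MvPolynomial.X q * F) = expect (MvPolynomial.pderiv q F) := by
  induction F using MvPolynomial.induction_on' with
  | monomial s a =>
    classical
    have hX : MvPolynomial.X q * MvPolynomial.monomial s a =
        MvPolynomial.monomial (Finsupp.single q 1 + s) a := by
      rw [MvPolynomial.monomial_single_add, pow_one]
    rw [hX, MvPolynomial.pderiv_monomial, expect_monomial, expect_monomial, ← Finset.mul_prod_erase _ _ (Finset.mem_univ q),
      ← Finset.mul_prod_erase (Finset.univ) (fun i => gaussMoment ((s - Finsupp.single q 1 : σ →₀ ℕ) i))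
        (Finset.mem_univ q)]
    have h1 : ∏ i ∈ Finset.univ.erase q, gaussMoment ((Finsupp.single q 1 + s : σ →₀ ℕ) i) =
        ∏ i ∈ Finset.univ.erase q, gaussMoment ((s - Finsupp.single q 1 : σ →₀ ℕ) i) := by
      apply Finset.prod_congr rfl
      intro i hi
      have : q ≠ i := (Finset.ne_of_mem_erase hi).symm
      simp [this]
    rw [h1]
    simp only [Finsupp.add_apply, Finsupp.single_eq_same, Finsupp.tsub_apply]
    rw [add_comm 1, gaussMoment_succ]
    ring
  | add F G hF hG => simp only [mul_add, map_add, hF, hG]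

/-- The Cauchy–Schwarz inequality. -/
lemma expect_mul_sq_le (F G : MvPolynomial σ ℝ) :
    expect (F * G) ^ 2 ≤ expect (F ^ 2) * expect (G ^ 2) := by
  have h : ∀ t : ℝ, 0 ≤ expect (G ^ 2) * (t * t) + 2 * expect (F * G) * t + expect (F ^ 2) := by
    intro t
    have h1 : 0 ≤ expect ((F + t • G) ^ 2) := expect_nonneg fun x => by
      rw [map_pow]; positivity
    have h2 : (F + t • G) ^ 2 = F ^ 2 + (2 * t) • (F * G) + (t * t) • G ^ 2 := by
      simp only [MvPolynomial.smul_eq_C_mul, map_mul]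
      have : (MvPolynomial.C (2 : ℝ) : MvPolynomial σ ℝ) = 2 := rfl
      rw [this]; ring
    rw [h2] at h1
    simp only [map_add, map_smul, smul_eq_mul] at h1
    linarith
  have := discrim_le_zero h
  rw [discrim] at this
  nlinarith

lemma prod_X_eq_monomial {σ S : Type*} [Fintype S] (q : S → σ) :
    ∏ x, (MvPolynomial.X (q x) : MvPolynomial σ ℝ) =
      MvPolynomial.monomial (∑ x, Finsupp.single (q x) 1) 1 := by
  rw [MvPolynomial.monomial_sum_one]
  rfl

lemma sum_single_apply {σ S : Type*} [DecidableEq σ] [Fintype S] (q : S → σ) (i : σ) :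
    (∑ x, Finsupp.single (q x) 1 : σ →₀ ℕ) i = Fintype.card {x // q x = i} := by
  rw [Finsupp.finsetSum_apply, Fintype.card_subtype]
  simp [Finsupp.single_apply, Finset.sum_boole]

/-- The expectation is a product of moments at most `m!`, with `m` the multiplicities of the
variables, and a product of factorials divides the factorial of the sum. -/
lemma expect_prod_X_le {S : Type*} [Fintype S] (q : S → σ) :
    expect (∏ x, (MvPolynomial.X (q x) : MvPolynomial σ ℝ)) ≤ (Fintype.card S).factorial := by
  classical
  rw [prod_X_eq_monomial, expect_monomial, one_mul]
  calc ∏ i, gaussMoment _ ≤ ∏ i, (((∑ x, Finsupp.single (q x) 1 : σ →₀ ℕ) i).factorial : ℝ) :=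
        Finset.prod_le_prod (fun i _ => (gaussMoment_nonneg_le _).1)
          fun i _ => (gaussMoment_nonneg_le _).2
    _ ≤ _ := by
      have h := Nat.le_of_dvd (Nat.factorial_pos _) (Nat.prod_factorial_dvd_factorial_sum
        Finset.univ fun i => (∑ x, Finsupp.single (q x) 1 : σ →₀ ℕ) i)
      have h2 : ∑ i, (∑ x, Finsupp.single (q x) 1 : σ →₀ ℕ) i = Fintype.card S := by
        simp only [Finsupp.finsetSum_apply]
        rw [Finset.sum_comm]
        simp [Finsupp.single_apply]
      rw [h2] at h
      exact_mod_cast h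

lemma expect_prod_X_eq_zero [DecidableEq σ] {S : Type*} [Fintype S] (q : S → σ) {i : σ}
    (h : Odd (Fintype.card {x // q x = i})) :
    expect (∏ x, (MvPolynomial.X (q x) : MvPolynomial σ ℝ)) = 0 := by
  rw [prod_X_eq_monomial, expect_monomial, one_mul]
  refine Finset.prod_eq_zero (Finset.mem_univ i) (gaussMoment_odd _ ?_)
  rwa [sum_single_apply]

end Expect

/-! ### Words in a matrix and its partial transpose, derivations, partial traces. -/

section Words
variable {α β R : Type*} [Fintype α] [Fintype β] [DecidableEq α] [DecidableEq β] [CommRing R]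

/-- The matrix that belongs to a letter. -/
def letterMat {α β R : Type*} (W : Matrix (α × β) (α × β) R) (e : Fin 2) : Matrix (α × β) (α × β) R :=
  if e = 0 then W else rightPartialTranspose W

/-- The product of the matrices of the letters of a word. -/
def wordMat (W : Matrix (α × β) (α × β) R) (w : List (Fin 2)) : Matrix (α × β) (α × β) R :=
  (w.map (letterMat W)).prod

@[simp] lemma letterMat_zero {α β R : Type*} (W : Matrix (α × β) (α × β) R) : letterMat W 0 = W := rfl
@[simp] lemma letterMat_one {α β R : Type*} (W : Matrix (α × β) (α × β) R) :
    letterMat W 1 = rightPartialTranspose W := rfl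

@[simp] lemma wordMat_nil (W : Matrix (α × β) (α × β) R) : wordMat W [] = 1 := rfl

lemma wordMat_cons (W : Matrix (α × β) (α × β) R) (e : Fin 2) (w : List (Fin 2)) :
    wordMat W (e :: w) = letterMat W e * wordMat W w := by
  simp [wordMat]

lemma wordMat_append (W : Matrix (α × β) (α × β) R) (u v : List (Fin 2)) :
    wordMat W (u ++ v) = wordMat W u * wordMat W v := by
  simp [wordMat]

lemma wordMat_singleton_zero (W : Matrix (α × β) (α × β) R) : wordMat W [0] = W := by
  simp [wordMat]

lemma transpose_letterMat {α β R : Type*} {W : Matrix (α × β) (α × β) R} (hW : W.transpose = W) (e : Fin 2) :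
    (letterMat W e).transpose = letterMat W e := by
  fin_cases e
  · exact hW
  · ext a b
    exact congrFun (congrFun hW (a.1, b.2)) (b.1, a.2)

/-- Both letters are symmetric matrices. This makes the squared Hilbert–Schmidt norm of a word the
trace of the word followed by its reverse. -/
lemma transpose_wordMat {W : Matrix (α × β) (α × β) R} (hW : W.transpose = W)
    (w : List (Fin 2)) : (wordMat W w).transpose = wordMat W w.reverse := by
  induction w with
  | nil => simp
  | cons e w ih =>
    rw [wordMat_cons, Matrix.transpose_mul, ih, transpose_letterMat hW, List.reverse_cons,
      wordMat_append, wordMat_cons, wordMat_nil, mul_one]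

lemma wordMat_map {S : Type*} [CommRing S] (f : R →+* S) (W : Matrix (α × β) (α × β) R)
    (w : List (Fin 2)) : (wordMat W w).map f = wordMat (W.map f) w := by
  induction w with
  | nil =>
    rw [wordMat_nil, wordMat_nil]
    exact Matrix.map_one f (map_zero f) (map_one f)
  | cons e w ih =>
    rw [wordMat_cons, wordMat_cons, Matrix.map_mul, ih]
    congr 1
    fin_cases e <;> rfl

end Words

section Leibniz
variable {n R : Type*} [Fintype n] [CommRing R] [Algebra ℝ R]

lemma map_derivation_mul (D : Derivation ℝ R R) (A B : Matrix n n R) :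
    (A * B).map D = A.map D * B + A * B.map D := by
  ext i j
  simp only [Matrix.map_apply, Matrix.mul_apply, Matrix.add_apply, map_sum, Derivation.leibniz,
    smul_eq_mul, ← Finset.sum_add_distrib]
  exact Finset.sum_congr rfl fun k _ => by ring

variable {α β : Type*} [Fintype α] [Fintype β] [DecidableEq α] [DecidableEq β]

lemma map_derivation_wordMat (D : Derivation ℝ R R) (W : Matrix (α × β) (α × β) R)
    (w : List (Fin 2)) : (wordMat W w).map D =
      ((splits w).map fun t =>
        wordMat W t.1 * (letterMat W t.2.1).map D * wordMat W t.2.2).sum := by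
  induction w with
  | nil =>
    ext i j
    by_cases h : i = j <;> simp [splits, h]
  | cons e w ih =>
    rw [wordMat_cons, map_derivation_mul, ih, splits, List.map_cons, List.sum_cons, List.map_map,
      ← List.sum_map_mul_left]
    congr 1
    · simp
    · congr 1
      apply List.map_congr_left
      intro t _
      simp only [Function.comp, wordMat_cons, Matrix.mul_assoc]

end Leibniz

section Traces
variable {α β R : Type*} [Fintype α] [Fintype β] [CommRing R]

/-- The partial trace over the first factor. -/
def traceFst (A : Matrix (α × β) (α × β) R) : Matrix β β R :=
  Matrix.of fun i j => ∑ c, A (c, i) (c, j)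

/-- The partial trace over the second factor. -/
def traceSnd (A : Matrix (α × β) (α × β) R) : Matrix α α R :=
  Matrix.of fun i j => ∑ c, A (i, c) (j, c)

lemma trace_traceFst (A : Matrix (α × β) (α × β) R) : (traceFst A).trace = A.trace := by
  simp only [Matrix.trace, Matrix.diag, traceFst, Matrix.of_apply, Fintype.sum_prod_type]
  exact Finset.sum_comm

lemma trace_traceSnd (A : Matrix (α × β) (α × β) R) : (traceSnd A).trace = A.trace := by
  simp only [Matrix.trace, Matrix.diag, traceSnd, Matrix.of_apply, Fintype.sum_prod_type]

end Traces

/-! ### Effect of a derivation on one letter inside a word. -/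

/-- A family of derivations that acts on the entries of a symmetric matrix like the Lie algebra
of the general linear group. -/
structure IsLieAction {n R : Type*} [DecidableEq n] [CommRing R] [Algebra ℝ R]
    (W : Matrix n n R) (D : n → n → Derivation ℝ R R) : Prop where
  symm : W.transpose = W
  apply : ∀ a b x y, D a b (W x y) = (if x = b then W a y else 0) + (if y = b then W a x else 0)

section Hit
variable {α β R : Type*} [Fintype α] [Fintype β] [DecidableEq α] [DecidableEq β] [CommRing R]
  [Algebra ℝ R] {W : Matrix (α × β) (α × β) R} {D : α × β → α × β → Derivation ℝ R R}

lemma hit_zero (h : IsLieAction W D) (u v : Matrix (α × β) (α × β) R) (a b r s : α × β) :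
    (u * (letterMat W 0).map (D a b) * v) r s = u r b * (W * v) a s + (u * W) r a * v b s := by
  have hs : ∀ x, W a x = W x a := fun x => congrFun (congrFun h.symm x) a
  rw [letterMat_zero, Matrix.mul_assoc, Matrix.mul_apply]
  simp only [Matrix.mul_apply, Matrix.map_apply, h.apply, add_mul, ite_mul, zero_mul,
    Finset.sum_add_distrib, Finset.sum_ite_eq', Finset.mem_univ, if_true, mul_add, Finset.sum_ite_irrel,
    Finset.sum_const_zero, mul_ite, mul_zero]
  congr 1
  rw [Finset.sum_mul]
  exact Finset.sum_congr rfl fun x _ => by rw [hs]; ring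

/-- Partial transposition exchanges the second indices of the two ends of the letter. The index `b`
therefore fixes the first half of one end and the second half of the other, and two half indices
remain to be summed. -/
lemma hit_one (h : IsLieAction W D) (u v : Matrix (α × β) (α × β) R) (a b r s : α × β) :
    (u * (letterMat W 1).map (D a b) * v) r s =
      (∑ x, ∑ y, u r (b.1, x) * W a (y, x) * v (y, b.2) s) +
        ∑ x, ∑ y, u r (x, b.2) * W a (x, y) * v (b.1, y) s := by
  rw [letterMat_one, Matrix.mul_assoc, Matrix.mul_apply]
  simp only [Matrix.mul_apply, Matrix.map_apply, rightPartialTranspose, Matrix.of_apply, h.apply,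
    Fintype.sum_prod_type, add_mul, mul_add, Finset.sum_add_distrib]
  obtain ⟨b₁, b₂⟩ := b
  simp only [Prod.mk.injEq, ite_and, ite_mul, zero_mul]
  congr 1
  · simp only [Finset.sum_ite_irrel, Finset.sum_const_zero, Finset.sum_ite_eq', Finset.mem_univ,
      if_true, mul_ite, mul_zero, Finset.mul_sum]
    exact Finset.sum_congr rfl fun x _ => Finset.sum_congr rfl fun y _ => by ring
  · simp only [Finset.sum_ite_irrel, Finset.sum_const_zero, Finset.sum_ite_eq', Finset.mem_univ,
      if_true, mul_ite, mul_zero, Finset.mul_sum]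
    exact Finset.sum_congr rfl fun x _ => Finset.sum_congr rfl fun y _ => by ring

end Hit

/-! ### Cauchy–Schwarz bounds for tensor networks. -/

section Networks
variable {A B C D E F : Type*} [Fintype A] [Fintype B] [Fintype C] [Fintype D] [Fintype E]
  [Fintype F]

/-- The squared Hilbert–Schmidt norm. -/
def sqNorm (f : A → B → ℝ) : ℝ := ∑ a, ∑ b, f a b ^ 2

lemma sqNorm_nonneg (f : A → B → ℝ) : 0 ≤ sqNorm f :=
  Finset.sum_nonneg fun _ _ => Finset.sum_nonneg fun _ _ => sq_nonneg _

lemma sqNorm_swap (f : A → B → ℝ) : sqNorm (fun b a => f a b) = sqNorm f := Finset.sum_comm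

lemma sum_mul_sq_le (f g : A → B → ℝ) :
    (∑ a, ∑ b, f a b * g a b) ^ 2 ≤ sqNorm f * sqNorm g := by
  have h := Finset.sum_mul_sq_le_sq_mul_sq Finset.univ (fun t : A × B => f t.1 t.2)
    fun t => g t.1 t.2
  simpa only [Fintype.sum_prod_type, sqNorm] using h

lemma sqNorm_comp_le (f : A → B → ℝ) (g : A → C → ℝ) :
    sqNorm (fun b c => ∑ a, f a b * g a c) ≤ sqNorm f * sqNorm g := by
  calc sqNorm (fun b c => ∑ a, f a b * g a c)
      ≤ ∑ b, ∑ c, (∑ a, f a b ^ 2) * ∑ a, g a c ^ 2 :=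
        Finset.sum_le_sum fun b _ => Finset.sum_le_sum fun c _ =>
          Finset.sum_mul_sq_le_sq_mul_sq _ _ _
    _ = sqNorm f * sqNorm g := by
        rw [← sqNorm_swap f, ← sqNorm_swap g]
        simp only [sqNorm, Finset.sum_mul_sum]

lemma sum_triangle_sq_le (f : A → B → ℝ) (g : A → C → ℝ) (h : B → C → ℝ) :
    (∑ a, ∑ b, ∑ c, f a b * g a c * h b c) ^ 2 ≤ sqNorm f * sqNorm g * sqNorm h := by
  have e : ∑ a, ∑ b, ∑ c, f a b * g a c * h b c =
      ∑ b, ∑ c, (∑ a, f a b * g a c) * h b c := by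
    simp only [Finset.sum_mul]
    rw [Finset.sum_comm]
    exact Finset.sum_congr rfl fun _ _ => Finset.sum_comm
  rw [e]
  exact (sum_mul_sq_le _ _).trans
    (mul_le_mul_of_nonneg_right (sqNorm_comp_le f g) (sqNorm_nonneg h))

lemma sqNorm_prod (f : A → B × C → ℝ) : sqNorm f = ∑ a, ∑ b, ∑ c, f a (b, c) ^ 2 := by
  simp only [sqNorm, Fintype.sum_prod_type]

/-- Four tensors, each pair sharing one index. Contract `f` with `g` and `h` with `k`, apply
Cauchy–Schwarz to the two results, and bound each contraction separately. Degenerate networks arise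
by taking an index type to be `Unit` or a product. -/
lemma sum_tetrahedron_sq_le (f : A → B → C → ℝ) (g : A → D → E → ℝ) (h : F → B → D → ℝ)
    (k : F → C → E → ℝ) :
    (∑ t : A × B × C × D × E × F, f t.1 t.2.1 t.2.2.1 * g t.1 t.2.2.2.1 t.2.2.2.2.1 *
      h t.2.2.2.2.2 t.2.1 t.2.2.2.1 * k t.2.2.2.2.2 t.2.2.1 t.2.2.2.2.1) ^ 2 ≤
      (∑ a, ∑ b, ∑ c, f a b c ^ 2) * (∑ a, ∑ b, ∑ c, g a b c ^ 2) *
        (∑ a, ∑ b, ∑ c, h a b c ^ 2) * (∑ a, ∑ b, ∑ c, k a b c ^ 2) := by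
  have e : ∑ t : A × B × C × D × E × F, f t.1 t.2.1 t.2.2.1 * g t.1 t.2.2.2.1 t.2.2.2.2.1 *
      h t.2.2.2.2.2 t.2.1 t.2.2.2.1 * k t.2.2.2.2.2 t.2.2.1 t.2.2.2.2.1 =
      ∑ p : B × C, ∑ q : D × E, (∑ a, f a p.1 p.2 * g a q.1 q.2) *
        ∑ z, h z p.1 q.1 * k z p.2 q.2 := by
    simp only [Finset.sum_mul_sum]
    rw [← Fintype.sum_prod_type' (f := fun (p : B × C) (q : D × E) =>
      ∑ a, ∑ z, f a p.1 p.2 * g a q.1 q.2 * (h z p.1 q.1 * k z p.2 q.2))]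
    have e2 : ∑ x : (B × C) × D × E, ∑ a, ∑ z, f a x.1.1 x.1.2 * g a x.2.1 x.2.2 *
        (h z x.1.1 x.2.1 * k z x.1.2 x.2.2) = ∑ x : ((B × C) × D × E) × A × F,
        f x.2.1 x.1.1.1 x.1.1.2 * g x.2.1 x.1.2.1 x.1.2.2 *
        (h x.2.2 x.1.1.1 x.1.2.1 * k x.2.2 x.1.1.2 x.1.2.2) := by
      simp only [Fintype.sum_prod_type]
    rw [e2]
    refine Fintype.sum_equiv ⟨fun t => (((t.2.1, t.2.2.1), t.2.2.2.1, t.2.2.2.2.1), t.1,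
      t.2.2.2.2.2), fun x => (x.2.1, x.1.1.1, x.1.1.2, x.1.2.1, x.1.2.2, x.2.2),
      fun _ => rfl, fun _ => rfl⟩ _ _ fun t => ?_
    simp only [Equiv.coe_fn_mk]
    ring
  rw [e]
  refine (sum_mul_sq_le _ _).trans ?_
  have h1 := sqNorm_comp_le (fun a (p : B × C) => f a p.1 p.2) (fun a (q : D × E) => g a q.1 q.2)
  have h2 := sqNorm_comp_le (fun z (p : B × D) => h z p.1 p.2) (fun z (q : C × E) => k z q.1 q.2)
  -- A Hilbert–Schmidt norm does not depend on how the four free indices are grouped into rows and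
  -- columns; the second grouping is the one in which `h` and `k` appear as matrices.
  have h3 : sqNorm (fun (p : B × C) (q : D × E) => ∑ z, h z p.1 q.1 * k z p.2 q.2) =
      sqNorm (fun (p : B × D) (q : C × E) => ∑ z, h z p.1 p.2 * k z q.1 q.2) := by
    simp only [sqNorm, Fintype.sum_prod_type]
    exact Finset.sum_congr rfl fun _ _ => Finset.sum_comm
  rw [h3, mul_assoc _ _ (∑ a, ∑ b, ∑ c, k a b c ^ 2)]
  rw [sqNorm_prod (fun a (p : B × C) => f a p.1 p.2),
    sqNorm_prod (fun a (q : D × E) => g a q.1 q.2)] at h1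
  rw [sqNorm_prod (fun z (p : B × D) => h z p.1 p.2),
    sqNorm_prod (fun z (q : C × E) => k z q.1 q.2)] at h2
  exact mul_le_mul h1 h2 (sqNorm_nonneg _) (by positivity)

end Networks

section PartialTraces
variable {α β : Type*} [Fintype α] [Fintype β]

/-- Cauchy–Schwarz over the traced index costs its range, and the entries that occur are among those
of the diagonal blocks. -/
lemma sqNorm_traceFst_le (A : Matrix (α × β) (α × β) ℝ) :
    sqNorm (traceFst A) ≤ Fintype.card α * sqNorm A := by
  have h : ∀ i j, (traceFst A i j) ^ 2 ≤ Fintype.card α * ∑ c, A (c, i) (c, j) ^ 2 := fun i j =>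
    sq_sum_le_card_mul_sum_sq
  have h2 : ∑ i, ∑ j, ∑ c, A (c, i) (c, j) ^ 2 ≤ sqNorm A := by
    simp only [sqNorm, Fintype.sum_prod_type]
    calc _ = ∑ i, ∑ c, ∑ j, A (c, i) (c, j) ^ 2 :=
          Finset.sum_congr rfl fun _ _ => Finset.sum_comm
      _ = ∑ c, ∑ i, ∑ j, A (c, i) (c, j) ^ 2 := Finset.sum_comm
      _ ≤ _ := Finset.sum_le_sum fun c _ => Finset.sum_le_sum fun i _ =>
          Finset.single_le_sum (f := fun d => ∑ j, A (c, i) (d, j) ^ 2)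
            (fun d _ => Finset.sum_nonneg fun j _ => sq_nonneg _) (Finset.mem_univ c)
  calc sqNorm (traceFst A) ≤ ∑ i, ∑ j, Fintype.card α * ∑ c, A (c, i) (c, j) ^ 2 :=
        Finset.sum_le_sum fun i _ => Finset.sum_le_sum fun j _ => h i j
    _ = Fintype.card α * ∑ i, ∑ j, ∑ c, A (c, i) (c, j) ^ 2 := by simp only [Finset.mul_sum]
    _ ≤ _ := mul_le_mul_of_nonneg_left h2 (Nat.cast_nonneg _)

lemma sqNorm_traceSnd_le (A : Matrix (α × β) (α × β) ℝ) :
    sqNorm (traceSnd A) ≤ Fintype.card β * sqNorm A := by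
  have h := sqNorm_traceFst_le (A.submatrix Prod.swap Prod.swap : Matrix (β × α) (β × α) ℝ)
  have e : sqNorm (A.submatrix Prod.swap Prod.swap : Matrix (β × α) (β × α) ℝ) = sqNorm A := by
    unfold sqNorm
    refine Fintype.sum_equiv (Equiv.prodComm β α) _ _ fun x => ?_
    exact Fintype.sum_equiv (Equiv.prodComm β α) _ _ fun y => rfl
  rw [e] at h
  exact h

end PartialTraces

section Errors
variable {α β : Type*} [Fintype α] [Fintype β]

lemma fst_fst_sq_le (u v : Matrix (α × β) (α × β) ℝ) :
    (∑ i, ∑ j, traceFst u i j * traceFst v i j) ^ 2 ≤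
      Fintype.card α ^ 2 * (sqNorm u * sqNorm v) := by
  refine (sum_mul_sq_le _ _).trans ((mul_le_mul (sqNorm_traceFst_le u) (sqNorm_traceFst_le v)
    (sqNorm_nonneg _) (mul_nonneg (Nat.cast_nonneg _) (sqNorm_nonneg _))).trans (le_of_eq ?_))
  ring

lemma snd_snd_sq_le (u v : Matrix (α × β) (α × β) ℝ) :
    (∑ i, ∑ j, traceSnd u i j * traceSnd v i j) ^ 2 ≤
      Fintype.card β ^ 2 * (sqNorm u * sqNorm v) := by
  refine (sum_mul_sq_le _ _).trans ((mul_le_mul (sqNorm_traceSnd_le u) (sqNorm_traceSnd_le v)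
    (sqNorm_nonneg _) (mul_nonneg (Nat.cast_nonneg _) (sqNorm_nonneg _))).trans (le_of_eq ?_))
  ring

/-- The network without partial traces that comes with two transposed letters. -/
def crossSum {R : Type*} [CommRing R] (u W v : Matrix (α × β) (α × β) R) : R :=
  ∑ a : α × β, ∑ b : α × β, ∑ x, ∑ y,
    u (b.1, a.2) (x, b.2) * W a (x, y) * v (b.1, y) (a.1, b.2)

/-- The network is a triangle with composite edges: `u` and `W` share `(a.2, x)`, `u` and `v` share
`b`, `W` and `v` share `(a.1, y)`. -/
lemma crossSum_sq_le (u W v : Matrix (α × β) (α × β) ℝ) :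
    crossSum u W v ^ 2 ≤ sqNorm u * sqNorm W * sqNorm v := by
  have h := sum_triangle_sq_le (A := β × α) (B := α × β) (C := α × β)
    (fun p q => u (q.1, p.1) (p.2, q.2)) (fun p r => W (r.1, p.1) (p.2, r.2))
    (fun q r => v (q.1, r.2) (r.1, q.2))
  have e1 : sqNorm (fun (p : β × α) (q : α × β) => u (q.1, p.1) (p.2, q.2)) = sqNorm u := by
    simp only [sqNorm, ← Fintype.sum_prod_type']
    exact Fintype.sum_equiv ⟨fun t => ((t.2.1, t.1.1), (t.1.2, t.2.2)),
      fun t => ((t.1.2, t.2.1), (t.1.1, t.2.2)), fun _ => rfl, fun _ => rfl⟩ _ _ fun _ => rfl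
  have e2 : sqNorm (fun (p : β × α) (q : α × β) => W (q.1, p.1) (p.2, q.2)) = sqNorm W := by
    simp only [sqNorm, ← Fintype.sum_prod_type']
    exact Fintype.sum_equiv ⟨fun t => ((t.2.1, t.1.1), (t.1.2, t.2.2)),
      fun t => ((t.1.2, t.2.1), (t.1.1, t.2.2)), fun _ => rfl, fun _ => rfl⟩ _ _ fun _ => rfl
  have e3 : sqNorm (fun (p : α × β) (q : α × β) => v (p.1, q.2) (q.1, p.2)) = sqNorm v := by
    simp only [sqNorm, ← Fintype.sum_prod_type']
    exact Fintype.sum_equiv ⟨fun t => ((t.1.1, t.2.2), (t.2.1, t.1.2)),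
      fun t => ((t.1.1, t.2.2), (t.2.1, t.1.2)), fun _ => rfl, fun _ => rfl⟩ _ _ fun _ => rfl
  rw [e1, e2, e3] at h
  refine (le_of_eq ?_).trans h
  congr 1
  calc crossSum u W v = ∑ t : (α × β) × (α × β) × α × β,
        u (t.2.1.1, t.1.2) (t.2.2.1, t.2.1.2) * W t.1 (t.2.2.1, t.2.2.2) *
          v (t.2.1.1, t.2.2.2) (t.1.1, t.2.1.2) := by simp only [crossSum, Fintype.sum_prod_type]
    _ = ∑ t : (β × α) × (α × β) × α × β,
        u (t.2.1.1, t.1.1) (t.1.2, t.2.1.2) * W (t.2.2.1, t.1.1) (t.1.2, t.2.2.2) *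
          v (t.2.1.1, t.2.2.2) (t.2.2.1, t.2.1.2) :=
      Fintype.sum_equiv ⟨fun t => ((t.1.2, t.2.2.1), t.2.1, t.1.1, t.2.2.2),
        fun t => ((t.2.2.1, t.1.1), t.2.1, t.1.2, t.2.2.2), fun _ => rfl, fun _ => rfl⟩ _ _
        fun _ => rfl
    _ = _ := by simp only [Fintype.sum_prod_type]

end Errors

/-! ### Error networks of the second integration by parts. -/

section MainErrors
variable {α β : Type*} [Fintype α] [Fintype β]

lemma net_fst_zero_left (u x : Matrix (α × β) (α × β) ℝ) (V : Matrix α α ℝ) :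
    (∑ a : α × β, ∑ b : α × β, (∑ c, u (c, a.2) b * x a (c, b.2)) * V b.1 a.1) ^ 2 ≤
      sqNorm u * sqNorm x * sqNorm V := by
  have h := sum_triangle_sq_le (A := α × β × β) (B := α) (C := α)
    (fun p b => u (p.1, p.2.1) (b, p.2.2)) (fun p a => x (a, p.2.1) (p.1, p.2.2))
    (fun b a => V b a)
  have e1 : sqNorm (fun (p : α × β × β) (b : α) => u (p.1, p.2.1) (b, p.2.2)) = sqNorm u := by
    simp only [sqNorm, Fintype.sum_prod_type]
    exact Finset.sum_congr rfl fun _ _ => Finset.sum_congr rfl fun _ _ => Finset.sum_comm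
  have e2 : sqNorm (fun (p : α × β × β) (a : α) => x (a, p.2.1) (p.1, p.2.2)) = sqNorm x := by
    rw [← sqNorm_swap]
    simp only [sqNorm, Fintype.sum_prod_type]
    exact Finset.sum_congr rfl fun _ _ => Finset.sum_comm
  rw [e1, e2] at h
  refine (le_of_eq ?_).trans h
  congr 1
  calc _ = ∑ t : (α × β) × (α × β) × α,
        u (t.2.2, t.1.2) t.2.1 * x t.1 (t.2.2, t.2.1.2) * V t.2.1.1 t.1.1 := by
        simp only [Fintype.sum_prod_type, Finset.sum_mul]
    _ = ∑ t : (α × β × β) × α × α, u (t.1.1, t.1.2.1) (t.2.1, t.1.2.2) *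
          x (t.2.2, t.1.2.1) (t.1.1, t.1.2.2) * V t.2.1 t.2.2 :=
      Fintype.sum_equiv ⟨fun t => ((t.2.2, t.1.2, t.2.1.2), t.2.1.1, t.1.1),
        fun t => ((t.2.2, t.1.2.1), (t.2.1, t.1.2.2), t.1.1), fun _ => rfl, fun _ => rfl⟩ _ _
        fun _ => rfl
    _ = _ := by simp only [Fintype.sum_prod_type]

lemma net_fst_zero_right (x u : Matrix (α × β) (α × β) ℝ) (V : Matrix α α ℝ) :
    (∑ a : α × β, ∑ b : α × β, (∑ c, x (c, a.2) a * u b (c, b.2)) * V b.1 a.1) ^ 2 ≤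
      sqNorm (traceSnd x) * sqNorm (traceSnd u) * sqNorm V := by
  have h := sum_triangle_sq_le (traceSnd x) (fun c b => traceSnd u b c) (fun a b => V b a)
  rw [sqNorm_swap (traceSnd u), sqNorm_swap V] at h
  refine (le_of_eq ?_).trans h
  congr 1
  calc _ = ∑ t : (α × β) × (α × β) × α,
        x (t.2.2, t.1.2) t.1 * u t.2.1 (t.2.2, t.2.1.2) * V t.2.1.1 t.1.1 := by
        simp only [Fintype.sum_prod_type, Finset.sum_mul]
    _ = ∑ t : α × α × α × β × β, x (t.1, t.2.2.2.1) (t.2.1, t.2.2.2.1) *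
          u (t.2.2.1, t.2.2.2.2) (t.1, t.2.2.2.2) * V t.2.2.1 t.2.1 :=
      Fintype.sum_equiv ⟨fun t => (t.2.2, t.1.1, t.2.1.1, t.1.2, t.2.1.2),
        fun t => ((t.2.1, t.2.2.2.1), (t.2.2.1, t.2.2.2.2), t.1), fun _ => rfl, fun _ => rfl⟩ _ _
        fun _ => rfl
    _ = _ := by
        simp only [Fintype.sum_prod_type, traceSnd, Matrix.of_apply, Finset.sum_mul_sum]
        simp only [Finset.sum_mul]

/-- The index `b.2` occurs only in `v` and turns it into a partial trace. What remains is a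
tetrahedron in which `traceSnd v` and `V` share no index, whence the edge `Unit`. -/
lemma net_fst_one_left (u W v : Matrix (α × β) (α × β) ℝ) (V : Matrix α α ℝ) :
    (∑ a : α × β, ∑ b : α × β,
      (∑ c, ∑ x, ∑ y, u (c, a.2) (b.1, x) * W a (y, x) * v (y, b.2) (c, b.2)) * V b.1 a.1) ^ 2 ≤
      sqNorm u * sqNorm W * sqNorm (traceSnd v) * sqNorm V := by
  have h := sum_tetrahedron_sq_le (A := β × β) (B := α) (C := α) (D := α) (E := α) (F := Unit)
    (fun A B C => u (B, A.1) (C, A.2)) (fun A D E => W (E, A.1) (D, A.2))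
    (fun _ B D => traceSnd v D B) (fun _ C E => V C E)
  have e1 : ∑ A : β × β, ∑ B, ∑ C, u (B, A.1) (C, A.2) ^ 2 = sqNorm u := by
    calc _ = ∑ t : (β × β) × α × α, u (t.2.1, t.1.1) (t.2.2, t.1.2) ^ 2 := by
          simp only [Fintype.sum_prod_type]
      _ = ∑ t : (α × β) × (α × β), u t.1 t.2 ^ 2 :=
        Fintype.sum_equiv ⟨fun t => ((t.2.1, t.1.1), t.2.2, t.1.2),
          fun t => ((t.1.2, t.2.2), t.1.1, t.2.1), fun _ => rfl, fun _ => rfl⟩ _ _ fun _ => rfl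
      _ = _ := by simp only [sqNorm, Fintype.sum_prod_type]
  have e2 : ∑ A : β × β, ∑ D, ∑ E, W (E, A.1) (D, A.2) ^ 2 = sqNorm W := by
    calc _ = ∑ t : (β × β) × α × α, W (t.2.2, t.1.1) (t.2.1, t.1.2) ^ 2 := by
          simp only [Fintype.sum_prod_type]
      _ = ∑ t : (α × β) × (α × β), W t.1 t.2 ^ 2 :=
        Fintype.sum_equiv ⟨fun t => ((t.2.2, t.1.1), t.2.1, t.1.2),
          fun t => ((t.1.2, t.2.2), t.2.1, t.1.1), fun _ => rfl, fun _ => rfl⟩ _ _ fun _ => rfl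
      _ = _ := by simp only [sqNorm, Fintype.sum_prod_type]
  have e3 : ∑ _ : Unit, ∑ B, ∑ D, traceSnd v D B ^ 2 = sqNorm (traceSnd v) := by
    rw [Fintype.sum_unique]; exact sqNorm_swap _
  have e4 : ∑ _ : Unit, ∑ C, ∑ E, V C E ^ 2 = sqNorm V := by simp [sqNorm]
  rw [e1, e2, e3, e4] at h
  refine (le_of_eq ?_).trans h
  congr 1
  calc _ = ∑ t : (α × β) × (α × β) × α × β × α,
        u (t.2.2.1, t.1.2) (t.2.1.1, t.2.2.2.1) * W t.1 (t.2.2.2.2, t.2.2.2.1) *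
          v (t.2.2.2.2, t.2.1.2) (t.2.2.1, t.2.1.2) * V t.2.1.1 t.1.1 := by
        simp only [Fintype.sum_prod_type, Finset.sum_mul]
    _ = ∑ t : ((β × β) × α × α × α × α × Unit) × β,
        u (t.1.2.1, t.1.1.1) (t.1.2.2.1, t.1.1.2) *
          W (t.1.2.2.2.2.1, t.1.1.1) (t.1.2.2.2.1, t.1.1.2) *
          v (t.1.2.2.2.1, t.2) (t.1.2.1, t.2) * V t.1.2.2.1 t.1.2.2.2.2.1 :=
      Fintype.sum_equiv ⟨fun t => (((t.1.2, t.2.2.2.1), t.2.2.1, t.2.1.1, t.2.2.2.2, t.1.1, ()),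
          t.2.1.2),
        fun t => ((t.1.2.2.2.2.1, t.1.1.1), (t.1.2.2.1, t.2), t.1.2.1, t.1.1.2, t.1.2.2.2.1),
        fun _ => rfl, fun _ => rfl⟩ _ _ fun _ => rfl
    _ = _ := by
        rw [Fintype.sum_prod_type]
        simp only [traceSnd, Matrix.of_apply, Finset.mul_sum, Finset.sum_mul]

/-- No index is confined to one matrix here, so no partial trace is split off. The missing edge of
the tetrahedron is the one between `u` and `V`. -/
lemma net_fst_one_right (u W v : Matrix (α × β) (α × β) ℝ) (V : Matrix α α ℝ) :
    (∑ a : α × β, ∑ b : α × β,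
      (∑ c, ∑ x, ∑ y, u (c, a.2) (x, b.2) * W a (x, y) * v (b.1, y) (c, b.2)) * V b.1 a.1) ^ 2 ≤
      sqNorm u * sqNorm W * sqNorm v * sqNorm V := by
  have h := sum_tetrahedron_sq_le (A := β × α) (B := α × β) (C := Unit) (D := β) (E := α) (F := α)
    (fun A B _ => u (B.1, A.1) (A.2, B.2)) (fun A D E => W (E, A.1) (A.2, D))
    (fun F B D => v (F, D) B) (fun F _ E => V F E)
  have e1 : ∑ A : β × α, ∑ B : α × β, ∑ _ : Unit, u (B.1, A.1) (A.2, B.2) ^ 2 = sqNorm u := by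
    calc _ = ∑ t : (β × α) × (α × β), u (t.2.1, t.1.1) (t.1.2, t.2.2) ^ 2 := by
          simp only [Fintype.sum_prod_type, Finset.univ_unique, Finset.sum_singleton]
      _ = ∑ t : (α × β) × (α × β), u t.1 t.2 ^ 2 :=
        Fintype.sum_equiv ⟨fun t => ((t.2.1, t.1.1), t.1.2, t.2.2),
          fun t => ((t.1.2, t.2.1), t.1.1, t.2.2), fun _ => rfl, fun _ => rfl⟩ _ _ fun _ => rfl
      _ = _ := by simp only [sqNorm, Fintype.sum_prod_type]
  have e2 : ∑ A : β × α, ∑ D, ∑ E, W (E, A.1) (A.2, D) ^ 2 = sqNorm W := by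
    calc _ = ∑ t : (β × α) × β × α, W (t.2.2, t.1.1) (t.1.2, t.2.1) ^ 2 := by
          simp only [Fintype.sum_prod_type]
      _ = ∑ t : (α × β) × (α × β), W t.1 t.2 ^ 2 :=
        Fintype.sum_equiv ⟨fun t => ((t.2.2, t.1.1), t.1.2, t.2.1),
          fun t => ((t.1.2, t.2.1), t.2.2, t.1.1), fun _ => rfl, fun _ => rfl⟩ _ _ fun _ => rfl
      _ = _ := by simp only [sqNorm, Fintype.sum_prod_type]
  have e3 : ∑ F : α, ∑ B : α × β, ∑ D, v (F, D) B ^ 2 = sqNorm v := by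
    simp only [sqNorm, Fintype.sum_prod_type (f := fun x : α × β => ∑ y, v x y ^ 2)]
    exact Finset.sum_congr rfl fun _ _ => Finset.sum_comm
  have e4 : ∑ F : α, ∑ _ : Unit, ∑ E, V F E ^ 2 = sqNorm V := by simp [sqNorm]
  rw [e1, e2, e3, e4] at h
  refine (le_of_eq ?_).trans h
  congr 1
  calc _ = ∑ t : (α × β) × (α × β) × α × α × β,
        u (t.2.2.1, t.1.2) (t.2.2.2.1, t.2.1.2) * W t.1 (t.2.2.2.1, t.2.2.2.2) *
          v (t.2.1.1, t.2.2.2.2) (t.2.2.1, t.2.1.2) * V t.2.1.1 t.1.1 := by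
        simp only [Fintype.sum_prod_type, Finset.sum_mul]
    _ = _ :=
      Fintype.sum_equiv ⟨fun t => ((t.1.2, t.2.2.2.1), (t.2.2.1, t.2.1.2), (), t.2.2.2.2, t.1.1,
          t.2.1.1),
        fun t => ((t.2.2.2.2.1, t.1.1), (t.2.2.2.2.2, t.2.1.2), t.2.1.1, t.1.2, t.2.2.2.1),
        fun _ => rfl, fun _ => rfl⟩ _ _ fun _ => rfl

lemma net_snd_zero_left (v x : Matrix (α × β) (α × β) ℝ) (U : Matrix β β ℝ) :
    (∑ a : α × β, ∑ b : α × β, U a.2 b.2 * ∑ c, v (b.1, c) b * x a (a.1, c)) ^ 2 ≤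
      sqNorm (traceFst v) * sqNorm (traceFst x) * sqNorm U := by
  have h := sum_triangle_sq_le (traceFst v) (fun c a => traceFst x a c) (fun b a => U a b)
  rw [sqNorm_swap (traceFst x), sqNorm_swap U] at h
  refine (le_of_eq ?_).trans h
  congr 1
  calc _ = ∑ t : (α × β) × (α × β) × β,
        U t.1.2 t.2.1.2 * (v (t.2.1.1, t.2.2) t.2.1 * x t.1 (t.1.1, t.2.2)) := by
        simp only [Fintype.sum_prod_type, Finset.mul_sum]
    _ = ∑ t : β × β × β × α × α, v (t.2.2.2.1, t.1) (t.2.2.2.1, t.2.1) *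
          x (t.2.2.2.2, t.2.2.1) (t.2.2.2.2, t.1) * U t.2.2.1 t.2.1 :=
      Fintype.sum_equiv ⟨fun t => (t.2.2, t.2.1.2, t.1.2, t.2.1.1, t.1.1),
        fun t => ((t.2.2.2.2, t.2.2.1), (t.2.2.2.1, t.2.1), t.1), fun _ => rfl, fun _ => rfl⟩ _ _
        fun _ => mul_comm _ _
    _ = _ := by
        simp only [Fintype.sum_prod_type, traceFst, Matrix.of_apply, Finset.sum_mul_sum]
        simp only [Finset.sum_mul]

lemma net_snd_zero_right (x v : Matrix (α × β) (α × β) ℝ) (U : Matrix β β ℝ) :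
    (∑ a : α × β, ∑ b : α × β, U a.2 b.2 * ∑ c, x (b.1, c) a * v b (a.1, c)) ^ 2 ≤
      sqNorm x * sqNorm v * sqNorm U := by
  have h := sum_triangle_sq_le (A := α × β × α) (B := β) (C := β)
    (fun p a => x (p.1, p.2.1) (p.2.2, a)) (fun p b => v (p.1, b) (p.2.2, p.2.1))
    (fun a b => U a b)
  have e1 : sqNorm (fun (p : α × β × α) (a : β) => x (p.1, p.2.1) (p.2.2, a)) = sqNorm x := by
    simp only [sqNorm, Fintype.sum_prod_type]
  have e2 : sqNorm (fun (p : α × β × α) (b : β) => v (p.1, b) (p.2.2, p.2.1)) = sqNorm v := by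
    calc _ = ∑ t : (α × β × α) × β, v (t.1.1, t.2) (t.1.2.2, t.1.2.1) ^ 2 := by
          simp only [sqNorm, Fintype.sum_prod_type]
      _ = ∑ t : (α × β) × (α × β), v t.1 t.2 ^ 2 :=
        Fintype.sum_equiv ⟨fun t => ((t.1.1, t.2), t.1.2.2, t.1.2.1),
          fun t => ((t.1.1, t.2.2, t.2.1), t.1.2), fun _ => rfl, fun _ => rfl⟩ _ _ fun _ => rfl
      _ = _ := by simp only [sqNorm, Fintype.sum_prod_type]
  rw [e1, e2] at h
  refine (le_of_eq ?_).trans h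
  congr 1
  calc _ = ∑ t : (α × β) × (α × β) × β,
        U t.1.2 t.2.1.2 * (x (t.2.1.1, t.2.2) t.1 * v t.2.1 (t.1.1, t.2.2)) := by
        simp only [Fintype.sum_prod_type, Finset.mul_sum]
    _ = ∑ t : (α × β × α) × β × β, x (t.1.1, t.1.2.1) (t.1.2.2, t.2.1) *
          v (t.1.1, t.2.2) (t.1.2.2, t.1.2.1) * U t.2.1 t.2.2 :=
      Fintype.sum_equiv ⟨fun t => ((t.2.1.1, t.2.2, t.1.1), t.1.2, t.2.1.2),
        fun t => ((t.1.2.2, t.2.1), (t.1.1, t.2.2), t.1.2.1), fun _ => rfl, fun _ => rfl⟩ _ _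
        fun _ => mul_comm _ _
    _ = _ := by simp only [Fintype.sum_prod_type]

lemma net_snd_one_left (v W z : Matrix (α × β) (α × β) ℝ) (U : Matrix β β ℝ) :
    (∑ a : α × β, ∑ b : α × β, U a.2 b.2 *
      ∑ c, ∑ x, ∑ y, v (b.1, c) (b.1, x) * W a (y, x) * z (y, b.2) (a.1, c)) ^ 2 ≤
      sqNorm W * sqNorm z * sqNorm (traceFst v) * sqNorm U := by
  have h := sum_tetrahedron_sq_le (A := α × α) (B := β) (C := β) (D := β) (E := β) (F := Unit)
    (fun A B C => W (A.1, C) (A.2, B)) (fun A D E => z (A.2, E) (A.1, D))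
    (fun _ B D => traceFst v D B) (fun _ C E => U C E)
  have e1 : ∑ A : α × α, ∑ B, ∑ C, W (A.1, C) (A.2, B) ^ 2 = sqNorm W := by
    calc _ = ∑ t : (α × α) × β × β, W (t.1.1, t.2.2) (t.1.2, t.2.1) ^ 2 := by
          simp only [Fintype.sum_prod_type]
      _ = ∑ t : (α × β) × (α × β), W t.1 t.2 ^ 2 :=
        Fintype.sum_equiv ⟨fun t => ((t.1.1, t.2.2), t.1.2, t.2.1),
          fun t => ((t.1.1, t.2.1), t.2.2, t.1.2), fun _ => rfl, fun _ => rfl⟩ _ _ fun _ => rfl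
      _ = _ := by simp only [sqNorm, Fintype.sum_prod_type]
  have e2 : ∑ A : α × α, ∑ D, ∑ E, z (A.2, E) (A.1, D) ^ 2 = sqNorm z := by
    calc _ = ∑ t : (α × α) × β × β, z (t.1.2, t.2.2) (t.1.1, t.2.1) ^ 2 := by
          simp only [Fintype.sum_prod_type]
      _ = ∑ t : (α × β) × (α × β), z t.1 t.2 ^ 2 :=
        Fintype.sum_equiv ⟨fun t => ((t.1.2, t.2.2), t.1.1, t.2.1),
          fun t => ((t.2.1, t.1.1), t.2.2, t.1.2), fun _ => rfl, fun _ => rfl⟩ _ _ fun _ => rfl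
      _ = _ := by simp only [sqNorm, Fintype.sum_prod_type]
  have e3 : ∑ _ : Unit, ∑ B, ∑ D, traceFst v D B ^ 2 = sqNorm (traceFst v) := by
    rw [Fintype.sum_unique]; exact sqNorm_swap _
  have e4 : ∑ _ : Unit, ∑ C, ∑ E, U C E ^ 2 = sqNorm U := by simp [sqNorm]
  rw [e1, e2, e3, e4] at h
  refine (le_of_eq ?_).trans h
  congr 1
  calc _ = ∑ t : (α × β) × (α × β) × β × β × α,
        U t.1.2 t.2.1.2 * (v (t.2.1.1, t.2.2.1) (t.2.1.1, t.2.2.2.1) *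
          W t.1 (t.2.2.2.2, t.2.2.2.1) * z (t.2.2.2.2, t.2.1.2) (t.1.1, t.2.2.1)) := by
        simp only [Fintype.sum_prod_type, Finset.mul_sum]
    _ = ∑ t : ((α × α) × β × β × β × β × Unit) × α,
        W (t.1.1.1, t.1.2.2.1) (t.1.1.2, t.1.2.1) *
          z (t.1.1.2, t.1.2.2.2.2.1) (t.1.1.1, t.1.2.2.2.1) *
          v (t.2, t.1.2.2.2.1) (t.2, t.1.2.1) * U t.1.2.2.1 t.1.2.2.2.2.1 :=
      Fintype.sum_equiv ⟨fun t => (((t.1.1, t.2.2.2.2), t.2.2.2.1, t.1.2, t.2.2.1, t.2.1.2, ()),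
          t.2.1.1),
        fun t => ((t.1.1.1, t.1.2.2.1), (t.2, t.1.2.2.2.2.1), t.1.2.2.2.1, t.1.2.1, t.1.1.2),
        fun _ => rfl, fun _ => rfl⟩ _ _ fun _ => by
          simp only [Equiv.coe_fn_mk]; ring
    _ = _ := by
        rw [Fintype.sum_prod_type]
        simp only [traceFst, Matrix.of_apply, Finset.mul_sum, Finset.sum_mul]

/-- Again a tetrahedron with one missing edge, now between `z` and `U`. -/
lemma net_snd_one_right (v W z : Matrix (α × β) (α × β) ℝ) (U : Matrix β β ℝ) :
    (∑ a : α × β, ∑ b : α × β, U a.2 b.2 *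
      ∑ c, ∑ x, ∑ y, v (b.1, c) (x, b.2) * W a (x, y) * z (b.1, y) (a.1, c)) ^ 2 ≤
      sqNorm v * sqNorm z * sqNorm W * sqNorm U := by
  have h := sum_tetrahedron_sq_le (A := α × β) (B := α) (C := β) (D := α × β) (E := Unit) (F := β)
    (fun A B C => v A (B, C)) (fun A D _ => z (A.1, D.2) (D.1, A.2))
    (fun F B D => W (D.1, F) (B, D.2)) (fun F C _ => U F C)
  have e1 : ∑ A : α × β, ∑ B, ∑ C, v A (B, C) ^ 2 = sqNorm v := (sqNorm_prod _).symm
  have e2 : ∑ A : α × β, ∑ D : α × β, ∑ _ : Unit, z (A.1, D.2) (D.1, A.2) ^ 2 = sqNorm z := by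
    calc _ = ∑ t : (α × β) × (α × β), z (t.1.1, t.2.2) (t.2.1, t.1.2) ^ 2 := by
          simp only [Fintype.sum_prod_type, Finset.univ_unique, Finset.sum_singleton]
      _ = ∑ t : (α × β) × (α × β), z t.1 t.2 ^ 2 :=
        Fintype.sum_equiv ⟨fun t => ((t.1.1, t.2.2), t.2.1, t.1.2),
          fun t => ((t.1.1, t.2.2), t.2.1, t.1.2), fun _ => rfl, fun _ => rfl⟩ _ _ fun _ => rfl
      _ = _ := by simp only [sqNorm, Fintype.sum_prod_type]
  have e3 : ∑ F : β, ∑ B : α, ∑ D : α × β, W (D.1, F) (B, D.2) ^ 2 = sqNorm W := by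
    calc _ = ∑ t : β × α × α × β, W (t.2.2.1, t.1) (t.2.1, t.2.2.2) ^ 2 := by
          simp only [Fintype.sum_prod_type]
      _ = ∑ t : (α × β) × (α × β), W t.1 t.2 ^ 2 :=
        Fintype.sum_equiv ⟨fun t => ((t.2.2.1, t.1), t.2.1, t.2.2.2),
          fun t => (t.1.2, t.2.1, t.1.1, t.2.2), fun _ => rfl, fun _ => rfl⟩ _ _ fun _ => rfl
      _ = _ := by simp only [sqNorm, Fintype.sum_prod_type]
  have e4 : ∑ F : β, ∑ C, ∑ _ : Unit, U F C ^ 2 = sqNorm U := by simp [sqNorm]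
  rw [e1, e2, e3, e4] at h
  refine (le_of_eq ?_).trans h
  congr 1
  calc _ = ∑ t : (α × β) × (α × β) × β × α × β,
        U t.1.2 t.2.1.2 * (v (t.2.1.1, t.2.2.1) (t.2.2.2.1, t.2.1.2) *
          W t.1 (t.2.2.2.1, t.2.2.2.2) * z (t.2.1.1, t.2.2.2.2) (t.1.1, t.2.2.1)) := by
        simp only [Fintype.sum_prod_type, Finset.mul_sum]
    _ = _ :=
      Fintype.sum_equiv ⟨fun t => ((t.2.1.1, t.2.2.1), t.2.2.2.1, t.2.1.2, (t.1.1, t.2.2.2.2), (),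
          t.1.2),
        fun t => ((t.2.2.2.1.1, t.2.2.2.2.2), (t.1.1, t.2.2.1), t.1.2, t.2.1, t.2.2.2.1.2),
        fun _ => rfl, fun _ => rfl⟩ _ _ fun _ => by
          simp only [Equiv.coe_fn_mk]; ring

end MainErrors

/-! ### Main terms and error terms from hitting one letter. -/

section HitSums
variable {α β R : Type*} [Fintype α] [Fintype β] [DecidableEq α] [DecidableEq β] [CommRing R]
  [Algebra ℝ R]

/-- The contribution of a letter `e` between `u` and `v` when the first letter is `0`. -/
def loopHit (W : Matrix (α × β) (α × β) R) (D : α × β → α × β → Derivation ℝ R R) (e : Fin 2)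
    (u v : Matrix (α × β) (α × β) R) : R :=
  ∑ a, ∑ b, (u * (letterMat W e).map (D a b) * v) b a

/-- The contribution of a letter `e` between `u` and `v` when the first letter is `1`. -/
def twistHit (W : Matrix (α × β) (α × β) R) (D : α × β → α × β → Derivation ℝ R R) (e : Fin 2)
    (u v : Matrix (α × β) (α × β) R) : R :=
  ∑ a : α × β, ∑ b : α × β, (u * (letterMat W e).map (D a b) * v) (b.1, a.2) (a.1, b.2)

/-- The contribution of a letter `e` between `u` and `v` inside the first partial trace. -/
def fstHit (W : Matrix (α × β) (α × β) R) (D : α × β → α × β → Derivation ℝ R R) (e : Fin 2)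
    (u v : Matrix (α × β) (α × β) R) (V : Matrix α α R) : R :=
  ∑ a : α × β, ∑ b : α × β,
    traceFst (u * (letterMat W e).map (D a b) * v) a.2 b.2 * V b.1 a.1

/-- The contribution of a letter `e` between `u` and `v` inside the second partial trace. -/
def sndHit (W : Matrix (α × β) (α × β) R) (D : α × β → α × β → Derivation ℝ R R) (e : Fin 2)
    (u v : Matrix (α × β) (α × β) R) (U : Matrix β β R) : R :=
  ∑ a : α × β, ∑ b : α × β,
    U a.2 b.2 * traceSnd (u * (letterMat W e).map (D a b) * v) b.1 a.1

/-- The contraction of `W` with both partial traces. -/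
def mainSum (u W v : Matrix (α × β) (α × β) R) : R :=
  ∑ a : α × β, ∑ b : α × β, W a b * (traceFst u a.2 b.2 * traceSnd v b.1 a.1)

lemma traceFst_map {α β R : Type*} [Fintype α] [CommRing R] (f : R →+* ℝ) (A : Matrix (α × β) (α × β) R) :
    (traceFst A).map f = traceFst (A.map f) := by
  ext i j; simp [traceFst]

lemma traceSnd_map {α β R : Type*} [Fintype β] [CommRing R] (f : R →+* ℝ) (A : Matrix (α × β) (α × β) R) :
    (traceSnd A).map f = traceSnd (A.map f) := by
  ext i j; simp [traceSnd]

lemma add_sq_le_of_le {x y a b : ℝ} (h1 : x ^ 2 ≤ a) (h2 : y ^ 2 ≤ b) :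
    (x + y) ^ 2 ≤ 2 * a + 2 * b := by
  nlinarith [sq_nonneg (x - y)]

variable {W : Matrix (α × β) (α × β) R} {D : α × β → α × β → Derivation ℝ R R}
  (h : IsLieAction W D) (f : R →+* ℝ) (u v : Matrix (α × β) (α × β) R)
include h

lemma loopHit_zero : loopHit W D 0 u v =
    u.trace * (W * v).trace + ∑ b, ∑ a, (u * W) b a * v b a := by
  simp only [loopHit, hit_zero h, Finset.sum_add_distrib]
  congr 1
  · simp only [Matrix.trace, Matrix.diag, Finset.sum_mul_sum]
    exact Finset.sum_comm
  · exact Finset.sum_comm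

/-- Hitting a transposed letter when the first letter is not transposed produces no full traces.
Each pairing of partial traces is of lower order than a product of two full traces, so the whole
contribution is an error. -/
lemma loopHit_one : loopHit W D 1 u v =
    (∑ i, ∑ j, traceFst u i j * traceFst (v * W) i j) +
      ∑ i, ∑ j, traceSnd u i j * traceSnd (v * W) i j := by
  simp only [loopHit, hit_one h, Finset.sum_add_distrib]
  congr 1
  · calc _ = ∑ t : (α × β) × (α × β) × β × α,
          u t.2.1 (t.2.1.1, t.2.2.1) * W t.1 (t.2.2.2, t.2.2.1) * v (t.2.2.2, t.2.1.2) t.1 := by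
          simp only [Fintype.sum_prod_type]
      _ = ∑ t : β × β × α × α × α × β, u (t.2.2.1, t.1) (t.2.2.1, t.2.1) *
          (v (t.2.2.2.1, t.1) t.2.2.2.2 * W t.2.2.2.2 (t.2.2.2.1, t.2.1)) :=
        Fintype.sum_equiv ⟨fun t => (t.2.1.2, t.2.2.1, t.2.1.1, t.2.2.2, t.1),
          fun t => (t.2.2.2.2, (t.2.2.1, t.1), t.2.1, t.2.2.2.1), fun _ => rfl, fun _ => rfl⟩ _ _
          fun _ => by simp only [Equiv.coe_fn_mk]; ring
      _ = _ := by
        simp only [Fintype.sum_prod_type, traceFst, Matrix.of_apply, Finset.sum_mul_sum,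
          Matrix.mul_apply]
        simp only [Finset.mul_sum]
  · calc _ = ∑ t : (α × β) × (α × β) × α × β,
          u t.2.1 (t.2.2.1, t.2.1.2) * W t.1 (t.2.2.1, t.2.2.2) * v (t.2.1.1, t.2.2.2) t.1 := by
          simp only [Fintype.sum_prod_type]
      _ = ∑ t : α × α × β × β × α × β, u (t.1, t.2.2.1) (t.2.1, t.2.2.1) *
          (v (t.1, t.2.2.2.1) t.2.2.2.2 * W t.2.2.2.2 (t.2.1, t.2.2.2.1)) :=
        Fintype.sum_equiv ⟨fun t => (t.2.1.1, t.2.2.1, t.2.1.2, t.2.2.2, t.1),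
          fun t => (t.2.2.2.2, (t.1, t.2.2.1), t.2.1, t.2.2.2.1), fun _ => rfl, fun _ => rfl⟩ _ _
          fun _ => by simp only [Equiv.coe_fn_mk]; ring
      _ = _ := by
        simp only [Fintype.sum_prod_type, traceSnd, Matrix.of_apply, Finset.sum_mul_sum,
          Matrix.mul_apply]
        simp only [Finset.mul_sum]

lemma twistHit_zero : twistHit W D 0 u v =
    (∑ i, ∑ j, traceFst u i j * traceFst (W * v) i j) +
      ∑ i, ∑ j, traceSnd (u * W) i j * traceSnd v i j := by
  simp only [twistHit, hit_zero h, Finset.sum_add_distrib]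
  congr 1
  · calc _ = ∑ t : (α × β) × (α × β),
          u (t.2.1, t.1.2) t.2 * (W * v) t.1 (t.1.1, t.2.2) := by
          simp only [Fintype.sum_prod_type]
      _ = ∑ t : β × β × α × α, u (t.2.2.1, t.1) (t.2.2.1, t.2.1) *
          (W * v) (t.2.2.2, t.1) (t.2.2.2, t.2.1) :=
        Fintype.sum_equiv ⟨fun t => (t.1.2, t.2.2, t.2.1, t.1.1),
          fun t => ((t.2.2.2, t.1), t.2.2.1, t.2.1), fun _ => rfl, fun _ => rfl⟩ _ _ fun _ => rfl
      _ = _ := by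
        simp only [Fintype.sum_prod_type, traceFst, Matrix.of_apply, Finset.sum_mul_sum]
  · calc _ = ∑ t : (α × β) × (α × β),
          (u * W) (t.2.1, t.1.2) t.1 * v t.2 (t.1.1, t.2.2) := by
          simp only [Fintype.sum_prod_type]
      _ = ∑ t : α × α × β × β, (u * W) (t.1, t.2.2.1) (t.2.1, t.2.2.1) *
          v (t.1, t.2.2.2) (t.2.1, t.2.2.2) :=
        Fintype.sum_equiv ⟨fun t => (t.2.1, t.1.1, t.1.2, t.2.2),
          fun t => ((t.2.1, t.2.2.1), t.1, t.2.2.2), fun _ => rfl, fun _ => rfl⟩ _ _ fun _ => rfl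
      _ = _ := by
        simp only [Fintype.sum_prod_type, traceSnd, Matrix.of_apply, Finset.sum_mul_sum]

/-- Here a main term survives, but it still contains the random matrix `W`; it is evaluated by a
second integration by parts in `IsStein.loop_main`. -/
lemma twistHit_one : twistHit W D 1 u v = mainSum u W v + crossSum u W v := by
  simp only [twistHit, hit_one h, Finset.sum_add_distrib]
  congr 1
  calc _ = ∑ t : (α × β) × (α × β) × β × α,
        u (t.2.1.1, t.1.2) (t.2.1.1, t.2.2.1) * W t.1 (t.2.2.2, t.2.2.1) *
          v (t.2.2.2, t.2.1.2) (t.1.1, t.2.1.2) := by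
        simp only [Fintype.sum_prod_type]
    _ = ∑ t : (α × β) × (α × β) × α × β, W t.1 t.2.1 *
          (u (t.2.2.1, t.1.2) (t.2.2.1, t.2.1.2) * v (t.2.1.1, t.2.2.2) (t.1.1, t.2.2.2)) :=
      Fintype.sum_equiv ⟨fun t => (t.1, (t.2.2.2, t.2.2.1), t.2.1.1, t.2.1.2),
        fun t => (t.1, (t.2.2.1, t.2.2.2), t.2.1.2, t.2.1.1), fun _ => rfl, fun _ => rfl⟩ _ _
        fun _ => by simp only [Equiv.coe_fn_mk]; ring
    _ = _ := by
      simp only [mainSum, Fintype.sum_prod_type, traceFst, traceSnd, Matrix.of_apply,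
        Finset.sum_mul_sum]
      simp only [Finset.mul_sum]

lemma loopHit_zero_error_sq_le :
    f (loopHit W D 0 u v - u.trace * (W * v).trace) ^ 2 ≤
      sqNorm ((u * W).map f) * sqNorm (v.map f) := by
  rw [loopHit_zero h, add_sub_cancel_left]
  simp only [map_sum, map_mul]
  exact sum_mul_sq_le ((u * W).map f) (v.map f)

lemma loopHit_one_sq_le : f (loopHit W D 1 u v) ^ 2 ≤
    2 * (Fintype.card α ^ 2 * (sqNorm (u.map f) * sqNorm ((v * W).map f))) +
      2 * (Fintype.card β ^ 2 * (sqNorm (u.map f) * sqNorm ((v * W).map f))) := by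
  rw [loopHit_one h, map_add]
  simp only [map_sum, map_mul]
  refine add_sq_le_of_le ((le_of_eq ?_).trans (fst_fst_sq_le (u.map f) ((v * W).map f)))
    ((le_of_eq ?_).trans (snd_snd_sq_le (u.map f) ((v * W).map f)))
  · rw [← traceFst_map, ← traceFst_map]; rfl
  · rw [← traceSnd_map, ← traceSnd_map]; rfl

lemma twistHit_zero_sq_le : f (twistHit W D 0 u v) ^ 2 ≤
    2 * (Fintype.card α ^ 2 * (sqNorm (u.map f) * sqNorm ((W * v).map f))) +
      2 * (Fintype.card β ^ 2 * (sqNorm ((u * W).map f) * sqNorm (v.map f))) := by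
  rw [twistHit_zero h, map_add]
  simp only [map_sum, map_mul]
  refine add_sq_le_of_le ((le_of_eq ?_).trans (fst_fst_sq_le (u.map f) ((W * v).map f)))
    ((le_of_eq ?_).trans (snd_snd_sq_le ((u * W).map f) (v.map f)))
  · rw [← traceFst_map, ← traceFst_map]; rfl
  · rw [← traceSnd_map, ← traceSnd_map]; rfl

lemma twistHit_one_error_sq_le : f (twistHit W D 1 u v - mainSum u W v) ^ 2 ≤
    sqNorm (u.map f) * sqNorm (W.map f) * sqNorm (v.map f) := by
  rw [twistHit_one h, add_sub_cancel_left]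
  refine (le_of_eq ?_).trans (crossSum_sq_le (u.map f) (W.map f) (v.map f))
  simp only [crossSum, map_sum, map_mul, Matrix.map_apply]

lemma fstHit_zero_sq_le (V : Matrix α α R) : f (fstHit W D 0 u v V) ^ 2 ≤
    2 * (sqNorm (u.map f) * sqNorm ((W * v).map f) * sqNorm (V.map f)) +
      2 * (sqNorm (traceSnd ((u * W).map f)) * sqNorm (traceSnd (v.map f)) *
        sqNorm (V.map f)) := by
  refine (le_of_eq ?_).trans (add_sq_le_of_le
    (net_fst_zero_left (u.map f) ((W * v).map f) (V.map f))
    (net_fst_zero_right ((u * W).map f) (v.map f) (V.map f)))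
  simp only [fstHit, traceFst, Matrix.of_apply, hit_zero h, Finset.sum_add_distrib, add_mul,
    map_add, map_sum, map_mul, Matrix.map_apply]

lemma fstHit_one_sq_le (V : Matrix α α R) : f (fstHit W D 1 u v V) ^ 2 ≤
    2 * (sqNorm (u.map f) * sqNorm (W.map f) * sqNorm (traceSnd (v.map f)) * sqNorm (V.map f)) +
      2 * (sqNorm (u.map f) * sqNorm (W.map f) * sqNorm (v.map f) * sqNorm (V.map f)) := by
  refine (le_of_eq ?_).trans (add_sq_le_of_le
    (net_fst_one_left (u.map f) (W.map f) (v.map f) (V.map f))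
    (net_fst_one_right (u.map f) (W.map f) (v.map f) (V.map f)))
  simp only [fstHit, traceFst, Matrix.of_apply, hit_one h, Finset.sum_add_distrib, add_mul,
    map_add, map_sum, map_mul, Matrix.map_apply]

lemma sndHit_zero_sq_le (U : Matrix β β R) : f (sndHit W D 0 u v U) ^ 2 ≤
    2 * (sqNorm (traceFst (u.map f)) * sqNorm (traceFst ((W * v).map f)) * sqNorm (U.map f)) +
      2 * (sqNorm ((u * W).map f) * sqNorm (v.map f) * sqNorm (U.map f)) := by
  refine (le_of_eq ?_).trans (add_sq_le_of_le
    (net_snd_zero_left (u.map f) ((W * v).map f) (U.map f))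
    (net_snd_zero_right ((u * W).map f) (v.map f) (U.map f)))
  simp only [sndHit, traceSnd, Matrix.of_apply, hit_zero h, Finset.sum_add_distrib, mul_add,
    map_add, map_sum, map_mul, Matrix.map_apply]

lemma sndHit_one_sq_le (U : Matrix β β R) : f (sndHit W D 1 u v U) ^ 2 ≤
    2 * (sqNorm (W.map f) * sqNorm (v.map f) * sqNorm (traceFst (u.map f)) * sqNorm (U.map f)) +
      2 * (sqNorm (u.map f) * sqNorm (v.map f) * sqNorm (W.map f) * sqNorm (U.map f)) := by
  refine (le_of_eq ?_).trans (add_sq_le_of_le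
    (net_snd_one_left (u.map f) (W.map f) (v.map f) (U.map f))
    (net_snd_one_right (u.map f) (W.map f) (v.map f) (U.map f)))
  simp only [sndHit, traceSnd, Matrix.of_apply, hit_one h, Finset.sum_add_distrib, mul_add,
    map_add, map_sum, map_mul, Matrix.map_apply]

end HitSums

/-! ### Loop equations from integration by parts. -/

section LoopEquations
variable {α β R : Type*} [Fintype α] [Fintype β] [DecidableEq α] [DecidableEq β] [CommRing R]
  [Algebra ℝ R]

lemma sum_derivation_wordMat (W : Matrix (α × β) (α × β) R)
    (D : α × β → α × β → Derivation ℝ R R) (w : List (Fin 2)) (a b r s : α × β) :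
    D a b (wordMat W w r s) = ((splits w).map fun t =>
      (wordMat W t.1 * (letterMat W t.2.1).map (D a b) * wordMat W t.2.2) r s).sum := by
  have h := congrFun (congrFun (map_derivation_wordMat (D a b) W w) r) s
  rw [Matrix.map_apply] at h
  rw [h]
  generalize splits w = l
  induction l with
  | nil => simp
  | cons t l ih => simp [ih]

lemma sum_list_sum_comm {ι T M : Type*} [AddCommMonoid M] (s : Finset ι) (l : List T)
    (g : ι → T → M) : ∑ i ∈ s, (l.map (g i)).sum = (l.map fun t => ∑ i ∈ s, g i t).sum := by
  induction l with
  | nil => simp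
  | cons t l ih => simp [Finset.sum_add_distrib, ih]

lemma sum_loopHit (W : Matrix (α × β) (α × β) R) (D : α × β → α × β → Derivation ℝ R R)
    (w : List (Fin 2)) : ∑ a, ∑ b, D a b (wordMat W w b a) =
      ((splits w).map fun t => loopHit W D t.2.1 (wordMat W t.1) (wordMat W t.2.2)).sum := by
  simp only [sum_derivation_wordMat, sum_list_sum_comm]
  rfl

lemma sum_twistHit (W : Matrix (α × β) (α × β) R) (D : α × β → α × β → Derivation ℝ R R)
    (w : List (Fin 2)) :
    ∑ a : α × β, ∑ b : α × β, D a b (wordMat W w (b.1, a.2) (a.1, b.2)) =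
      ((splits w).map fun t => twistHit W D t.2.1 (wordMat W t.1) (wordMat W t.2.2)).sum := by
  simp only [sum_derivation_wordMat, sum_list_sum_comm]
  rfl

lemma sum_fstHit (W : Matrix (α × β) (α × β) R) (D : α × β → α × β → Derivation ℝ R R)
    (w : List (Fin 2)) (V : Matrix α α R) :
    ∑ a : α × β, ∑ b : α × β, D a b (traceFst (wordMat W w) a.2 b.2) * V b.1 a.1 =
      ((splits w).map fun t => fstHit W D t.2.1 (wordMat W t.1) (wordMat W t.2.2) V).sum := by
  simp only [traceFst, Matrix.of_apply, map_sum, sum_derivation_wordMat, sum_list_sum_comm,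
    ← List.sum_map_mul_right]
  rfl

lemma sum_sndHit (W : Matrix (α × β) (α × β) R) (D : α × β → α × β → Derivation ℝ R R)
    (w : List (Fin 2)) (U : Matrix β β R) :
    ∑ a : α × β, ∑ b : α × β, U a.2 b.2 * D a b (traceSnd (wordMat W w) b.1 a.1) =
      ((splits w).map fun t => sndHit W D t.2.1 (wordMat W t.1) (wordMat W t.2.2) U).sum := by
  simp only [traceSnd, Matrix.of_apply, map_sum, sum_derivation_wordMat, sum_list_sum_comm,
    ← List.sum_map_mul_left]
  rfl

/-- The integration by parts formula for a functional `L`. -/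
def IsStein (W : Matrix (α × β) (α × β) R) (D : α × β → α × β → Derivation ℝ R R)
    (L : R →ₗ[ℝ] ℝ) (N p : ℝ) : Prop :=
  ∀ a b F, N * L (W a b * F) = (if a = b then p * L F else 0) + L (D a b F)

variable {W : Matrix (α × β) (α × β) R} {D : α × β → α × β → Derivation ℝ R R}
  {L : R →ₗ[ℝ] ℝ} {N p : ℝ}

lemma IsStein.sum_mul (hS : IsStein W D L N p) (A : α × β → α × β → R) (Q : R) :
    N * L ((∑ a, ∑ b, W a b * A a b) * Q) = p * L ((∑ a, A a a) * Q) +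
      L ((∑ a, ∑ b, D a b (A a b)) * Q) + L (∑ a, ∑ b, A a b * D a b Q) := by
  have h1 : ∀ a b, N * L (W a b * (A a b * Q)) = (if a = b then p * L (A a b * Q) else 0) +
      (L (D a b (A a b) * Q) + L (A a b * D a b Q)) := by
    intro a b
    rw [hS, Derivation.leibniz, map_add, smul_eq_mul, smul_eq_mul, mul_comm Q, add_comm (L _)]
  simp only [Finset.sum_mul, map_sum, Finset.mul_sum, mul_assoc, h1, Finset.sum_add_distrib,
    Finset.sum_ite_eq, Finset.mem_univ, if_true, add_assoc]

lemma IsStein.loop_zero (hS : IsStein W D L N p) (w : List (Fin 2)) (Q : R) :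
    N * L ((wordMat W (0 :: w)).trace * Q) = p * L ((wordMat W w).trace * Q) +
      ((splits w).map fun t =>
        L (loopHit W D t.2.1 (wordMat W t.1) (wordMat W t.2.2) * Q)).sum +
      L (∑ a, ∑ b, wordMat W w b a * D a b Q) := by
  have h := hS.sum_mul (fun a b => wordMat W w b a) Q
  rw [sum_loopHit, ← List.sum_map_mul_right, map_list_sum, List.map_map] at h
  exact h

lemma IsStein.loop_one (hS : IsStein W D L N p) (w : List (Fin 2)) (Q : R) :
    N * L ((wordMat W (1 :: w)).trace * Q) = p * L ((wordMat W w).trace * Q) +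
      ((splits w).map fun t =>
        L (twistHit W D t.2.1 (wordMat W t.1) (wordMat W t.2.2) * Q)).sum +
      L (∑ a : α × β, ∑ b : α × β, wordMat W w (b.1, a.2) (a.1, b.2) * D a b Q) := by
  have h := hS.sum_mul (fun a b => wordMat W w (b.1, a.2) (a.1, b.2)) Q
  rw [sum_twistHit, ← List.sum_map_mul_right, map_list_sum, List.map_map] at h
  refine Eq.trans ?_ h
  congr 3
  -- Exchanging the second halves of the two summation indices removes the partial transpose from
  -- the first letter and moves it to the rest of the word.
  calc (wordMat W (1 :: w)).trace = ∑ t : (α × β) × (α × β),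
        W (t.1.1, t.2.2) (t.2.1, t.1.2) * wordMat W w t.2 t.1 := by
        simp only [wordMat_cons, Matrix.trace, Matrix.diag, Matrix.mul_apply,
          Fintype.sum_prod_type (f := fun t : (α × β) × (α × β) =>
            W (t.1.1, t.2.2) (t.2.1, t.1.2) * wordMat W w t.2 t.1)]
        rfl
    _ = ∑ t : (α × β) × (α × β), W t.1 t.2 * wordMat W w (t.2.1, t.1.2) (t.1.1, t.2.2) :=
      Fintype.sum_equiv ⟨fun t => ((t.1.1, t.2.2), (t.2.1, t.1.2)),
        fun t => ((t.1.1, t.2.2), (t.2.1, t.1.2)), fun _ => rfl, fun _ => rfl⟩ _ _ fun _ => rfl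
    _ = _ := by rw [Fintype.sum_prod_type]

/-- The diagonal term sets `a = b`, and the two partial traces, which use complementary halves of
the indices, then decouple into two full traces. The derivative hits one of the two words or `Q`. -/
lemma IsStein.loop_main (hS : IsStein W D L N p) (u v : List (Fin 2)) (Q : R) :
    N * L (mainSum (wordMat W u) W (wordMat W v) * Q) =
      p * L ((wordMat W u).trace * (wordMat W v).trace * Q) +
      (((splits u).map fun t => L (fstHit W D t.2.1 (wordMat W t.1) (wordMat W t.2.2)
        (traceSnd (wordMat W v)) * Q)).sum +
      ((splits v).map fun t => L (sndHit W D t.2.1 (wordMat W t.1) (wordMat W t.2.2)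
        (traceFst (wordMat W u)) * Q)).sum) +
      L (∑ a : α × β, ∑ b : α × β,
        traceFst (wordMat W u) a.2 b.2 * traceSnd (wordMat W v) b.1 a.1 * D a b Q) := by
  have h := hS.sum_mul
    (fun a b => traceFst (wordMat W u) a.2 b.2 * traceSnd (wordMat W v) b.1 a.1) Q
  have e1 : ∑ a : α × β, traceFst (wordMat W u) a.2 a.2 * traceSnd (wordMat W v) a.1 a.1 =
      (wordMat W u).trace * (wordMat W v).trace := by
    rw [← trace_traceFst (wordMat W u), ← trace_traceSnd (wordMat W v)]
    simp only [Matrix.trace, Matrix.diag, Finset.sum_mul_sum, Fintype.sum_prod_type]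
    exact Finset.sum_comm
  have e2 : ∑ a : α × β, ∑ b : α × β,
      D a b (traceFst (wordMat W u) a.2 b.2 * traceSnd (wordMat W v) b.1 a.1) =
      ((splits u).map fun t => fstHit W D t.2.1 (wordMat W t.1) (wordMat W t.2.2)
        (traceSnd (wordMat W v))).sum +
      ((splits v).map fun t => sndHit W D t.2.1 (wordMat W t.1) (wordMat W t.2.2)
        (traceFst (wordMat W u))).sum := by
    rw [← sum_fstHit, ← sum_sndHit, ← Finset.sum_add_distrib]
    refine Finset.sum_congr rfl fun a _ => ?_
    rw [← Finset.sum_add_distrib]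
    refine Finset.sum_congr rfl fun b _ => ?_
    rw [Derivation.leibniz, smul_eq_mul, smul_eq_mul]
    ring
  rw [e1, e2, add_mul, map_add, ← List.sum_map_mul_right, ← List.sum_map_mul_right, map_list_sum,
    map_list_sum, List.map_map, List.map_map] at h
  exact h

end LoopEquations

/-! ### The Wishart matrix with indeterminate entries. -/

section WishartPoly
variable (α β τ : Type*) [Fintype α] [Fintype β] [Fintype τ] [DecidableEq α] [DecidableEq β]
  [DecidableEq τ]

/-- The real Wishart matrix with indeterminate entries. -/
noncomputable def wishartPoly :
    Matrix (α × β) (α × β) (MvPolynomial (α × β × τ) ℝ) :=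
  Matrix.of fun a b => ((Fintype.card α : ℝ) * Fintype.card β)⁻¹ •
    ∑ s, MvPolynomial.X (a.1, a.2, s) * MvPolynomial.X (b.1, b.2, s)

/-- The derivations that generate the action of the general linear group. -/
noncomputable def lieDer (a b : α × β) :
    Derivation ℝ (MvPolynomial (α × β × τ) ℝ) (MvPolynomial (α × β × τ) ℝ) :=
  ∑ s, (MvPolynomial.X (a.1, a.2, s) : MvPolynomial (α × β × τ) ℝ) •
    MvPolynomial.pderiv (b.1, b.2, s)

variable {α β τ}

lemma lieDer_apply {α β τ : Type*} [Fintype τ] (a b : α × β) (F : MvPolynomial (α × β × τ) ℝ) :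
    lieDer α β τ a b F =
      ∑ s, MvPolynomial.X (a.1, a.2, s) * MvPolynomial.pderiv (b.1, b.2, s) F := by
  unfold lieDer
  rw [← Derivation.coeFnAddMonoidHom_apply, map_sum, Finset.sum_apply]
  rfl

lemma lieDer_X {α β τ : Type*} [Fintype τ] [DecidableEq α] [DecidableEq β] [DecidableEq τ]
    (a b x : α × β) (t : τ) :
    lieDer α β τ a b (MvPolynomial.X (x.1, x.2, t)) =
      if x = b then MvPolynomial.X (a.1, a.2, t) else 0 := by
  rw [lieDer_apply]
  simp only [MvPolynomial.pderiv_X, Pi.single_apply, Prod.mk.injEq]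
  obtain ⟨b₁, b₂⟩ := b
  obtain ⟨x₁, x₂⟩ := x
  by_cases h : (x₁, x₂) = (b₁, b₂)
  · obtain ⟨rfl, rfl⟩ := Prod.mk.inj h
    simp
  · have h' : ∀ s, ¬ (x₁ = b₁ ∧ x₂ = b₂ ∧ t = s) := fun s hs => h (by rw [hs.1, hs.2.1])
    simp [h, h']

/-- The derivation sends the entries of row `b` of the stacked Gaussian matrix to those of row `a`
and kills the other rows; apply the Leibniz rule to the products of rows. -/
lemma isLieAction_wishartPoly : IsLieAction (wishartPoly α β τ) (lieDer α β τ) where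
  symm := by
    ext1 a b
    simp only [wishartPoly, Matrix.transpose_apply, Matrix.of_apply, mul_comm]
  apply a b x y := by
    simp only [wishartPoly, Matrix.of_apply, Derivation.map_smul, map_sum, Derivation.leibniz,
      lieDer_X, smul_eq_mul, Finset.sum_add_distrib, smul_add]
    rw [add_comm]
    congr 1
    · by_cases h : x = b <;> simp [h, mul_comm]
    · by_cases h : y = b <;> simp [h, mul_comm]

/-- Integrate by parts in the variable from row `b`. Its derivative hits the variable from row `a`
only if `a = b`, and the sum over `s` then gives `Fintype.card τ`; the remaining terms make up
`lieDer`. -/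
lemma isStein_wishartPoly [Nonempty α] [Nonempty β] :
    IsStein (wishartPoly α β τ) (lieDer α β τ) expect
      ((Fintype.card α : ℝ) * Fintype.card β) (Fintype.card τ) := by
  intro a b F
  have hN : ((Fintype.card α : ℝ) * Fintype.card β) ≠ 0 := by positivity
  have e : ∀ s, expect (MvPolynomial.X (a.1, a.2, s) * MvPolynomial.X (b.1, b.2, s) * F) =
      (if a = b then expect F else 0) +
      expect (MvPolynomial.X (a.1, a.2, s) * MvPolynomial.pderiv (b.1, b.2, s) F) := by
    intro s
    rw [mul_comm (MvPolynomial.X (a.1, a.2, s)), mul_assoc, expect_X_mul, Derivation.leibniz,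
      MvPolynomial.pderiv_X, map_add, smul_eq_mul, smul_eq_mul, add_comm]
    congr 1
    by_cases h : a = b
    · simp [h]
    · have : (a.1, a.2, s) ≠ (b.1, b.2, s) := by
        intro h2
        simp only [Prod.mk.injEq] at h2
        exact h (Prod.ext h2.1 h2.2.1)
      simp [h, this]
  rw [wishartPoly, Matrix.of_apply, smul_mul_assoc, map_smul, smul_eq_mul, mul_inv_cancel_left₀ hN,
    Finset.sum_mul, map_sum, lieDer_apply, map_sum]
  simp only [e, Finset.sum_add_distrib, Finset.sum_const, Finset.card_univ, nsmul_eq_mul]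
  by_cases h : a = b <;> simp [h]

end WishartPoly

/-! ### Pairings and the number of classes they leave. -/

section Pairings

lemma exists_pairing {S T : Type*} [Fintype S] [Fintype T] [DecidableEq T] {n : ℕ}
    (hS : Fintype.card S = n * 2) (q : S → T)
    (h : ∀ t, Even (Fintype.card {x // q x = t})) :
    ∃ e : Fin n × Bool ≃ S, ∀ k, q (e (k, false)) = q (e (k, true)) := by
  choose m hm using h
  have e₁ : ∀ t, Nonempty (Fin (m t) × Bool ≃ {x // q x = t}) := fun t =>
    ⟨Fintype.equivOfCardEq (by rw [hm]; simp [mul_two])⟩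
  let e₂ : (Σ t, Fin (m t)) × Bool ≃ S :=
    (Equiv.sigmaProdDistrib _ _).trans ((Equiv.sigmaCongrRight fun t => (e₁ t).some).trans
      (Equiv.sigmaFiberEquiv q))
  have hc : Fintype.card (Fin n) = Fintype.card (Σ t, Fin (m t)) := by
    have := Fintype.card_congr e₂
    rw [Fintype.card_prod, Fintype.card_bool, hS] at this
    rw [Fintype.card_fin]
    omega
  have hq : ∀ x b, q (e₂ (x, b)) = x.1 := fun x b => ((e₁ x.1).some (x.2, b)).2
  exact ⟨((Fintype.equivOfCardEq hc).prodCongr (Equiv.refl _)).trans e₂, fun k => by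
    simp [hq]⟩

/-- An odd multiplicity makes the expectation vanish. Otherwise at least one permutation pairs equal
variables and the factorial bound suffices; exact Wick counting is unnecessary, since only the order
in the dimensions matters. -/
lemma expect_prod_X_le_sum {σ : Type*} [Fintype σ] [DecidableEq σ] {n : ℕ}
    (q : Fin n × Bool → σ) :
    expect (∏ x, (MvPolynomial.X (q x) : MvPolynomial σ ℝ)) ≤
      (n * 2).factorial * ∑ e : Equiv.Perm (Fin n × Bool),
        if ∀ k, q (e (k, false)) = q (e (k, true)) then 1 else 0 := by
  by_cases h : ∀ t, Even (Fintype.card {x // q x = t})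
  · obtain ⟨e, he⟩ := exists_pairing (n := n) (by simp) q h
    refine (expect_prod_X_le q).trans ?_
    have h1 : (1 : ℝ) ≤ ∑ e : Equiv.Perm (Fin n × Bool),
        if ∀ k, q (e (k, false)) = q (e (k, true)) then 1 else 0 := by
      refine le_trans ?_ (Finset.single_le_sum (fun e _ => ?_) (Finset.mem_univ e))
      · rw [if_pos he]
      · split_ifs <;> simp
    have h2 : Fintype.card (Fin n × Bool) = n * 2 := by simp
    rw [h2]
    exact le_mul_of_one_le_right (Nat.cast_nonneg _) h1
  · push Not at h
    obtain ⟨t, ht⟩ := h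
    rw [expect_prod_X_eq_zero q (Nat.not_even_iff_odd.1 ht)]
    refine mul_nonneg (Nat.cast_nonneg _) (Finset.sum_nonneg fun e _ => ?_)
    split_ifs <;> simp

lemma card_invariant {V A : Type*} [Finite V] (r : V → V → Prop) :
    Nat.card {i : V → A // ∀ x y, r x y → i x = i y} = Nat.card A ^ Nat.card (Quot r) := by
  rw [← Nat.card_fun]
  exact Nat.card_congr
    ⟨fun i => Quot.lift i.1 i.2, fun g => ⟨fun x => g (Quot.mk r x), fun x y h =>
      congrArg g (Quot.sound h)⟩, fun i => rfl, fun g => by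
        funext x; induction x using Quot.ind; rfl⟩

/-- The relation on `V` that a pairing of the points induces through `v`. -/
inductive PairRel {n : ℕ} {V : Type*} (v : Fin n × Bool → V) (e : Equiv.Perm (Fin n × Bool))
    (r : V → V → Prop) : V → V → Prop
  | pair (k : Fin n) : PairRel v e r (v (e (k, false))) (v (e (k, true)))
  | base {x y : V} (h : r x y) : PairRel v e r x y

/-- The vertex of a closed walk that an end of a letter is attached to; `c` marks the letters that
are turned around. -/
def vertex {n : ℕ} (c : Fin n → Bool) (x : Fin n × Bool) : Fin (n + 1) :=
  if xor x.2 (c x.1) then x.1.succ else x.1.castSucc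

/-- Consider the bipartite graph whose vertices are the classes of walk positions and the classes of
letters, with one edge for each of the `n` pairs. It is connected because the walk is, so it has at
most `n + 1` vertices. -/
lemma card_quot_add_card_quot_le {n : ℕ} (c : Fin n → Bool) (e : Equiv.Perm (Fin n × Bool)) :
    Nat.card (Quot (PairRel (vertex c) e fun x y => x = 0 ∧ y = Fin.last n)) +
      Nat.card (Quot (PairRel Prod.fst e fun _ _ => False)) ≤ n + 1 := by
  set r₁ := PairRel (vertex c) e fun x y => x = 0 ∧ y = Fin.last n
  set r₂ : Fin n → Fin n → Prop := PairRel Prod.fst e fun _ _ => False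
  classical
  let _ := Fintype.ofFinite (Quot r₁)
  let _ := Fintype.ofFinite (Quot r₂)
  -- Connectedness in linear form: a function on the vertices is determined by its differences along
  -- the `n` edges and its value at one vertex.
  let φ : ((Quot r₁ → ℚ) × (Quot r₂ → ℚ)) →ₗ[ℚ] (Fin n → ℚ) × ℚ :=
    { toFun := fun p => (fun k => p.1 (Quot.mk _ (vertex c (e (k, false)))) -
        p.2 (Quot.mk _ (e (k, false)).1), p.1 (Quot.mk _ 0))
      map_add' := fun p q => by
        ext
        · simp; ring
        · simp
      map_smul' := fun z p => by
        ext
        · simp; ring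
        · simp }
  have hφ : Function.Injective φ := by
    rw [← LinearMap.ker_eq_bot, LinearMap.ker_eq_bot']
    rintro ⟨i, s⟩ h
    obtain ⟨h1, h2⟩ := Prod.mk.inj h
    have h3 : ∀ k, i (Quot.mk _ (vertex c (e (k, false)))) = s (Quot.mk _ (e (k, false)).1) :=
      fun k => sub_eq_zero.1 (congrFun h1 k)
    have h4 : ∀ x, i (Quot.mk _ (vertex c x)) = s (Quot.mk _ x.1) := by
      intro x
      obtain ⟨⟨k, b⟩, rfl⟩ := e.surjective x
      cases b
      · exact h3 k
      -- Both ends of a pair give the same edge of the graph, so the equation transfers to the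
      -- second end.
      · rw [← Quot.sound (PairRel.pair k : r₁ _ _), h3, Quot.sound (PairRel.pair k : r₂ _ _)]
    have h5 : ∀ j : Fin n, i (Quot.mk _ j.castSucc) = s (Quot.mk _ j) ∧
        i (Quot.mk _ j.succ) = s (Quot.mk _ j) := by
      intro j
      have ht := h4 (j, true)
      have hf := h4 (j, false)
      cases hc : c j <;> simp [vertex, hc] at ht hf <;> simp [ht, hf]
    have h6 : ∀ j : Fin (n + 1), i (Quot.mk _ j) = 0 := by
      intro j
      induction j using Fin.induction with
      | zero => exact h2
      | succ j ih => rw [(h5 j).2, ← (h5 j).1, ih]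
    refine Prod.ext ?_ ?_
    · funext x
      induction x using Quot.ind with
      | mk x => exact h6 x
    · funext x
      induction x using Quot.ind with
      | mk x => exact (h5 x).1.symm.trans (h6 _)
  have := LinearMap.finrank_le_finrank_of_injective hφ
  rw [Module.finrank_prod, Module.finrank_prod, Module.finrank_fintype_fun_eq_card,
    Module.finrank_fintype_fun_eq_card, Module.finrank_fintype_fun_eq_card, Fintype.card_fin,
    Module.finrank_self] at this
  simpa only [Nat.card_eq_fintype_card] using this

end Pairings

/-! ### Expansion of traces over walks and the bound on their expectations. -/

section WalkExpansion

lemma prod_ofFn_apply {ι R : Type*} [Fintype ι] [DecidableEq ι] [CommRing R] {n : ℕ}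
    (M : Fin n → Matrix ι ι R) (x y : ι) : (List.ofFn M).prod x y =
      ∑ i : Fin (n + 1) → ι, if i 0 = x ∧ i (Fin.last n) = y then
        ∏ k, M k (i k.castSucc) (i k.succ) else 0 := by
  induction n generalizing x with
  | zero =>
    rw [Fintype.sum_equiv (Equiv.funUnique (Fin 1) ι) _
      (fun z => if z = x ∧ z = y then 1 else 0) fun i => by simp]
    simp [Matrix.one_apply, ite_and]
  | succ n ih =>
    rw [List.ofFn_succ, List.prod_cons, Matrix.mul_apply]
    rw [← Fintype.sum_equiv (Fin.consEquiv fun _ : Fin (n + 2) => ι)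
      (fun p : ι × (Fin (n + 1) → ι) => if p.1 = x ∧ p.2 (Fin.last n) = y then
        M 0 p.1 (p.2 0) * ∏ k : Fin n, M k.succ (p.2 k.castSucc) (p.2 k.succ) else 0) _
      fun p => ?_]
    · rw [Fintype.sum_prod_type]
      simp only [ite_and, Finset.sum_ite_irrel, Finset.sum_const_zero, Finset.sum_ite_eq',
        Finset.mem_univ, if_true, ih, Finset.mul_sum]
      rw [Finset.sum_comm]
      refine Finset.sum_congr rfl fun i _ => ?_
      simp [mul_ite]
    · rw [Fin.prod_univ_succ]
      simp [Fin.consEquiv, ← Fin.succ_last]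

end WalkExpansion

section WickBound

/-- The matrix entry that is attached to an end of a letter. -/
def wickIndex {α β τ : Type*} {n : ℕ} (c : Fin n → Bool) (i : Fin (n + 1) → α × β)
    (s : Fin n → τ) (x : Fin n × Bool) : α × β × τ :=
  ((i (vertex (fun _ => false) x)).1, (i (vertex c x)).2, s x.1)

variable {α β τ : Type*} [Fintype α] [Fintype β] [Fintype τ] [DecidableEq α] [DecidableEq β]

/-- Each letter carries two Gaussian variables, one for each end. A partial transpose exchanges the
ends only in the second coordinate, so the turning function enters only there in `wickIndex`. -/
lemma trace_wordMat_wishartPoly (w : List (Fin 2)) :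
    (wordMat (wishartPoly α β τ) w).trace =
      (((Fintype.card α : ℝ) * Fintype.card β)⁻¹ ^ w.length) •
        ∑ i : Fin (w.length + 1) → α × β, ∑ s : Fin w.length → τ,
          if i 0 = i (Fin.last _) then
            ∏ x, (MvPolynomial.X (wickIndex (fun k => decide (w.get k ≠ 0)) i s x) :
              MvPolynomial (α × β × τ) ℝ) else 0 := by
  have hl : wordMat (wishartPoly α β τ) w =
      (List.ofFn fun k => letterMat (wishartPoly α β τ) (w.get k)).prod := by
    rw [wordMat]
    conv_lhs => rw [← List.ofFn_get w, List.map_ofFn]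
    rfl
  have hletter : ∀ (k : Fin w.length) (i : Fin (w.length + 1) → α × β),
      letterMat (wishartPoly α β τ) (w.get k) (i k.castSucc) (i k.succ) =
      ((Fintype.card α : ℝ) * Fintype.card β)⁻¹ • ∑ s : τ, ∏ b : Bool,
        MvPolynomial.X ((i (vertex (fun _ => false) (k, b))).1,
          (i (vertex (fun k => decide (w.get k ≠ 0)) (k, b))).2, s) := by
    intro k i
    by_cases he : w.get k = 0
    · rw [he, letterMat_zero, wishartPoly, Matrix.of_apply]
      simp only [Fintype.prod_bool, vertex, he, Bool.xor_false, if_true, Bool.false_eq_true,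
        if_false, ne_eq, not_true_eq_false, decide_false, mul_comm]
    · rw [letterMat, if_neg he, wishartPoly, rightPartialTranspose, Matrix.of_apply,
        Matrix.of_apply]
      simp only [Fintype.prod_bool, vertex, Bool.xor_false, if_true, Bool.false_eq_true,
        if_false, ne_eq, he, not_false_eq_true, decide_true, Bool.xor_true, Bool.not_true,
        Bool.not_false, mul_comm]
  rw [hl, Matrix.trace]
  simp only [Matrix.diag, prod_ofFn_apply]
  rw [Finset.sum_comm, Finset.smul_sum]
  refine Finset.sum_congr rfl fun i _ => ?_
  simp only [ite_and, Finset.sum_ite_eq, Finset.mem_univ, if_true]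
  by_cases h : i 0 = i (Fin.last _)
  · simp only [h, if_true, hletter]
    rw [Finset.prod_smul, Finset.prod_const, Finset.card_univ, Fintype.card_fin,
      Finset.prod_univ_sum, Fintype.piFinset_univ]
    congr 1
    refine Finset.sum_congr rfl fun s _ => ?_
    rw [Fintype.prod_prod_type]
    rfl
  · simp [h, Ne.symm h]

/-- Equality of two variables is equality of three coordinates. The constraints on the `α`, `β` and
`τ` labels therefore decouple, and each kind of label is constant on the classes of its own
relation. -/
lemma card_closed_wickIndex_le {n : ℕ} (c : Fin n → Bool) (e : Equiv.Perm (Fin n × Bool))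
    [DecidableEq τ] :
    Fintype.card {p : (Fin (n + 1) → α × β) × (Fin n → τ) // p.1 0 = p.1 (Fin.last n) ∧
      ∀ k, wickIndex c p.1 p.2 (e (k, false)) = wickIndex c p.1 p.2 (e (k, true))} ≤
    Nat.card α ^ Nat.card (Quot (PairRel (vertex fun _ => false) e
        fun x y => x = 0 ∧ y = Fin.last n)) *
      (Nat.card β ^ Nat.card (Quot (PairRel (vertex c) e fun x y => x = 0 ∧ y = Fin.last n)) *
        Nat.card τ ^ Nat.card (Quot (PairRel Prod.fst e fun _ _ => False))) := by
  rw [← card_invariant, ← card_invariant, ← card_invariant, ← Nat.card_prod, ← Nat.card_prod,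
    ← Nat.card_eq_fintype_card]
  refine Nat.card_le_card_of_injective (fun p => (⟨fun x => (p.1.1 x).1, ?_⟩,
    ⟨fun x => (p.1.1 x).2, ?_⟩, ⟨p.1.2, ?_⟩)) ?_
  · rintro x y (k | ⟨rfl, rfl⟩)
    · exact congrArg (fun z : α × β × τ => z.1) (p.2.2 k)
    · exact congrArg Prod.fst p.2.1
  · rintro x y (k | ⟨rfl, rfl⟩)
    · exact congrArg (fun z : α × β × τ => z.2.1) (p.2.2 k)
    · exact congrArg Prod.snd p.2.1
  · rintro x y (k | h)
    · exact congrArg (fun z : α × β × τ => z.2.2) (p.2.2 k)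
    · exact h.elim
  · rintro ⟨⟨i, s⟩, h⟩ ⟨⟨i', s'⟩, h'⟩ heq
    simp only [Prod.mk.injEq, Subtype.mk.injEq] at heq
    have : i = i' := funext fun x => Prod.ext (congrFun heq.1 x) (congrFun heq.2.1 x)
    subst this
    obtain rfl := heq.2.2
    rfl

/-- Each `τ` class contributes up to `C * (a * b)`, hence one power of `a` and one of `b`. The
inequalities `h₁` and `h₂` then bound both exponents by `n + 1`, and a single `a * b` survives the
normalization. -/
lemma wick_power_le {n c₁ c₂ c₃ : ℕ} (h₁ : c₁ + c₃ ≤ n + 1) (h₂ : c₂ + c₃ ≤ n + 1) (h₃ : c₃ ≤ n)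
    {a b t C : ℝ} (ha : 1 ≤ a) (hb : 1 ≤ b) (hC : 1 ≤ C) (ht0 : 0 ≤ t) (ht : t ≤ C * (a * b)) :
    (a * b)⁻¹ ^ n * (a ^ c₁ * (b ^ c₂ * t ^ c₃)) ≤ C ^ n * (a * b) := by
  have hab : 0 < (a * b) ^ n := by positivity
  rw [inv_pow, inv_mul_le_iff₀ hab]
  calc a ^ c₁ * (b ^ c₂ * t ^ c₃) ≤ a ^ c₁ * (b ^ c₂ * (C * (a * b)) ^ c₃) := by gcongr
    _ = C ^ c₃ * (a ^ (c₁ + c₃) * b ^ (c₂ + c₃)) := by ring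
    _ ≤ C ^ n * (a ^ (n + 1) * b ^ (n + 1)) := by gcongr
    _ = _ := by ring

/-- The prefactor depends only on the length of the word and `C`, so the normalized trace has
bounded expectation. -/
theorem expect_trace_wordMat_le (w : List (Fin 2)) [Nonempty α] [Nonempty β]
    {C : ℝ} (hC : 1 ≤ C)
    (hτ : (Fintype.card τ : ℝ) ≤ C * ((Fintype.card α : ℝ) * Fintype.card β)) :
    expect (wordMat (wishartPoly α β τ) w).trace ≤
      (w.length * 2).factorial * Fintype.card (Equiv.Perm (Fin w.length × Bool)) *
        C ^ w.length * ((Fintype.card α : ℝ) * Fintype.card β) := by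
  classical
  set N : ℝ := (Fintype.card α : ℝ) * Fintype.card β with hN
  set n := w.length
  set c : Fin n → Bool := fun k => decide (w.get k ≠ 0)
  set T := (Fin (n + 1) → α × β) × (Fin n → τ)
  let good (e : Equiv.Perm (Fin n × Bool)) (p : T) : Prop := p.1 0 = p.1 (Fin.last n) ∧
    ∀ k, wickIndex c p.1 p.2 (e (k, false)) = wickIndex c p.1 p.2 (e (k, true))
  have hN0 : 0 ≤ N⁻¹ ^ n := by positivity
  rw [trace_wordMat_wishartPoly, map_smul, smul_eq_mul]
  have h1 : expect (∑ i : Fin (n + 1) → α × β, ∑ s : Fin n → τ,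
      if i 0 = i (Fin.last _) then ∏ x, (MvPolynomial.X (wickIndex c i s x) :
        MvPolynomial (α × β × τ) ℝ) else 0) ≤
      (n * 2).factorial * ∑ e : Equiv.Perm (Fin n × Bool),
        (Fintype.card {p : T // good e p} : ℝ) := by
    have h2 : ∀ e, (Fintype.card {p : T // good e p} : ℝ) =
        ∑ p : T, if good e p then 1 else 0 := by
      intro e
      rw [Fintype.card_subtype, Finset.sum_boole]
    have h6 : ((n * 2).factorial * ∑ e : Equiv.Perm (Fin n × Bool),
        (Fintype.card {p : T // good e p} : ℝ)) = ∑ i, ∑ s, (n * 2).factorial *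
          ∑ e : Equiv.Perm (Fin n × Bool), if good e (i, s) then (1 : ℝ) else 0 := by
      simp only [h2]
      rw [Finset.sum_comm, Finset.mul_sum, Fintype.sum_prod_type]
    rw [h6, map_sum]
    simp only [map_sum]
    refine Finset.sum_le_sum fun i _ => Finset.sum_le_sum fun s _ => ?_
    by_cases h : i 0 = i (Fin.last n)
    · simp only [h, if_true, good, true_and]
      exact expect_prod_X_le_sum (wickIndex c i s)
    · simp [h, good]
  refine (mul_le_mul_of_nonneg_left h1 hN0).trans ?_
  have h3 : ∀ e, N⁻¹ ^ n * (Fintype.card {p : T // good e p} : ℝ) ≤ C ^ n * N := by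
    intro e
    have h4 := card_closed_wickIndex_le (α := α) (β := β) (τ := τ) c e
    simp only [Nat.card_eq_fintype_card (α := α), Nat.card_eq_fintype_card (α := β),
      Nat.card_eq_fintype_card (α := τ)] at h4
    have h5 : (Fintype.card {p : T // good e p} : ℝ) ≤ _ := Nat.cast_le.2 h4
    refine (mul_le_mul_of_nonneg_left h5 hN0).trans ?_
    push_cast
    refine wick_power_le (card_quot_add_card_quot_le _ e) (card_quot_add_card_quot_le _ e) ?_ ?_ ?_
      hC (Nat.cast_nonneg _) hτ
    · have := Nat.card_le_card_of_surjective (Quot.mk (PairRel Prod.fst e fun _ _ => False))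
        Quot.mk_surjective
      simpa using this
    · exact_mod_cast Fintype.card_pos
    · exact_mod_cast Fintype.card_pos
  calc N⁻¹ ^ n * ((n * 2).factorial * ∑ e : Equiv.Perm (Fin n × Bool),
        (Fintype.card {p : T // good e p} : ℝ))
      = (n * 2).factorial * ∑ e : Equiv.Perm (Fin n × Bool),
        N⁻¹ ^ n * (Fintype.card {p : T // good e p} : ℝ) := by rw [← Finset.mul_sum]; ring
    _ ≤ (n * 2).factorial * ∑ e : Equiv.Perm (Fin n × Bool), C ^ n * N := by
        exact mul_le_mul_of_nonneg_left (Finset.sum_le_sum fun e _ => h3 e) (Nat.cast_nonneg _)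
    _ = _ := by
        rw [Finset.sum_const, Finset.card_univ, nsmul_eq_mul]; ring

end WickBound

/-! ### Bounded moments and negligible families. -/

section Moments
variable {ι : Type*} {l : Filter ι} {σ : ι → Type*} [∀ N, Fintype (σ N)]

/-- All moments stay bounded along the filter. -/
def BddMoments (l : Filter ι) (F : ∀ N, MvPolynomial (σ N) ℝ) : Prop :=
  ∀ k : ℕ, ∃ C : ℝ, ∀ᶠ N in l, expect (F N ^ (2 * k)) ≤ C

/-- The second moment tends to zero along the filter. -/
def Negligible (l : Filter ι) (F : ∀ N, MvPolynomial (σ N) ℝ) : Prop :=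
  Tendsto (fun N => expect (F N ^ 2)) l (𝓝 0)

lemma BddMoments.mono {F G : ∀ N, MvPolynomial (σ N) ℝ} (hG : BddMoments l G)
    (h : ∀ᶠ N in l, ∀ x, |MvPolynomial.eval x (F N)| ≤ MvPolynomial.eval x (G N)) :
    BddMoments l F := by
  intro k
  obtain ⟨C, hC⟩ := hG k
  refine ⟨C, ?_⟩
  filter_upwards [hC, h] with N h1 h2
  refine (expect_mono fun x => ?_).trans h1
  rw [map_pow, map_pow, ← (even_two_mul k).pow_abs]
  exact pow_le_pow_left₀ (abs_nonneg _) (h2 x) _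

lemma bddMoments_C (a : ℝ) : BddMoments l fun N => (MvPolynomial.C a : MvPolynomial (σ N) ℝ) := by
  intro k
  refine ⟨a ^ (2 * k), Eventually.of_forall fun N => ?_⟩
  rw [← map_pow, expect_C]

lemma BddMoments.mul {F G : ∀ N, MvPolynomial (σ N) ℝ} (hF : BddMoments l F)
    (hG : BddMoments l G) : BddMoments l fun N => F N * G N := by
  intro k
  obtain ⟨A, hA⟩ := hF (2 * k)
  obtain ⟨B, hB⟩ := hG (2 * k)
  refine ⟨A + B, ?_⟩
  filter_upwards [hA, hB] with N h1 h2
  refine le_trans ?_ (add_le_add h1 h2)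
  rw [← map_add]
  refine expect_mono fun x => ?_
  simp only [map_pow, map_mul, map_add, mul_pow, pow_mul']
  nlinarith [sq_nonneg ((MvPolynomial.eval x (F N) ^ 2) ^ k - (MvPolynomial.eval x (G N) ^ 2) ^ k),
    sq_nonneg ((MvPolynomial.eval x (F N) ^ 2) ^ k), sq_nonneg ((MvPolynomial.eval x (G N) ^ 2) ^ k),
    pow_right_comm (MvPolynomial.eval x (F N)) 2 k, pow_right_comm (MvPolynomial.eval x (G N)) 2 k]

lemma BddMoments.add {F G : ∀ N, MvPolynomial (σ N) ℝ} (hF : BddMoments l F)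
    (hG : BddMoments l G) : BddMoments l fun N => F N + G N := by
  intro k
  obtain ⟨A, hA⟩ := hF k
  obtain ⟨B, hB⟩ := hG k
  -- The constant is that of the power mean inequality; for `k = 0` the truncated exponent gives
  -- `1`, which is enough.
  refine ⟨2 ^ (2 * k - 1) * (A + B), ?_⟩
  filter_upwards [hA, hB] with N h1 h2
  refine le_trans ?_ (mul_le_mul_of_nonneg_left (add_le_add h1 h2) (by positivity))
  have e : 2 ^ (2 * k - 1) * expect (F N ^ (2 * k) + G N ^ (2 * k)) =
      expect ((2 : ℝ) ^ (2 * k - 1) • (F N ^ (2 * k) + G N ^ (2 * k))) := by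
    rw [map_smul, smul_eq_mul]
  rw [← map_add, e]
  refine expect_mono fun x => ?_
  simp only [map_pow, map_add, MvPolynomial.smul_eval]
  exact (even_two_mul k).add_pow_le

lemma BddMoments.const_mul {F : ∀ N, MvPolynomial (σ N) ℝ} (a : ℝ) (hF : BddMoments l F) :
    BddMoments l fun N => MvPolynomial.C a * F N := (bddMoments_C a).mul hF

lemma BddMoments.expect_le {F : ∀ N, MvPolynomial (σ N) ℝ} (hF : BddMoments l F) :
    ∃ C : ℝ, ∀ᶠ N in l, |expect (F N)| ≤ C := by
  obtain ⟨C, hC⟩ := hF 1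
  refine ⟨1 + C, ?_⟩
  filter_upwards [hC] with N h
  have h1 := expect_mul_sq_le (F N) 1
  have h2 : expect (1 : MvPolynomial (σ N) ℝ) = 1 := expect_C 1
  rw [mul_one, one_pow, h2, mul_one] at h1
  rw [mul_one] at h
  rw [← sq_abs] at h1
  nlinarith [sq_nonneg (|expect (F N)| - 1)]

/-- The form in which every error is handled: a pointwise bound on the square by a deterministic
rate times a family with bounded moments. -/
lemma Negligible.of_le {F H : ∀ N, MvPolynomial (σ N) ℝ} {ρ : ι → ℝ} (hρ : Tendsto ρ l (𝓝 0))
    (hH : BddMoments l H) (h : ∀ᶠ N in l, ∀ x,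
      MvPolynomial.eval x (F N) ^ 2 ≤ ρ N * MvPolynomial.eval x (H N)) : Negligible l F := by
  obtain ⟨C, hC⟩ := hH.expect_le
  have h1 : Tendsto (fun N => |ρ N| * C) l (𝓝 0) := by
    have := hρ.abs.mul_const C
    simpa using this
  refine tendsto_of_tendsto_of_tendsto_of_le_of_le' tendsto_const_nhds h1
    (Eventually.of_forall fun N => expect_nonneg fun x => by rw [map_pow]; positivity) ?_
  filter_upwards [hC, h] with N h2 h3
  calc expect (F N ^ 2) ≤ expect (ρ N • H N) := expect_mono fun x => by
        rw [map_pow, MvPolynomial.smul_eval]; exact h3 x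
    _ = ρ N * expect (H N) := by rw [map_smul, smul_eq_mul]
    _ ≤ |ρ N * expect (H N)| := le_abs_self _
    _ = |ρ N| * |expect (H N)| := abs_mul _ _
    _ ≤ _ := by gcongr

lemma Negligible.expect_mul {F Q : ∀ N, MvPolynomial (σ N) ℝ} (hF : Negligible l F)
    (hQ : BddMoments l Q) : Tendsto (fun N => expect (F N * Q N)) l (𝓝 0) := by
  obtain ⟨C, hC⟩ := hQ 1
  have h1 : Tendsto (fun N => expect (F N ^ 2) * C) l (𝓝 0) := by
    have := Tendsto.mul_const C hF
    simpa using this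
  have h2 : Tendsto (fun N => expect (F N * Q N) ^ 2) l (𝓝 0) := by
    refine tendsto_of_tendsto_of_tendsto_of_le_of_le' tendsto_const_nhds h1
      (Eventually.of_forall fun N => sq_nonneg _) ?_
    filter_upwards [hC] with N h
    refine (expect_mul_sq_le _ _).trans (mul_le_mul_of_nonneg_left h (expect_nonneg fun x => ?_))
    rw [map_pow]; positivity
  have h3 := h2.sqrt
  simp only [Real.sqrt_sq_eq_abs, Real.sqrt_zero] at h3
  exact (tendsto_zero_iff_abs_tendsto_zero _).2 h3

lemma Negligible.expect_tendsto {F : ∀ N, MvPolynomial (σ N) ℝ} (hF : Negligible l F) :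
    Tendsto (fun N => expect (F N)) l (𝓝 0) := by
  have := hF.expect_mul (bddMoments_C 1)
  simpa using this

variable {J : ι → Type*} [∀ N, Fintype (J N)]

/-- The Hilbert–Schmidt norms of a family of matrices have bounded moments. -/
def BddNorm (l : Filter ι) (G : ∀ N, J N → J N → MvPolynomial (σ N) ℝ) : Prop :=
  BddMoments l fun N => ∑ a, ∑ b, G N a b ^ 2

lemma eval_sum_sq {s : Type*} {j : Type*} [Fintype j] (x : s → ℝ)
    (G : j → j → MvPolynomial s ℝ) : MvPolynomial.eval x (∑ a, ∑ b, G a b ^ 2) =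
      sqNorm fun a b => MvPolynomial.eval x (G a b) := by
  simp [sqNorm]

lemma BddNorm.of_le {G : ∀ N, J N → J N → MvPolynomial (σ N) ℝ} {H : ∀ N, MvPolynomial (σ N) ℝ}
    (hH : BddMoments l H) (h : ∀ᶠ N in l, ∀ x,
      (sqNorm fun a b => MvPolynomial.eval x (G N a b)) ≤ MvPolynomial.eval x (H N)) :
    BddNorm l G := by
  refine BddMoments.mono hH ?_
  filter_upwards [h] with N h x
  rw [eval_sum_sq, abs_of_nonneg (sqNorm_nonneg _)]
  exact h x

lemma sqNorm_add_le {A B : Type*} [Fintype A] [Fintype B] (f g : A → B → ℝ) :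
    (sqNorm fun a b => f a b + g a b) ≤ 2 * (sqNorm f + sqNorm g) := by
  simp only [sqNorm, ← Finset.sum_add_distrib, Finset.mul_sum]
  exact Finset.sum_le_sum fun a _ => Finset.sum_le_sum fun b _ => by
    nlinarith [sq_nonneg (f a b - g a b)]

lemma sqNorm_const_mul {A B : Type*} [Fintype A] [Fintype B] (z : ℝ) (f : A → B → ℝ) :
    (sqNorm fun a b => z * f a b) = z ^ 2 * sqNorm f := by
  simp only [sqNorm, Finset.mul_sum, mul_pow]

lemma BddNorm.add {G H : ∀ N, J N → J N → MvPolynomial (σ N) ℝ} (hG : BddNorm l G)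
    (hH : BddNorm l H) : BddNorm l fun N a b => G N a b + H N a b := by
  refine BddNorm.of_le ((BddMoments.add hG hH).const_mul 2) (Eventually.of_forall fun N x => ?_)
  rw [map_mul, map_add, eval_sum_sq, eval_sum_sq, MvPolynomial.eval_C]
  simp only [map_add]
  exact sqNorm_add_le _ _

lemma BddNorm.mul_left {F : ∀ N, MvPolynomial (σ N) ℝ}
    {G : ∀ N, J N → J N → MvPolynomial (σ N) ℝ} (hF : BddMoments l F) (hG : BddNorm l G) :
    BddNorm l fun N a b => F N * G N a b := by
  refine BddNorm.of_le ((hF.mul hF).mul hG) (Eventually.of_forall fun N x => ?_)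
  rw [map_mul, eval_sum_sq]
  simp only [map_mul, sqNorm_const_mul]
  rw [sq]

lemma bddNorm_list_sum {T : Type*} (t : List T) (G : T → ∀ N, J N → J N → MvPolynomial (σ N) ℝ)
    (h : ∀ i ∈ t, BddNorm l (G i)) : BddNorm l fun N a b => (t.map fun i => G i N a b).sum := by
  induction t with
  | nil =>
    refine BddNorm.of_le (bddMoments_C 0) (Eventually.of_forall fun N x => ?_)
    simp [sqNorm]
  | cons i t ih =>
    simp only [List.map_cons, List.sum_cons]
    exact (h i (by simp)).add (ih fun j hj => h j (List.mem_cons_of_mem _ hj))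

end Moments

/-! ### Pointwise trace inequalities for words. -/

section WordMoments

/-- The matrix of a word in the Wishart matrix with indeterminate entries. -/
noncomputable abbrev wordPoly (d₁ d₂ p : ℕ) (w : List (Fin 2)) :
    Matrix (Fin d₁ × Fin d₂) (Fin d₁ × Fin d₂) (MvPolynomial (Fin d₁ × Fin d₂ × Fin p) ℝ) :=
  wordMat (wishartPoly (Fin d₁) (Fin d₂) (Fin p)) w

/-- The normalized trace of a word. -/
noncomputable def trPoly (d₁ d₂ p : ℕ) (w : List (Fin 2)) :
    MvPolynomial (Fin d₁ × Fin d₂ × Fin p) ℝ :=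
  ((d₁ : ℝ) * d₂)⁻¹ • (wordPoly d₁ d₂ p w).trace

variable {d₁ d₂ p : ℕ}

lemma sqNorm_wordPoly (h₁ : 0 < d₁) (h₂ : 0 < d₂) (x : Fin d₁ × Fin d₂ × Fin p → ℝ)
    (w : List (Fin 2)) : sqNorm ((wordPoly d₁ d₂ p w).map (MvPolynomial.eval x)) =
      ((d₁ : ℝ) * d₂) * MvPolynomial.eval x (trPoly d₁ d₂ p (w ++ w.reverse)) := by
  have hn : ((d₁ : ℝ) * d₂) ≠ 0 := by positivity
  rw [trPoly, MvPolynomial.smul_eval, mul_inv_cancel_left₀ hn, wordPoly, wordPoly, wordMat_append,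
    ← transpose_wordMat isLieAction_wishartPoly.symm]
  simp only [Matrix.trace, Matrix.diag, Matrix.mul_apply, Matrix.transpose_apply, map_sum, map_mul,
    sqNorm, Matrix.map_apply, sq]

lemma eval_trPoly_nonneg (h₁ : 0 < d₁) (h₂ : 0 < d₂) (x : Fin d₁ × Fin d₂ × Fin p → ℝ)
    (w : List (Fin 2)) : 0 ≤ MvPolynomial.eval x (trPoly d₁ d₂ p (w ++ w.reverse)) := by
  have h := sqNorm_nonneg ((wordPoly d₁ d₂ p w).map (MvPolynomial.eval x))
  rw [sqNorm_wordPoly h₁ h₂] at h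
  have : (0 : ℝ) < (d₁ : ℝ) * d₂ := by positivity
  exact nonneg_of_mul_nonneg_right h this

lemma eval_trPoly_sq_le (h₁ : 0 < d₁) (h₂ : 0 < d₂) (x : Fin d₁ × Fin d₂ × Fin p → ℝ)
    (w : List (Fin 2)) : MvPolynomial.eval x (trPoly d₁ d₂ p w) ^ 2 ≤
      MvPolynomial.eval x (trPoly d₁ d₂ p (w ++ w.reverse)) := by
  have hn : (0 : ℝ) < (d₁ : ℝ) * d₂ := by positivity
  set M := (wordPoly d₁ d₂ p w).map (MvPolynomial.eval x) with hM
  have h3 : MvPolynomial.eval x (wordPoly d₁ d₂ p w).trace = ∑ a, M a a := by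
    simp [Matrix.trace, hM]
  have h4 : (∑ a, M a a) ^ 2 ≤ ((d₁ : ℝ) * d₂) * sqNorm M := by
    have h5 : (∑ a, M a a) ^ 2 ≤ (Finset.univ : Finset (Fin d₁ × Fin d₂)).card *
        ∑ a, M a a ^ 2 := sq_sum_le_card_mul_sum_sq
    have h6 : ∑ a, M a a ^ 2 ≤ sqNorm M := Finset.sum_le_sum fun a _ =>
      Finset.single_le_sum (f := fun b => M a b ^ 2) (fun b _ => sq_nonneg _) (Finset.mem_univ a)
    have h7 : ((Finset.univ : Finset (Fin d₁ × Fin d₂)).card : ℝ) = (d₁ : ℝ) * d₂ := by simp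
    rw [h7] at h5
    exact h5.trans (mul_le_mul_of_nonneg_left h6 hn.le)
  rw [hM, sqNorm_wordPoly h₁ h₂, ← hM] at h4
  rw [trPoly, MvPolynomial.smul_eval, h3, mul_pow, inv_pow, inv_mul_le_iff₀ (by positivity)]
  linarith

/-- Iterated Cauchy–Schwarz for the trace bounds a power of one trace by the trace of a single
longer word, at every point and in every dimension. First moments thus control all moments. -/
lemma eval_trPoly_pow_le (w : List (Fin 2)) (k : ℕ) : ∃ w' : List (Fin 2), ∀ {d₁ d₂ p : ℕ},
    0 < d₁ → 0 < d₂ → ∀ x : Fin d₁ × Fin d₂ × Fin p → ℝ,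
      MvPolynomial.eval x (trPoly d₁ d₂ p w) ^ (2 ^ (k + 1)) ≤
        MvPolynomial.eval x (trPoly d₁ d₂ p w') := by
  induction k generalizing w with
  | zero => exact ⟨w ++ w.reverse, fun h₁ h₂ x => by simpa using eval_trPoly_sq_le h₁ h₂ x w⟩
  | succ k ih =>
    obtain ⟨w', h⟩ := ih (w ++ w.reverse)
    refine ⟨w', fun h₁ h₂ x => le_trans ?_ (h h₁ h₂ x)⟩
    rw [pow_succ' 2 (k + 1), pow_mul]
    exact pow_le_pow_left₀ (sq_nonneg _) (eval_trPoly_sq_le h₁ h₂ x w) _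

lemma pow_two_mul_le (y : ℝ) (k : ℕ) : y ^ (2 * k) ≤ 1 + y ^ (2 ^ (k + 1)) := by
  have hk : 2 * k ≤ 2 ^ (k + 1) := by
    have := Nat.lt_two_pow_self (n := k)
    rw [pow_succ]; omega
  have he : Even (2 ^ (k + 1)) := by rw [pow_succ']; exact even_two_mul _
  rw [← (even_two_mul k).pow_abs, ← he.pow_abs]
  rcases le_total |y| 1 with h | h
  · have := pow_le_one₀ (n := 2 * k) (abs_nonneg y) h
    have := pow_nonneg (abs_nonneg y) (2 ^ (k + 1))
    linarith
  · have := pow_le_pow_right₀ h hk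
    linarith

end WordMoments

/-! ### Boundedness of the traces in the asymptotic regime. -/

/-- The regime in which the block sizes tend to infinity and the aspect ratio converges. -/
structure WishartRegime {ι : Type*} (l : Filter ι) (d₁ d₂ p : ι → ℕ) (c : ℝ) : Prop where
  fst : Tendsto d₁ l atTop
  snd : Tendsto d₂ l atTop
  ratio : Tendsto (fun N => (p N : ℝ) / ((d₁ N : ℝ) * (d₂ N : ℝ))) l (𝓝 c)

section Regime
variable {ι : Type*} {l : Filter ι} {d₁ d₂ p : ι → ℕ} {c : ℝ}

lemma WishartRegime.pos (H : WishartRegime l d₁ d₂ p c) : ∀ᶠ N in l, 0 < d₁ N ∧ 0 < d₂ N :=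
  (H.fst.eventually_gt_atTop 0).and (H.snd.eventually_gt_atTop 0)

lemma WishartRegime.inv_fst (H : WishartRegime l d₁ d₂ p c) :
    Tendsto (fun N => ((d₁ N : ℝ))⁻¹) l (𝓝 0) :=
  tendsto_inv_atTop_zero.comp (tendsto_natCast_atTop_atTop.comp H.fst)

lemma WishartRegime.inv_snd (H : WishartRegime l d₁ d₂ p c) :
    Tendsto (fun N => ((d₂ N : ℝ))⁻¹) l (𝓝 0) :=
  tendsto_inv_atTop_zero.comp (tendsto_natCast_atTop_atTop.comp H.snd)

lemma WishartRegime.inv_add_inv (H : WishartRegime l d₁ d₂ p c) :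
    Tendsto (fun N => ((d₁ N : ℝ))⁻¹ + ((d₂ N : ℝ))⁻¹) l (𝓝 0) := by
  simpa using H.inv_fst.add H.inv_snd

lemma WishartRegime.expect_trPoly_le (H : WishartRegime l d₁ d₂ p c) (w : List (Fin 2)) :
    ∃ C : ℝ, ∀ᶠ N in l, expect (trPoly (d₁ N) (d₂ N) (p N) w) ≤ C := by
  -- The value `|c| + 1` eventually bounds the aspect ratio and is at least `1`, as the pairing
  -- bound requires.
  refine ⟨(w.length * 2).factorial * Fintype.card (Equiv.Perm (Fin w.length × Bool)) *
        (|c| + 1) ^ w.length, ?_⟩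
  have h1 : ∀ᶠ N in l, (p N : ℝ) / ((d₁ N : ℝ) * (d₂ N : ℝ)) < |c| + 1 :=
    H.ratio.eventually_lt_const (by linarith [le_abs_self c])
  filter_upwards [H.pos, h1] with N ⟨hd₁, hd₂⟩ h2
  have hn : (0 : ℝ) < (d₁ N : ℝ) * d₂ N := by positivity
  have : Nonempty (Fin (d₁ N)) := ⟨⟨0, hd₁⟩⟩
  have : Nonempty (Fin (d₂ N)) := ⟨⟨0, hd₂⟩⟩
  have h3 := expect_trace_wordMat_le (α := Fin (d₁ N)) (β := Fin (d₂ N)) (τ := Fin (p N)) w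
    (C := |c| + 1) (by linarith [abs_nonneg c]) (by
      simp only [Fintype.card_fin]
      rw [div_lt_iff₀ hn] at h2
      exact h2.le)
  rw [trPoly, map_smul, smul_eq_mul, inv_mul_le_iff₀ hn]
  simp only [Fintype.card_fin] at h3
  linarith

lemma WishartRegime.bddMoments_trPoly (H : WishartRegime l d₁ d₂ p c) (w : List (Fin 2)) :
    BddMoments l fun N => trPoly (d₁ N) (d₂ N) (p N) w := by
  intro k
  obtain ⟨w', hw⟩ := eval_trPoly_pow_le w k
  obtain ⟨C, hC⟩ := H.expect_trPoly_le w'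
  refine ⟨1 + C, ?_⟩
  filter_upwards [H.pos, hC] with N ⟨hd₁, hd₂⟩ h2
  refine le_trans ?_ (add_le_add_right h2 1)
  have h3 : expect (1 : MvPolynomial (Fin (d₁ N) × Fin (d₂ N) × Fin (p N)) ℝ) = 1 := expect_C 1
  rw [← h3, ← map_add]
  refine expect_mono fun x => ?_
  rw [map_pow, map_add, map_one]
  exact (pow_two_mul_le _ k).trans (by linarith [hw hd₁ hd₂ x])

end Regime

/-! ### Powers of the dimensions in the error terms. -/

section Numerics

/-- The common rate `a⁻¹ + b⁻¹` dominates every monomial in the inverse dimensions of positive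
degree in `a⁻¹`; the errors therefore need no separate rates. -/
lemma inv_pow_mul_inv_pow_le_fst {a b : ℝ} (ha : 1 ≤ a) (hb : 1 ≤ b) (i j : ℕ) :
    a⁻¹ ^ (i + 1) * b⁻¹ ^ j ≤ a⁻¹ + b⁻¹ := by
  have hx0 : 0 ≤ a⁻¹ := by positivity
  have hy0 : 0 ≤ b⁻¹ := by positivity
  have hx : a⁻¹ ≤ 1 := inv_le_one_of_one_le₀ ha
  have hy : b⁻¹ ≤ 1 := inv_le_one_of_one_le₀ hb
  have h1 : a⁻¹ ^ (i + 1) ≤ a⁻¹ := by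
    rw [pow_succ]
    exact mul_le_of_le_one_left hx0 (pow_le_one₀ hx0 hx)
  have h2 : b⁻¹ ^ j ≤ 1 := pow_le_one₀ hy0 hy
  calc a⁻¹ ^ (i + 1) * b⁻¹ ^ j ≤ a⁻¹ * 1 := mul_le_mul h1 h2 (by positivity) hx0
    _ ≤ _ := by linarith

lemma inv_pow_mul_inv_pow_le_snd {a b : ℝ} (ha : 1 ≤ a) (hb : 1 ≤ b) (i j : ℕ) :
    a⁻¹ ^ i * b⁻¹ ^ (j + 1) ≤ a⁻¹ + b⁻¹ := by
  rw [mul_comm, add_comm a⁻¹]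
  exact inv_pow_mul_inv_pow_le_fst hb ha j i

variable {a b t₁ t₂ t₃ t₄ t₅ : ℝ}

lemma pair_bound (ha : 1 ≤ a) (hb : 1 ≤ b) (h₁ : 0 ≤ t₁) (h₂ : 0 ≤ t₂) :
    ((a * b)⁻¹ ^ 2) ^ 2 * ((a * b * t₁) * (a * b * t₂)) ≤ (a⁻¹ + b⁻¹) * (t₁ * t₂) := by
  have e : ((a * b)⁻¹ ^ 2) ^ 2 * ((a * b * t₁) * (a * b * t₂)) =
      (a⁻¹ ^ 2 * b⁻¹ ^ 2) * (t₁ * t₂) := by field_simp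
  rw [e]
  exact mul_le_mul_of_nonneg_right (inv_pow_mul_inv_pow_le_fst ha hb 1 2) (by positivity)

lemma traced_pair_bound (ha : 1 ≤ a) (hb : 1 ≤ b) (h₁ : 0 ≤ t₁) (h₂ : 0 ≤ t₂) (h₃ : 0 ≤ t₃)
    (h₄ : 0 ≤ t₄) :
    ((a * b)⁻¹ ^ 2) ^ 2 * (2 * (a ^ 2 * ((a * b * t₁) * (a * b * t₂))) +
      2 * (b ^ 2 * ((a * b * t₃) * (a * b * t₄)))) ≤
      (a⁻¹ + b⁻¹) * (2 * (t₁ * t₂ + t₃ * t₄)) := by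
  have e : ((a * b)⁻¹ ^ 2) ^ 2 * (2 * (a ^ 2 * ((a * b * t₁) * (a * b * t₂))) +
      2 * (b ^ 2 * ((a * b * t₃) * (a * b * t₄)))) =
      (a⁻¹ ^ 0 * b⁻¹ ^ 2) * (2 * (t₁ * t₂)) + (a⁻¹ ^ 2 * b⁻¹ ^ 0) * (2 * (t₃ * t₄)) := by
    field_simp
  rw [e, mul_add, mul_add]
  exact add_le_add
    (mul_le_mul_of_nonneg_right (inv_pow_mul_inv_pow_le_snd ha hb 0 1) (by positivity))
    (mul_le_mul_of_nonneg_right (inv_pow_mul_inv_pow_le_fst ha hb 1 0) (by positivity))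

lemma triple_bound (ha : 1 ≤ a) (hb : 1 ≤ b) (h₁ : 0 ≤ t₁) (h₂ : 0 ≤ t₂) (h₃ : 0 ≤ t₃) :
    ((a * b)⁻¹ ^ 2) ^ 2 * ((a * b * t₁) * (a * b * t₂) * (a * b * t₃)) ≤
      (a⁻¹ + b⁻¹) * (t₁ * t₂ * t₃) := by
  have e : ((a * b)⁻¹ ^ 2) ^ 2 * ((a * b * t₁) * (a * b * t₂) * (a * b * t₃)) =
      (a⁻¹ ^ 1 * b⁻¹ ^ 1) * (t₁ * t₂ * t₃) := by field_simp
  rw [e]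
  exact mul_le_mul_of_nonneg_right (inv_pow_mul_inv_pow_le_fst ha hb 0 1) (by positivity)

lemma traced_triple_bound (ha : 1 ≤ a) (hb : 1 ≤ b) (h₁ : 0 ≤ t₁) (h₂ : 0 ≤ t₂) (h₃ : 0 ≤ t₃)
    (h₄ : 0 ≤ t₄) (h₅ : 0 ≤ t₅) :
    ((a * b)⁻¹ ^ 3) ^ 2 * (2 * ((a * b * t₁) * (a * b * t₂) * (b * (a * b * t₃))) +
      2 * ((b * (a * b * t₄)) * (b * (a * b * t₅)) * (b * (a * b * t₃)))) ≤
      (a⁻¹ + b⁻¹) * (2 * (t₁ * t₂ * t₃ + t₄ * t₅ * t₃)) := by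
  have e : ((a * b)⁻¹ ^ 3) ^ 2 * (2 * ((a * b * t₁) * (a * b * t₂) * (b * (a * b * t₃))) +
      2 * ((b * (a * b * t₄)) * (b * (a * b * t₅)) * (b * (a * b * t₃)))) =
      (a⁻¹ ^ 3 * b⁻¹ ^ 2) * (2 * (t₁ * t₂ * t₃)) +
        (a⁻¹ ^ 3 * b⁻¹ ^ 0) * (2 * (t₄ * t₅ * t₃)) := by
    field_simp
  rw [e, mul_add, mul_add]
  exact add_le_add
    (mul_le_mul_of_nonneg_right (inv_pow_mul_inv_pow_le_fst ha hb 2 2) (by positivity))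
    (mul_le_mul_of_nonneg_right (inv_pow_mul_inv_pow_le_fst ha hb 2 0) (by positivity))

lemma traced_quadruple_bound (ha : 1 ≤ a) (hb : 1 ≤ b) (h₁ : 0 ≤ t₁) (h₂ : 0 ≤ t₂) (h₃ : 0 ≤ t₃)
    (h₄ : 0 ≤ t₄) :
    ((a * b)⁻¹ ^ 3) ^ 2 * (2 * ((a * b * t₁) * (a * b * t₂) * (b * (a * b * t₃)) *
      (b * (a * b * t₄))) +
      2 * ((a * b * t₁) * (a * b * t₂) * (a * b * t₃) * (b * (a * b * t₄)))) ≤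
      (a⁻¹ + b⁻¹) * (4 * (t₁ * t₂ * t₃ * t₄)) := by
  have e : ((a * b)⁻¹ ^ 3) ^ 2 * (2 * ((a * b * t₁) * (a * b * t₂) * (b * (a * b * t₃)) *
      (b * (a * b * t₄))) +
      2 * ((a * b * t₁) * (a * b * t₂) * (a * b * t₃) * (b * (a * b * t₄)))) =
      (a⁻¹ ^ 2 * b⁻¹ ^ 0) * (2 * (t₁ * t₂ * t₃ * t₄)) +
        (a⁻¹ ^ 2 * b⁻¹ ^ 1) * (2 * (t₁ * t₂ * t₃ * t₄)) := by
    field_simp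
  have h4 : (a⁻¹ + b⁻¹) * (4 * (t₁ * t₂ * t₃ * t₄)) = (a⁻¹ + b⁻¹) * (2 * (t₁ * t₂ * t₃ * t₄)) +
      (a⁻¹ + b⁻¹) * (2 * (t₁ * t₂ * t₃ * t₄)) := by ring
  rw [e, h4]
  exact add_le_add
    (mul_le_mul_of_nonneg_right (inv_pow_mul_inv_pow_le_fst ha hb 1 0) (by positivity))
    (mul_le_mul_of_nonneg_right (inv_pow_mul_inv_pow_le_fst ha hb 1 1) (by positivity))

end Numerics

/-! ### The error terms are negligible. -/

section Errors
variable {ι : Type*} {l : Filter ι} {d₁ d₂ p : ι → ℕ} {c : ℝ}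

/-- The polynomial Wishart matrix. -/
noncomputable abbrev matPoly (d₁ d₂ p : ℕ) := wishartPoly (Fin d₁) (Fin d₂) (Fin p)

/-- The derivations of the polynomial ring of the polynomial Wishart matrix. -/
noncomputable abbrev derPoly (d₁ d₂ p : ℕ) := lieDer (Fin d₁) (Fin d₂) (Fin p)

/-- The normalized trace of the positive matrix `w wᵀ`. -/
noncomputable def sqPoly (d₁ d₂ p : ℕ) (w : List (Fin 2)) :
    MvPolynomial (Fin d₁ × Fin d₂ × Fin p) ℝ := trPoly d₁ d₂ p (w ++ w.reverse)

lemma eval_sqPoly_nonneg {d₁ d₂ p : ℕ} (h₁ : 0 < d₁) (h₂ : 0 < d₂)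
    (x : Fin d₁ × Fin d₂ × Fin p → ℝ) (w : List (Fin 2)) :
    0 ≤ MvPolynomial.eval x (sqPoly d₁ d₂ p w) := eval_trPoly_nonneg h₁ h₂ x w

lemma sqNorm_eq {d₁ d₂ p : ℕ} (h₁ : 0 < d₁) (h₂ : 0 < d₂)
    (x : Fin d₁ × Fin d₂ × Fin p → ℝ) (w : List (Fin 2)) :
    sqNorm ((wordPoly d₁ d₂ p w).map (MvPolynomial.eval x)) =
      ((d₁ : ℝ) * d₂) * MvPolynomial.eval x (sqPoly d₁ d₂ p w) := sqNorm_wordPoly h₁ h₂ x w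

lemma WishartRegime.bddMoments_sqPoly (H : WishartRegime l d₁ d₂ p c) (w : List (Fin 2)) :
    BddMoments l fun N => sqPoly (d₁ N) (d₂ N) (p N) w := H.bddMoments_trPoly _

lemma matPoly_mul_wordPoly (d₁ d₂ p : ℕ) (v : List (Fin 2)) :
    matPoly d₁ d₂ p * wordPoly d₁ d₂ p v = wordPoly d₁ d₂ p (0 :: v) := by
  rw [wordPoly, wordPoly, wordMat_cons, letterMat_zero]

lemma wordPoly_mul_matPoly (d₁ d₂ p : ℕ) (u : List (Fin 2)) :
    wordPoly d₁ d₂ p u * matPoly d₁ d₂ p = wordPoly d₁ d₂ p (u ++ [0]) := by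
  rw [wordPoly, wordPoly, wordMat_append, wordMat_singleton_zero]

lemma matPoly_eq (d₁ d₂ p : ℕ) : matPoly d₁ d₂ p = wordPoly d₁ d₂ p [0] :=
  (wordMat_singleton_zero _).symm

lemma sqNorm_traceFst_word_le {d₁ d₂ p : ℕ} (h₁ : 0 < d₁) (h₂ : 0 < d₂)
    (x : Fin d₁ × Fin d₂ × Fin p → ℝ) (w : List (Fin 2)) :
    sqNorm (traceFst ((wordPoly d₁ d₂ p w).map (MvPolynomial.eval x))) ≤
      d₁ * (d₁ * d₂ * MvPolynomial.eval x (sqPoly d₁ d₂ p w)) := by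
  have h := sqNorm_traceFst_le ((wordPoly d₁ d₂ p w).map (MvPolynomial.eval x))
  rwa [sqNorm_eq h₁ h₂, Fintype.card_fin] at h

lemma sqNorm_traceSnd_word_le {d₁ d₂ p : ℕ} (h₁ : 0 < d₁) (h₂ : 0 < d₂)
    (x : Fin d₁ × Fin d₂ × Fin p → ℝ) (w : List (Fin 2)) :
    sqNorm (traceSnd ((wordPoly d₁ d₂ p w).map (MvPolynomial.eval x))) ≤
      d₂ * (d₁ * d₂ * MvPolynomial.eval x (sqPoly d₁ d₂ p w)) := by
  have h := sqNorm_traceSnd_le ((wordPoly d₁ d₂ p w).map (MvPolynomial.eval x))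
  rwa [sqNorm_eq h₁ h₂, Fintype.card_fin] at h

lemma WishartRegime.negligible_loopHit_zero (H : WishartRegime l d₁ d₂ p c) (u v : List (Fin 2)) :
    Negligible l fun N => (((d₁ N : ℝ) * d₂ N)⁻¹ ^ 2) •
      (loopHit (matPoly (d₁ N) (d₂ N) (p N)) (derPoly (d₁ N) (d₂ N) (p N)) 0
        (wordPoly (d₁ N) (d₂ N) (p N) u) (wordPoly (d₁ N) (d₂ N) (p N) v) -
      (wordPoly (d₁ N) (d₂ N) (p N) u).trace * (wordPoly (d₁ N) (d₂ N) (p N) (0 :: v)).trace) := by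
  refine Negligible.of_le H.inv_add_inv
    ((H.bddMoments_sqPoly (u ++ [0])).mul (H.bddMoments_sqPoly v)) ?_
  filter_upwards [H.pos] with N ⟨h₁, h₂⟩ x
  have h := loopHit_zero_error_sq_le isLieAction_wishartPoly (MvPolynomial.eval x)
    (wordPoly (d₁ N) (d₂ N) (p N) u) (wordPoly (d₁ N) (d₂ N) (p N) v)
  rw [matPoly_mul_wordPoly, wordPoly_mul_matPoly, sqNorm_eq h₁ h₂, sqNorm_eq h₁ h₂] at h
  rw [MvPolynomial.smul_eval, mul_pow, map_mul]
  exact (mul_le_mul_of_nonneg_left h (sq_nonneg _)).trans (pair_bound (Nat.one_le_cast.2 h₁)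
    (Nat.one_le_cast.2 h₂) (eval_sqPoly_nonneg h₁ h₂ x _) (eval_sqPoly_nonneg h₁ h₂ x _))

lemma WishartRegime.negligible_loopHit_one (H : WishartRegime l d₁ d₂ p c) (u v : List (Fin 2)) :
    Negligible l fun N => (((d₁ N : ℝ) * d₂ N)⁻¹ ^ 2) •
      loopHit (matPoly (d₁ N) (d₂ N) (p N)) (derPoly (d₁ N) (d₂ N) (p N)) 1
        (wordPoly (d₁ N) (d₂ N) (p N) u) (wordPoly (d₁ N) (d₂ N) (p N) v) := by
  refine Negligible.of_le H.inv_add_inv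
    ((((H.bddMoments_sqPoly u).mul (H.bddMoments_sqPoly (v ++ [0]))).add
      ((H.bddMoments_sqPoly u).mul (H.bddMoments_sqPoly (v ++ [0])))).const_mul 2) ?_
  filter_upwards [H.pos] with N ⟨h₁, h₂⟩ x
  have h := loopHit_one_sq_le isLieAction_wishartPoly (MvPolynomial.eval x)
    (wordPoly (d₁ N) (d₂ N) (p N) u) (wordPoly (d₁ N) (d₂ N) (p N) v)
  rw [wordPoly_mul_matPoly, sqNorm_eq h₁ h₂, sqNorm_eq h₁ h₂, Fintype.card_fin,
    Fintype.card_fin] at h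
  rw [MvPolynomial.smul_eval, mul_pow, map_mul, map_add, map_mul, MvPolynomial.eval_C]
  exact (mul_le_mul_of_nonneg_left h (sq_nonneg _)).trans (traced_pair_bound
    (Nat.one_le_cast.2 h₁) (Nat.one_le_cast.2 h₂) (eval_sqPoly_nonneg h₁ h₂ x _)
    (eval_sqPoly_nonneg h₁ h₂ x _) (eval_sqPoly_nonneg h₁ h₂ x _) (eval_sqPoly_nonneg h₁ h₂ x _))

lemma WishartRegime.negligible_twistHit_zero (H : WishartRegime l d₁ d₂ p c)
    (u v : List (Fin 2)) : Negligible l fun N => (((d₁ N : ℝ) * d₂ N)⁻¹ ^ 2) •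
      twistHit (matPoly (d₁ N) (d₂ N) (p N)) (derPoly (d₁ N) (d₂ N) (p N)) 0
        (wordPoly (d₁ N) (d₂ N) (p N) u) (wordPoly (d₁ N) (d₂ N) (p N) v) := by
  refine Negligible.of_le H.inv_add_inv
    ((((H.bddMoments_sqPoly u).mul (H.bddMoments_sqPoly (0 :: v))).add
      ((H.bddMoments_sqPoly (u ++ [0])).mul (H.bddMoments_sqPoly v))).const_mul 2) ?_
  filter_upwards [H.pos] with N ⟨h₁, h₂⟩ x
  have h := twistHit_zero_sq_le isLieAction_wishartPoly (MvPolynomial.eval x)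
    (wordPoly (d₁ N) (d₂ N) (p N) u) (wordPoly (d₁ N) (d₂ N) (p N) v)
  rw [wordPoly_mul_matPoly, matPoly_mul_wordPoly, sqNorm_eq h₁ h₂, sqNorm_eq h₁ h₂,
    sqNorm_eq h₁ h₂, sqNorm_eq h₁ h₂, Fintype.card_fin, Fintype.card_fin] at h
  rw [MvPolynomial.smul_eval, mul_pow, map_mul, map_add, map_mul, map_mul, MvPolynomial.eval_C]
  exact (mul_le_mul_of_nonneg_left h (sq_nonneg _)).trans (traced_pair_bound
    (Nat.one_le_cast.2 h₁) (Nat.one_le_cast.2 h₂) (eval_sqPoly_nonneg h₁ h₂ x _)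
    (eval_sqPoly_nonneg h₁ h₂ x _) (eval_sqPoly_nonneg h₁ h₂ x _) (eval_sqPoly_nonneg h₁ h₂ x _))

lemma WishartRegime.negligible_twistHit_one (H : WishartRegime l d₁ d₂ p c)
    (u v : List (Fin 2)) : Negligible l fun N => (((d₁ N : ℝ) * d₂ N)⁻¹ ^ 2) •
      (twistHit (matPoly (d₁ N) (d₂ N) (p N)) (derPoly (d₁ N) (d₂ N) (p N)) 1
        (wordPoly (d₁ N) (d₂ N) (p N) u) (wordPoly (d₁ N) (d₂ N) (p N) v) -
      mainSum (wordPoly (d₁ N) (d₂ N) (p N) u) (matPoly (d₁ N) (d₂ N) (p N))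
        (wordPoly (d₁ N) (d₂ N) (p N) v)) := by
  refine Negligible.of_le H.inv_add_inv
    (((H.bddMoments_sqPoly u).mul (H.bddMoments_sqPoly [0])).mul (H.bddMoments_sqPoly v)) ?_
  filter_upwards [H.pos] with N ⟨h₁, h₂⟩ x
  have h := twistHit_one_error_sq_le isLieAction_wishartPoly (MvPolynomial.eval x)
    (wordPoly (d₁ N) (d₂ N) (p N) u) (wordPoly (d₁ N) (d₂ N) (p N) v)
  have e := sqNorm_eq h₁ h₂ x (p := p N) [0]
  rw [← matPoly_eq] at e
  rw [sqNorm_eq h₁ h₂, sqNorm_eq h₁ h₂, e] at h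
  rw [MvPolynomial.smul_eval, mul_pow, map_mul, map_mul]
  exact (mul_le_mul_of_nonneg_left h (sq_nonneg _)).trans (triple_bound
    (Nat.one_le_cast.2 h₁) (Nat.one_le_cast.2 h₂) (eval_sqPoly_nonneg h₁ h₂ x _)
    (eval_sqPoly_nonneg h₁ h₂ x _) (eval_sqPoly_nonneg h₁ h₂ x _))

/-- One power of the three in the prefactor comes from the second integration by parts. A squared
word norm has order `d₁ * d₂` and a partial trace over the second factor adds `d₂`; the largest term
is then of order `d₁⁻¹ ^ 2`. -/
lemma WishartRegime.negligible_fstHit (H : WishartRegime l d₁ d₂ p c) (e : Fin 2)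
    (u v w : List (Fin 2)) : Negligible l fun N => (((d₁ N : ℝ) * d₂ N)⁻¹ ^ 3) •
      fstHit (matPoly (d₁ N) (d₂ N) (p N)) (derPoly (d₁ N) (d₂ N) (p N)) e
        (wordPoly (d₁ N) (d₂ N) (p N) u) (wordPoly (d₁ N) (d₂ N) (p N) v)
        (traceSnd (wordPoly (d₁ N) (d₂ N) (p N) w)) := by
  have hb := H.bddMoments_sqPoly
  fin_cases e
  · refine Negligible.of_le H.inv_add_inv
      (((((hb u).mul (hb (0 :: v))).mul (hb w)).add
        (((hb (u ++ [0])).mul (hb v)).mul (hb w))).const_mul 2) ?_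
    filter_upwards [H.pos] with N ⟨h₁, h₂⟩ x
    have h := fstHit_zero_sq_le isLieAction_wishartPoly (MvPolynomial.eval x)
      (wordPoly (d₁ N) (d₂ N) (p N) u) (wordPoly (d₁ N) (d₂ N) (p N) v)
      (traceSnd (wordPoly (d₁ N) (d₂ N) (p N) w))
    have g := eval_sqPoly_nonneg h₁ h₂ x (p := p N)
    rw [traceSnd_map, wordPoly_mul_matPoly, matPoly_mul_wordPoly, sqNorm_eq h₁ h₂,
      sqNorm_eq h₁ h₂] at h
    simp only [MvPolynomial.smul_eval, mul_pow _ _ 2, map_mul, map_add, MvPolynomial.eval_C]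
    refine (mul_le_mul_of_nonneg_left (h.trans ?_) (sq_nonneg _)).trans (traced_triple_bound
      (Nat.one_le_cast.2 h₁) (Nat.one_le_cast.2 h₂) (g _) (g _) (g _) (g _) (g _))
    have g1 := g u
    have g2 := g (0 :: v)
    have g3 := g (u ++ [0])
    have g4 := g v
    have i1 := sqNorm_traceSnd_word_le h₁ h₂ x (p := p N) (u ++ [0])
    have i2 := sqNorm_traceSnd_word_le h₁ h₂ x (p := p N) v
    have i3 := sqNorm_traceSnd_word_le h₁ h₂ x (p := p N) w
    have n1 := sqNorm_nonneg (traceSnd ((wordPoly (d₁ N) (d₂ N) (p N) v).map (MvPolynomial.eval x)))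
    have n2 := sqNorm_nonneg (traceSnd ((wordPoly (d₁ N) (d₂ N) (p N) w).map (MvPolynomial.eval x)))
    gcongr
  · refine Negligible.of_le H.inv_add_inv
      (((((hb u).mul (hb [0])).mul (hb v)).mul (hb w)).const_mul 4) ?_
    filter_upwards [H.pos] with N ⟨h₁, h₂⟩ x
    have h := fstHit_one_sq_le isLieAction_wishartPoly (MvPolynomial.eval x)
      (wordPoly (d₁ N) (d₂ N) (p N) u) (wordPoly (d₁ N) (d₂ N) (p N) v)
      (traceSnd (wordPoly (d₁ N) (d₂ N) (p N) w))
    have g := eval_sqPoly_nonneg h₁ h₂ x (p := p N)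
    have e := sqNorm_eq h₁ h₂ x (p := p N) [0]
    rw [← matPoly_eq] at e
    rw [traceSnd_map, e, sqNorm_eq h₁ h₂, sqNorm_eq h₁ h₂] at h
    simp only [MvPolynomial.smul_eval, mul_pow _ _ 2, map_mul, MvPolynomial.eval_C]
    refine (mul_le_mul_of_nonneg_left (h.trans ?_) (sq_nonneg _)).trans (traced_quadruple_bound
      (Nat.one_le_cast.2 h₁) (Nat.one_le_cast.2 h₂) (g _) (g _) (g _) (g _))
    have g1 := g u
    have g2 := g [0]
    have g3 := g v
    have i2 := sqNorm_traceSnd_word_le h₁ h₂ x (p := p N) v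
    have i3 := sqNorm_traceSnd_word_le h₁ h₂ x (p := p N) w
    have n2 := sqNorm_nonneg (traceSnd ((wordPoly (d₁ N) (d₂ N) (p N) w).map (MvPolynomial.eval x)))
    gcongr

lemma WishartRegime.negligible_sndHit (H : WishartRegime l d₁ d₂ p c) (e : Fin 2)
    (u v w : List (Fin 2)) : Negligible l fun N => (((d₁ N : ℝ) * d₂ N)⁻¹ ^ 3) •
      sndHit (matPoly (d₁ N) (d₂ N) (p N)) (derPoly (d₁ N) (d₂ N) (p N)) e
        (wordPoly (d₁ N) (d₂ N) (p N) u) (wordPoly (d₁ N) (d₂ N) (p N) v)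
        (traceFst (wordPoly (d₁ N) (d₂ N) (p N) w)) := by
  have hb := H.bddMoments_sqPoly
  fin_cases e
  · refine Negligible.of_le H.inv_add_inv
      (((((hb (u ++ [0])).mul (hb v)).mul (hb w)).add
        (((hb u).mul (hb (0 :: v))).mul (hb w))).const_mul 2) ?_
    filter_upwards [H.pos] with N ⟨h₁, h₂⟩ x
    have h := sndHit_zero_sq_le isLieAction_wishartPoly (MvPolynomial.eval x)
      (wordPoly (d₁ N) (d₂ N) (p N) u) (wordPoly (d₁ N) (d₂ N) (p N) v)
      (traceFst (wordPoly (d₁ N) (d₂ N) (p N) w))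
    have g := eval_sqPoly_nonneg h₁ h₂ x (p := p N)
    rw [traceFst_map, wordPoly_mul_matPoly, matPoly_mul_wordPoly, sqNorm_eq h₁ h₂ x (u ++ [0]),
      sqNorm_eq h₁ h₂ x v, add_comm] at h
    simp only [MvPolynomial.smul_eval, mul_pow _ _ 2, map_mul, map_add, MvPolynomial.eval_C]
    -- The roles of the two dimensions are exchanged, so that the same numerical bound serves for
    -- partial traces over the first factor.
    rw [mul_comm (d₁ N : ℝ), add_comm (d₁ N : ℝ)⁻¹]
    rw [mul_comm (d₁ N : ℝ)] at h
    refine (mul_le_mul_of_nonneg_left (h.trans ?_) (sq_nonneg _)).trans (traced_triple_bound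
      (Nat.one_le_cast.2 h₂) (Nat.one_le_cast.2 h₁) (g _) (g _) (g _) (g _) (g _))
    have g1 := g u
    have g2 := g (0 :: v)
    have g3 := g (u ++ [0])
    have g4 := g v
    have i1 := sqNorm_traceFst_word_le h₁ h₂ x (p := p N) (0 :: v)
    have i2 := sqNorm_traceFst_word_le h₁ h₂ x (p := p N) u
    have i3 := sqNorm_traceFst_word_le h₁ h₂ x (p := p N) w
    rw [mul_comm (d₁ N : ℝ) (d₂ N : ℝ)] at i1 i2 i3
    have n1 := sqNorm_nonneg (traceFst ((wordPoly (d₁ N) (d₂ N) (p N) (0 :: v)).map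
      (MvPolynomial.eval x)))
    have n2 := sqNorm_nonneg (traceFst ((wordPoly (d₁ N) (d₂ N) (p N) w).map (MvPolynomial.eval x)))
    gcongr
  · refine Negligible.of_le H.inv_add_inv
      (((((hb [0]).mul (hb v)).mul (hb u)).mul (hb w)).const_mul 4) ?_
    filter_upwards [H.pos] with N ⟨h₁, h₂⟩ x
    have h := sndHit_one_sq_le isLieAction_wishartPoly (MvPolynomial.eval x)
      (wordPoly (d₁ N) (d₂ N) (p N) u) (wordPoly (d₁ N) (d₂ N) (p N) v)
      (traceFst (wordPoly (d₁ N) (d₂ N) (p N) w))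
    have g := eval_sqPoly_nonneg h₁ h₂ x (p := p N)
    have e := sqNorm_eq h₁ h₂ x (p := p N) [0]
    rw [← matPoly_eq] at e
    rw [traceFst_map, e, sqNorm_eq h₁ h₂ x u, sqNorm_eq h₁ h₂ x v] at h
    have hcomm : ∀ t₁ t₂ t₃ t₄ : ℝ, t₃ * t₂ * t₁ * t₄ = t₁ * t₂ * t₃ * t₄ := fun _ _ _ _ => by ring
    rw [hcomm _ _ (_ * MvPolynomial.eval x (sqPoly (d₁ N) (d₂ N) (p N) u))] at h
    simp only [MvPolynomial.smul_eval, mul_pow _ _ 2, map_mul, MvPolynomial.eval_C]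
    rw [mul_comm (d₁ N : ℝ), add_comm (d₁ N : ℝ)⁻¹]
    rw [mul_comm (d₁ N : ℝ)] at h
    refine (mul_le_mul_of_nonneg_left (h.trans ?_) (sq_nonneg _)).trans (traced_quadruple_bound
      (Nat.one_le_cast.2 h₂) (Nat.one_le_cast.2 h₁) (g _) (g _) (g _) (g _))
    have g1 := g u
    have g2 := g [0]
    have g3 := g v
    have i2 := sqNorm_traceFst_word_le h₁ h₂ x (p := p N) u
    have i3 := sqNorm_traceFst_word_le h₁ h₂ x (p := p N) w
    rw [mul_comm (d₁ N : ℝ) (d₂ N : ℝ)] at i2 i3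
    have n2 := sqNorm_nonneg (traceFst ((wordPoly (d₁ N) (d₂ N) (p N) w).map (MvPolynomial.eval x)))
    gcongr

end Errors

/-! ### Derivatives of traces of words. -/

section TraceHit
variable {α β R : Type*} [Fintype α] [Fintype β] [DecidableEq α] [DecidableEq β] [CommRing R]
  [Algebra ℝ R] {W : Matrix (α × β) (α × β) R} {D : α × β → α × β → Derivation ℝ R R}

/-- The contribution of one letter to the derivative of the trace of a word. -/
def traceHit (W : Matrix (α × β) (α × β) R) (D : α × β → α × β → Derivation ℝ R R) (e : Fin 2)
    (u v : Matrix (α × β) (α × β) R) (a b : α × β) : R :=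
  (u * (letterMat W e).map (D a b) * v).trace

lemma derivation_trace_wordMat (W : Matrix (α × β) (α × β) R)
    (D : α × β → α × β → Derivation ℝ R R) (w : List (Fin 2)) (a b : α × β) :
    D a b (wordMat W w).trace = ((splits w).map fun t =>
      traceHit W D t.2.1 (wordMat W t.1) (wordMat W t.2.2) a b).sum := by
  simp only [Matrix.trace, Matrix.diag, map_sum, sum_derivation_wordMat, sum_list_sum_comm]
  rfl

lemma traceHit_zero (h : IsLieAction W D) (u v : Matrix (α × β) (α × β) R) (a b : α × β) :
    traceHit W D 0 u v a b = (W * (v * u)) a b + (v * u * W) b a := by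
  simp only [traceHit, Matrix.trace, Matrix.diag, hit_zero h, Finset.sum_add_distrib]
  rw [← Matrix.mul_assoc W, Matrix.mul_assoc v, Matrix.mul_apply, Matrix.mul_apply (M := v)]
  simp only [mul_comm]

lemma traceHit_one (h : IsLieAction W D) (u v : Matrix (α × β) (α × β) R) (a b : α × β) :
    traceHit W D 1 u v a b =
      (∑ t : α × β, W a t * (v * u) (t.1, b.2) (b.1, t.2)) +
        ∑ t : α × β, W a t * (v * u) (b.1, t.2) (t.1, b.2) := by
  simp only [traceHit, Matrix.trace, Matrix.diag, hit_one h, Finset.sum_add_distrib]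
  congr 1
  · rw [Finset.sum_comm, Fintype.sum_prod_type_right]
    refine Finset.sum_congr rfl fun x _ => ?_
    rw [Finset.sum_comm]
    refine Finset.sum_congr rfl fun y _ => ?_
    rw [Matrix.mul_apply, Finset.mul_sum]
    exact Finset.sum_congr rfl fun z _ => by ring
  · rw [Finset.sum_comm, Fintype.sum_prod_type]
    refine Finset.sum_congr rfl fun x _ => ?_
    rw [Finset.sum_comm]
    refine Finset.sum_congr rfl fun y _ => ?_
    rw [Matrix.mul_apply, Finset.mul_sum]
    exact Finset.sum_congr rfl fun z _ => by ring

variable (f : R →+* ℝ)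

lemma sqNorm_traceHit_zero_le (h : IsLieAction W D) (u v : Matrix (α × β) (α × β) R) :
    (sqNorm fun a b => f (traceHit W D 0 u v a b)) ≤
      2 * (sqNorm ((W * (v * u)).map f) + sqNorm ((v * u * W).map f)) := by
  simp only [traceHit_zero h, map_add]
  refine (sqNorm_add_le _ _).trans (le_of_eq ?_)
  rw [sqNorm_swap fun a b => f ((v * u * W) a b)]
  rfl

lemma sqNorm_twist_fst {α β : Type*} [Fintype α] [Fintype β] (M : Matrix (α × β) (α × β) ℝ) :
    (sqNorm fun t b : α × β => M (t.1, b.2) (b.1, t.2)) = sqNorm M := by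
  simp only [sqNorm, Fintype.sum_prod_type]
  refine Finset.sum_congr rfl fun x _ => ?_
  calc _ = ∑ z : α, ∑ y : β, ∑ t : β, M (x, t) (z, y) ^ 2 := Finset.sum_comm
    _ = ∑ z : α, ∑ t : β, ∑ y : β, M (x, t) (z, y) ^ 2 :=
      Finset.sum_congr rfl fun z _ => Finset.sum_comm
    _ = _ := Finset.sum_comm

lemma sqNorm_twist_snd {α β : Type*} [Fintype α] [Fintype β] (M : Matrix (α × β) (α × β) ℝ) :
    (sqNorm fun t b : α × β => M (b.1, t.2) (t.1, b.2)) = sqNorm M := by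
  rw [← sqNorm_swap, ← sqNorm_twist_fst M]

/-- Each term is a product of `W` with a matrix whose entries are those of `v * u` rearranged, so
submultiplicativity of the Hilbert–Schmidt norm applies. -/
lemma sqNorm_traceHit_one_le (h : IsLieAction W D) (u v : Matrix (α × β) (α × β) R) :
    (sqNorm fun a b => f (traceHit W D 1 u v a b)) ≤
      2 * (sqNorm (W.map f) * sqNorm ((v * u).map f) +
        sqNorm (W.map f) * sqNorm ((v * u).map f)) := by
  simp only [traceHit_one h, map_add, map_sum, map_mul]
  have h1 := sqNorm_comp_le (fun t a : α × β => f (W a t))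
    fun t b : α × β => (v * u).map f (t.1, b.2) (b.1, t.2)
  have h2 := sqNorm_comp_le (fun t a : α × β => f (W a t))
    fun t b : α × β => (v * u).map f (b.1, t.2) (t.1, b.2)
  rw [sqNorm_twist_fst, sqNorm_swap fun a t : α × β => f (W a t)] at h1
  rw [sqNorm_twist_snd, sqNorm_swap fun a t : α × β => f (W a t)] at h2
  exact (sqNorm_add_le _ _).trans (mul_le_mul_of_nonneg_left (add_le_add h1 h2) zero_le_two)

end TraceHit

/-! ### Test functions with controlled derivatives. -/

section TestFunctions
variable {ι : Type*} {l : Filter ι} {d₁ d₂ p : ι → ℕ} {c : ℝ}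

/-- Families of polynomials with bounded moments and bounded derivatives. -/
structure DerBdd (l : Filter ι) (d₁ d₂ p : ι → ℕ)
    (Q : ∀ N, MvPolynomial (Fin (d₁ N) × Fin (d₂ N) × Fin (p N)) ℝ) : Prop where
  bdd : BddMoments l Q
  der : BddNorm l fun N a b => derPoly (d₁ N) (d₂ N) (p N) a b (Q N)

lemma derBdd_one : DerBdd l d₁ d₂ p fun _ => 1 where
  bdd := by simpa using bddMoments_C (l := l) (σ := fun N => Fin (d₁ N) × Fin (d₂ N) × Fin (p N)) 1
  der := BddNorm.of_le (bddMoments_C 0) (Eventually.of_forall fun N x => by simp [sqNorm])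

lemma DerBdd.mul {F G : ∀ N, MvPolynomial (Fin (d₁ N) × Fin (d₂ N) × Fin (p N)) ℝ}
    (hF : DerBdd l d₁ d₂ p F) (hG : DerBdd l d₁ d₂ p G) :
    DerBdd l d₁ d₂ p fun N => F N * G N where
  bdd := hF.bdd.mul hG.bdd
  der := by
    simp only [Derivation.leibniz, smul_eq_mul]
    exact (hG.der.mul_left hF.bdd).add (hF.der.mul_left hG.bdd)

lemma inv_sq_mul_le {n t s : ℝ} (hn : 1 ≤ n) (ht : 0 ≤ t) (hs : 0 ≤ s) :
    n⁻¹ ^ 2 * (2 * (n * t + n * s)) ≤ 2 * (t + s) := by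
  have e : n⁻¹ ^ 2 * (2 * (n * t + n * s)) = n⁻¹ * (2 * (t + s)) := by field_simp
  rw [e]
  exact mul_le_of_le_one_left (by positivity) (inv_le_one_of_one_le₀ hn)

/-- For the transposed letter the powers of the dimension cancel exactly, so the bound does not
decay. Boundedness is enough, since `negligible_sum_der` and its variants bring their own decay. -/
lemma WishartRegime.bddNorm_traceHit (H : WishartRegime l d₁ d₂ p c) (e : Fin 2)
    (u v : List (Fin 2)) : BddNorm l fun N a b => ((d₁ N : ℝ) * d₂ N)⁻¹ •
      traceHit (matPoly (d₁ N) (d₂ N) (p N)) (derPoly (d₁ N) (d₂ N) (p N)) e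
        (wordPoly (d₁ N) (d₂ N) (p N) u) (wordPoly (d₁ N) (d₂ N) (p N) v) a b := by
  have hb := H.bddMoments_sqPoly
  fin_cases e
  · refine BddNorm.of_le (((hb (0 :: (v ++ u))).add (hb (v ++ u ++ [0]))).const_mul 2) ?_
    filter_upwards [H.pos] with N ⟨h₁, h₂⟩ x
    have h := sqNorm_traceHit_zero_le (MvPolynomial.eval x) isLieAction_wishartPoly
      (wordPoly (d₁ N) (d₂ N) (p N) u) (wordPoly (d₁ N) (d₂ N) (p N) v)
    have g := eval_sqPoly_nonneg h₁ h₂ x (p := p N)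
    have hn : (1 : ℝ) ≤ (d₁ N : ℝ) * d₂ N := by exact_mod_cast Nat.mul_pos h₁ h₂
    rw [← wordMat_append, matPoly_mul_wordPoly, wordPoly_mul_matPoly, sqNorm_eq h₁ h₂,
      sqNorm_eq h₁ h₂] at h
    simp only [MvPolynomial.smul_eval, map_mul, map_add, MvPolynomial.eval_C]
    rw [sqNorm_const_mul]
    exact (mul_le_mul_of_nonneg_left h (sq_nonneg _)).trans (inv_sq_mul_le hn (g _) (g _))
  · refine BddNorm.of_le ((((hb [0]).mul (hb (v ++ u))).add
      ((hb [0]).mul (hb (v ++ u)))).const_mul 2) ?_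
    filter_upwards [H.pos] with N ⟨h₁, h₂⟩ x
    have h := sqNorm_traceHit_one_le (MvPolynomial.eval x) isLieAction_wishartPoly
      (wordPoly (d₁ N) (d₂ N) (p N) u) (wordPoly (d₁ N) (d₂ N) (p N) v)
    have e := sqNorm_eq h₁ h₂ x (p := p N) [0]
    rw [← matPoly_eq] at e
    have hn : (d₁ N : ℝ) * d₂ N ≠ 0 := by positivity
    rw [← wordMat_append, e, sqNorm_eq h₁ h₂] at h
    simp only [MvPolynomial.smul_eval, map_mul, map_add, MvPolynomial.eval_C]
    rw [sqNorm_const_mul]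
    refine (mul_le_mul_of_nonneg_left h (sq_nonneg _)).trans (le_of_eq ?_)
    field_simp

lemma WishartRegime.derBdd_trPoly (H : WishartRegime l d₁ d₂ p c) (w : List (Fin 2)) :
    DerBdd l d₁ d₂ p fun N => trPoly (d₁ N) (d₂ N) (p N) w where
  bdd := H.bddMoments_trPoly w
  der := by
    simp only [trPoly, Derivation.map_smul, derivation_trace_wordMat, List.smul_sum, List.map_map]
    exact bddNorm_list_sum (splits w) (fun t N a b => ((d₁ N : ℝ) * d₂ N)⁻¹ •
      traceHit (matPoly (d₁ N) (d₂ N) (p N)) (derPoly (d₁ N) (d₂ N) (p N)) t.2.1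
        (wordPoly (d₁ N) (d₂ N) (p N) t.1) (wordPoly (d₁ N) (d₂ N) (p N) t.2.2) a b)
      fun t _ => H.bddNorm_traceHit _ _ _

lemma inv_sq_sq_mul_le {a b t s : ℝ} (ha : 1 ≤ a) (hb : 1 ≤ b) (ht : 0 ≤ t) (hs : 0 ≤ s) :
    ((a * b)⁻¹ ^ 2) ^ 2 * ((a * b * t) * s) ≤ (a⁻¹ + b⁻¹) * (t * s) := by
  have e : ((a * b)⁻¹ ^ 2) ^ 2 * ((a * b * t) * s) = (a⁻¹ ^ 3 * b⁻¹ ^ 3) * (t * s) := by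
    field_simp
  rw [e]
  exact mul_le_mul_of_nonneg_right (inv_pow_mul_inv_pow_le_fst ha hb 2 3) (by positivity)

lemma inv_cube_sq_mul_le {a b t₁ t₂ s : ℝ} (ha : 1 ≤ a) (hb : 1 ≤ b) (h₁ : 0 ≤ t₁) (h₂ : 0 ≤ t₂)
    (hs : 0 ≤ s) : ((a * b)⁻¹ ^ 3) ^ 2 * ((a * (a * b * t₁)) * (b * (a * b * t₂)) * s) ≤
      (a⁻¹ + b⁻¹) * (t₁ * t₂ * s) := by
  have e : ((a * b)⁻¹ ^ 3) ^ 2 * ((a * (a * b * t₁)) * (b * (a * b * t₂)) * s) =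
      (a⁻¹ ^ 3 * b⁻¹ ^ 3) * (t₁ * t₂ * s) := by field_simp
  rw [e]
  exact mul_le_mul_of_nonneg_right (inv_pow_mul_inv_pow_le_fst ha hb 2 3) (by positivity)

variable {Q : ∀ N, MvPolynomial (Fin (d₁ N) × Fin (d₂ N) × Fin (p N)) ℝ}

/-- This is the term in which the derivative falls on the test function. Cauchy–Schwarz against the
bounded gradient leaves a square of order `(d₁ * d₂)⁻¹ ^ 3`. -/
lemma WishartRegime.negligible_sum_der (H : WishartRegime l d₁ d₂ p c)
    (hQ : DerBdd l d₁ d₂ p Q) (w : List (Fin 2)) :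
    Negligible l fun N => (((d₁ N : ℝ) * d₂ N)⁻¹ ^ 2) •
      ∑ a, ∑ b, wordPoly (d₁ N) (d₂ N) (p N) w b a * derPoly (d₁ N) (d₂ N) (p N) a b (Q N) := by
  refine Negligible.of_le H.inv_add_inv ((H.bddMoments_sqPoly w).mul hQ.der) ?_
  filter_upwards [H.pos] with N ⟨h₁, h₂⟩ x
  have h := sum_mul_sq_le (fun a b => MvPolynomial.eval x (wordPoly (d₁ N) (d₂ N) (p N) w b a))
    fun a b => MvPolynomial.eval x (derPoly (d₁ N) (d₂ N) (p N) a b (Q N))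
  rw [sqNorm_swap fun b a => MvPolynomial.eval x (wordPoly (d₁ N) (d₂ N) (p N) w b a)] at h
  have e := sqNorm_eq h₁ h₂ x (p := p N) w
  change sqNorm (fun b a => MvPolynomial.eval x (wordPoly (d₁ N) (d₂ N) (p N) w b a)) = _ at e
  rw [e] at h
  rw [MvPolynomial.smul_eval, mul_pow, map_mul, eval_sum_sq]
  simp only [map_sum, map_mul]
  exact (mul_le_mul_of_nonneg_left h (sq_nonneg _)).trans (inv_sq_sq_mul_le
    (Nat.one_le_cast.2 h₁) (Nat.one_le_cast.2 h₂) (eval_sqPoly_nonneg h₁ h₂ x _) (sqNorm_nonneg _))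

lemma WishartRegime.negligible_sum_der_twist (H : WishartRegime l d₁ d₂ p c)
    (hQ : DerBdd l d₁ d₂ p Q) (w : List (Fin 2)) :
    Negligible l fun N => (((d₁ N : ℝ) * d₂ N)⁻¹ ^ 2) •
      ∑ a : Fin (d₁ N) × Fin (d₂ N), ∑ b : Fin (d₁ N) × Fin (d₂ N),
        wordPoly (d₁ N) (d₂ N) (p N) w (b.1, a.2) (a.1, b.2) *
          derPoly (d₁ N) (d₂ N) (p N) a b (Q N) := by
  refine Negligible.of_le H.inv_add_inv ((H.bddMoments_sqPoly w).mul hQ.der) ?_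
  filter_upwards [H.pos] with N ⟨h₁, h₂⟩ x
  have h := sum_mul_sq_le (fun a b : Fin (d₁ N) × Fin (d₂ N) =>
      (wordPoly (d₁ N) (d₂ N) (p N) w).map (MvPolynomial.eval x) (b.1, a.2) (a.1, b.2))
    fun a b => MvPolynomial.eval x (derPoly (d₁ N) (d₂ N) (p N) a b (Q N))
  rw [sqNorm_twist_snd, sqNorm_eq h₁ h₂] at h
  rw [MvPolynomial.smul_eval, mul_pow, map_mul, eval_sum_sq]
  simp only [map_sum, map_mul]
  exact (mul_le_mul_of_nonneg_left h (sq_nonneg _)).trans (inv_sq_sq_mul_le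
    (Nat.one_le_cast.2 h₁) (Nat.one_le_cast.2 h₂) (eval_sqPoly_nonneg h₁ h₂ x _) (sqNorm_nonneg _))

lemma sqNorm_tensor {α β : Type*} [Fintype α] [Fintype β] (U : Matrix β β ℝ) (V : Matrix α α ℝ) :
    (sqNorm fun a b : α × β => U a.2 b.2 * V b.1 a.1) = sqNorm U * sqNorm V := by
  rw [← sqNorm_swap V]
  simp only [sqNorm, Fintype.sum_prod_type, mul_pow]
  simp only [Finset.sum_mul_sum]
  rw [Finset.sum_comm]
  refine Finset.sum_congr rfl fun x _ => Finset.sum_congr rfl fun y _ => ?_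
  exact Finset.sum_comm

lemma WishartRegime.negligible_sum_der_traces (H : WishartRegime l d₁ d₂ p c)
    (hQ : DerBdd l d₁ d₂ p Q) (u v : List (Fin 2)) :
    Negligible l fun N => (((d₁ N : ℝ) * d₂ N)⁻¹ ^ 3) •
      ∑ a : Fin (d₁ N) × Fin (d₂ N), ∑ b : Fin (d₁ N) × Fin (d₂ N),
        traceFst (wordPoly (d₁ N) (d₂ N) (p N) u) a.2 b.2 *
          traceSnd (wordPoly (d₁ N) (d₂ N) (p N) v) b.1 a.1 *
          derPoly (d₁ N) (d₂ N) (p N) a b (Q N) := by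
  refine Negligible.of_le H.inv_add_inv
    (((H.bddMoments_sqPoly u).mul (H.bddMoments_sqPoly v)).mul hQ.der) ?_
  filter_upwards [H.pos] with N ⟨h₁, h₂⟩ x
  have h := sum_mul_sq_le (fun a b : Fin (d₁ N) × Fin (d₂ N) =>
      (traceFst (wordPoly (d₁ N) (d₂ N) (p N) u)).map (MvPolynomial.eval x) a.2 b.2 *
      (traceSnd (wordPoly (d₁ N) (d₂ N) (p N) v)).map (MvPolynomial.eval x) b.1 a.1)
    fun a b => MvPolynomial.eval x (derPoly (d₁ N) (d₂ N) (p N) a b (Q N))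
  rw [sqNorm_tensor, traceFst_map, traceSnd_map] at h
  rw [MvPolynomial.smul_eval, mul_pow _ _ 2, map_mul, map_mul, eval_sum_sq]
  simp only [map_sum, map_mul]
  rw [← traceFst_map, ← traceSnd_map] at h
  refine (mul_le_mul_of_nonneg_left (h.trans ?_) (sq_nonneg _)).trans (inv_cube_sq_mul_le
    (Nat.one_le_cast.2 h₁) (Nat.one_le_cast.2 h₂) (eval_sqPoly_nonneg h₁ h₂ x _)
    (eval_sqPoly_nonneg h₁ h₂ x _) (sqNorm_nonneg _))
  rw [traceFst_map, traceSnd_map]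
  exact mul_le_mul_of_nonneg_right (mul_le_mul (sqNorm_traceFst_word_le h₁ h₂ x u)
    (sqNorm_traceSnd_word_le h₁ h₂ x v) (sqNorm_nonneg _) (by
      have := eval_sqPoly_nonneg h₁ h₂ x (p := p N) u
      positivity)) (sqNorm_nonneg _)

end TestFunctions

lemma tendsto_list_sum_zero {ι T : Type*} {l : Filter ι} (s : List T) (g : T → ι → ℝ)
    (h : ∀ t ∈ s, Tendsto (g t) l (𝓝 0)) : Tendsto (fun N => (s.map fun t => g t N).sum) l (𝓝 0) := by
  have := tendsto_list_sum s h
  simpa using this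

lemma list_sum_mul_sub {T : Type*} (s : List T) (z : ℝ) (g h : T → ℝ) :
    (s.map fun t => z * g t - h t).sum = z * (s.map g).sum - (s.map h).sum := by
  induction s with
  | nil => simp
  | cons t s ih =>
    simp only [List.map_cons, List.sum_cons, ih]
    ring

/-! ### Asymptotic loop equations. -/

section Recursion
variable {ι : Type*} {l : Filter ι} {d₁ d₂ p : ι → ℕ} {c : ℝ}
  {Q : ∀ N, MvPolynomial (Fin (d₁ N) × Fin (d₂ N) × Fin (p N)) ℝ}

/-- The second integration by parts: of `IsStein.loop_main` only the diagonal term survives, so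
inside this contraction `W` acts like the aspect ratio times the identity. -/
lemma WishartRegime.tendsto_mainSum (H : WishartRegime l d₁ d₂ p c) (hQ : DerBdd l d₁ d₂ p Q)
    (u v : List (Fin 2)) : Tendsto (fun N => ((d₁ N : ℝ) * d₂ N)⁻¹ ^ 2 *
      expect (mainSum (wordPoly (d₁ N) (d₂ N) (p N) u) (matPoly (d₁ N) (d₂ N) (p N))
        (wordPoly (d₁ N) (d₂ N) (p N) v) * Q N) -
      (p N : ℝ) / ((d₁ N : ℝ) * d₂ N) * expect (trPoly (d₁ N) (d₂ N) (p N) u *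
        (trPoly (d₁ N) (d₂ N) (p N) v * Q N))) l (𝓝 0) := by
  have h1 := tendsto_list_sum_zero (splits u) _ fun t _ =>
    (H.negligible_fstHit t.2.1 t.1 t.2.2 v).expect_mul hQ.bdd
  have h2 := tendsto_list_sum_zero (splits v) _ fun t _ =>
    (H.negligible_sndHit t.2.1 t.1 t.2.2 u).expect_mul hQ.bdd
  have h3 := (H.negligible_sum_der_traces hQ u v).expect_tendsto
  have h := (h1.add h2).add h3
  simp only [add_zero] at h
  refine h.congr' ?_
  filter_upwards [H.pos] with N ⟨hd₁, hd₂⟩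
  have : Nonempty (Fin (d₁ N)) := ⟨⟨0, hd₁⟩⟩
  have : Nonempty (Fin (d₂ N)) := ⟨⟨0, hd₂⟩⟩
  have hL := (isStein_wishartPoly (α := Fin (d₁ N)) (β := Fin (d₂ N))
    (τ := Fin (p N))).loop_main u v (Q N)
  simp only [Fintype.card_fin] at hL
  simp only [trPoly, smul_mul_assoc, mul_smul_comm, map_smul, smul_eq_mul, List.sum_map_mul_left]
  rw [mul_assoc (Matrix.trace _)] at hL
  have hn : (d₁ N : ℝ) * d₂ N ≠ 0 := by positivity
  generalize (d₁ N : ℝ) * d₂ N = n at hn hL ⊢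
  field_simp
  linarith

lemma WishartRegime.tendsto_step_zero (H : WishartRegime l d₁ d₂ p c) (hQ : DerBdd l d₁ d₂ p Q)
    (w : List (Fin 2)) : Tendsto (fun N =>
      expect (trPoly (d₁ N) (d₂ N) (p N) (0 :: w) * Q N) -
      ((p N : ℝ) / ((d₁ N : ℝ) * d₂ N) * expect (trPoly (d₁ N) (d₂ N) (p N) w * Q N) +
        ((splits w).map fun t => if t.2.1 = 0 then expect (trPoly (d₁ N) (d₂ N) (p N) t.1 *
          (trPoly (d₁ N) (d₂ N) (p N) (0 :: t.2.2) * Q N)) else 0).sum)) l (𝓝 0) := by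
  have h1 := tendsto_list_sum_zero (l := l) (splits w)
    (fun t N => ((d₁ N : ℝ) * d₂ N)⁻¹ ^ 2 *
      expect (loopHit (matPoly (d₁ N) (d₂ N) (p N)) (derPoly (d₁ N) (d₂ N) (p N)) t.2.1
        (wordPoly (d₁ N) (d₂ N) (p N) t.1) (wordPoly (d₁ N) (d₂ N) (p N) t.2.2) * Q N) -
      if t.2.1 = 0 then expect (trPoly (d₁ N) (d₂ N) (p N) t.1 *
          (trPoly (d₁ N) (d₂ N) (p N) (0 :: t.2.2) * Q N)) else 0) (by
    rintro ⟨u, e, v⟩ -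
    fin_cases e
    · refine ((H.negligible_loopHit_zero u v).expect_mul hQ.bdd).congr fun N => ?_
      simp only [trPoly, smul_mul_assoc, mul_smul_comm, map_smul, smul_eq_mul, sub_mul, map_sub,
        Fin.zero_eta, if_true, mul_assoc]
      ring
    · refine ((H.negligible_loopHit_one u v).expect_mul hQ.bdd).congr fun N => ?_
      simp)
  have h := h1.add (H.negligible_sum_der hQ w).expect_tendsto
  simp only [add_zero, list_sum_mul_sub] at h
  refine h.congr' ?_
  filter_upwards [H.pos] with N ⟨hd₁, hd₂⟩
  have : Nonempty (Fin (d₁ N)) := ⟨⟨0, hd₁⟩⟩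
  have : Nonempty (Fin (d₂ N)) := ⟨⟨0, hd₂⟩⟩
  have hL := (isStein_wishartPoly (α := Fin (d₁ N)) (β := Fin (d₂ N))
    (τ := Fin (p N))).loop_zero w (Q N)
  simp only [Fintype.card_fin] at hL
  rw [map_smul, smul_eq_mul]
  have e : ∀ w, expect (trPoly (d₁ N) (d₂ N) (p N) w * Q N) =
      ((d₁ N : ℝ) * d₂ N)⁻¹ * expect ((wordPoly (d₁ N) (d₂ N) (p N) w).trace * Q N) := fun w => by
    rw [trPoly, smul_mul_assoc, map_smul, smul_eq_mul]
  rw [e, e]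
  have hn : (d₁ N : ℝ) * d₂ N ≠ 0 := by positivity
  generalize (d₁ N : ℝ) * d₂ N = n at hn hL ⊢
  field_simp
  linarith

lemma WishartRegime.tendsto_step_one (H : WishartRegime l d₁ d₂ p c) (hQ : DerBdd l d₁ d₂ p Q)
    (w : List (Fin 2)) : Tendsto (fun N =>
      expect (trPoly (d₁ N) (d₂ N) (p N) (1 :: w) * Q N) -
      ((p N : ℝ) / ((d₁ N : ℝ) * d₂ N) * expect (trPoly (d₁ N) (d₂ N) (p N) w * Q N) +
        ((splits w).map fun t => if t.2.1 = 1 then (p N : ℝ) / ((d₁ N : ℝ) * d₂ N) *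
          expect (trPoly (d₁ N) (d₂ N) (p N) t.1 *
          (trPoly (d₁ N) (d₂ N) (p N) t.2.2 * Q N)) else 0).sum)) l (𝓝 0) := by
  have h1 := tendsto_list_sum_zero (l := l) (splits w)
    (fun t N => ((d₁ N : ℝ) * d₂ N)⁻¹ ^ 2 *
      expect (twistHit (matPoly (d₁ N) (d₂ N) (p N)) (derPoly (d₁ N) (d₂ N) (p N)) t.2.1
        (wordPoly (d₁ N) (d₂ N) (p N) t.1) (wordPoly (d₁ N) (d₂ N) (p N) t.2.2) * Q N) -
      if t.2.1 = 1 then (p N : ℝ) / ((d₁ N : ℝ) * d₂ N) * expect (trPoly (d₁ N) (d₂ N) (p N) t.1 *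
          (trPoly (d₁ N) (d₂ N) (p N) t.2.2 * Q N)) else 0) (by
    rintro ⟨u, e, v⟩ -
    fin_cases e
    · refine ((H.negligible_twistHit_zero u v).expect_mul hQ.bdd).congr fun N => ?_
      simp
    · have h := ((H.negligible_twistHit_one u v).expect_mul hQ.bdd).add (H.tendsto_mainSum hQ u v)
      rw [add_zero] at h
      refine h.congr fun N => ?_
      simp only [smul_mul_assoc, map_smul, smul_eq_mul, sub_mul, map_sub,
        Fin.mk_one, if_true]
      ring)
  have h := h1.add (H.negligible_sum_der_twist hQ w).expect_tendsto
  simp only [add_zero, list_sum_mul_sub] at h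
  refine h.congr' ?_
  filter_upwards [H.pos] with N ⟨hd₁, hd₂⟩
  have : Nonempty (Fin (d₁ N)) := ⟨⟨0, hd₁⟩⟩
  have : Nonempty (Fin (d₂ N)) := ⟨⟨0, hd₂⟩⟩
  have hL := (isStein_wishartPoly (α := Fin (d₁ N)) (β := Fin (d₂ N))
    (τ := Fin (p N))).loop_one w (Q N)
  simp only [Fintype.card_fin] at hL
  rw [map_smul, smul_eq_mul]
  have e : ∀ w, expect (trPoly (d₁ N) (d₂ N) (p N) w * Q N) =
      ((d₁ N : ℝ) * d₂ N)⁻¹ * expect ((wordPoly (d₁ N) (d₂ N) (p N) w).trace * Q N) := fun w => by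
    rw [trPoly, smul_mul_assoc, map_smul, smul_eq_mul]
  rw [e, e]
  have hn : (d₁ N : ℝ) * d₂ N ≠ 0 := by positivity
  generalize ((splits w).map fun t : List (Fin 2) × Fin 2 × List (Fin 2) => if t.2.1 = 1 then
    (p N : ℝ) / ((d₁ N : ℝ) * d₂ N) * expect (trPoly (d₁ N) (d₂ N) (p N) t.1 *
      (trPoly (d₁ N) (d₂ N) (p N) t.2.2 * Q N)) else 0).sum = S
  generalize (d₁ N : ℝ) * d₂ N = n at hn hL ⊢
  field_simp
  linarith

end Recursion

/-! ### Identification of the limit moments. -/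

section Limit

lemma length_of_mem_splits {J : Type*} {w : List J} {t : List J × J × List J}
    (h : t ∈ splits w) : t.1.length + t.2.2.length + 1 = w.length := by
  induction w generalizing t with
  | nil => simp [splits] at h
  | cons e w ih =>
    rw [splits, List.mem_cons, List.mem_map] at h
    rcases h with rfl | ⟨s, hs, rfl⟩
    · simp
    · have := ih hs
      simp only [List.length_cons]
      omega

/-- The limit of the mixed moments. -/
noncomputable def limitMoment (c : ℝ) (w : List (Fin 2)) : ℝ :=
  (Fock.state (Fock.word (√c : ℝ) w)).re

/-- The recursion has real coefficients, so induction on the length applies; hence taking the real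
part in `limitMoment` loses nothing. -/
lemma state_word_mem_range (s : ℝ) (w : List (Fin 2)) :
    Fock.state (Fock.word (s : ℂ) w) ∈ Complex.ofRealHom.range := by
  induction h : w.length using Nat.strong_induction_on generalizing w with
  | _ k ih =>
    have hs : (s : ℂ) ^ 2 ∈ Complex.ofRealHom.range := ⟨s ^ 2, by simp⟩
    rcases w with _ | ⟨e, w⟩
    · have : Fock.word (s : ℂ) [] = 1 := rfl
      rw [this, Fock.state_one]
      exact one_mem _
    · have hlt : ∀ v : List (Fin 2), v.length ≤ w.length →
          Fock.state (Fock.word (s : ℂ) v) ∈ Complex.ofRealHom.range := fun v hv =>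
        ih v.length (by rw [← h, List.length_cons]; omega) v rfl
      fin_cases e
      · change Fock.state (Fock.word (s : ℂ) (0 :: w)) ∈ _
        rw [Fock.state_word_zero]
        refine add_mem (mul_mem hs (hlt w le_rfl)) (list_sum_mem fun x hx => ?_)
        obtain ⟨t, ht, rfl⟩ := List.mem_map.1 hx
        have hl := length_of_mem_splits ht
        split_ifs
        · exact mul_mem (hlt _ (by omega)) (hlt _ (by rw [List.length_cons]; omega))
        · exact zero_mem _
      · change Fock.state (Fock.word (s : ℂ) (1 :: w)) ∈ _
        rw [Fock.state_word_one]
        refine add_mem (mul_mem hs (hlt w le_rfl)) (list_sum_mem fun x hx => ?_)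
        obtain ⟨t, ht, rfl⟩ := List.mem_map.1 hx
        have hl := length_of_mem_splits ht
        split_ifs
        · exact mul_mem hs (mul_mem (hlt _ (by omega)) (hlt _ (by omega)))
        · exact zero_mem _

lemma ofReal_limitMoment (c : ℝ) (w : List (Fin 2)) :
    (limitMoment c w : ℂ) = Fock.state (Fock.word (√c : ℝ) w) := by
  obtain ⟨r, hr⟩ := state_word_mem_range (√c) w
  rw [limitMoment, ← hr]
  rfl

lemma limitMoment_nil (c : ℝ) : limitMoment c [] = 1 := by
  have : Fock.word ((√c : ℝ) : ℂ) [] = 1 := rfl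
  rw [limitMoment, this, Fock.state_one, Complex.one_re]

lemma limitMoment_zero {c : ℝ} (hc : 0 ≤ c) (w : List (Fin 2)) :
    limitMoment c (0 :: w) = c * limitMoment c w + ((splits w).map fun t =>
      if t.2.1 = 0 then limitMoment c t.1 * limitMoment c (0 :: t.2.2) else 0).sum := by
  apply Complex.ofReal_injective
  have hs : ((√c : ℝ) : ℂ) ^ 2 = c := by rw [← Complex.ofReal_pow, Real.sq_sqrt hc]
  rw [ofReal_limitMoment, Fock.state_word_zero, hs, ← ofReal_limitMoment, Complex.ofReal_add,
    Complex.ofReal_mul, ← Complex.ofRealHom_eq_coe (List.sum _), map_list_sum, List.map_map]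
  congr 3
  funext t
  simp only [Function.comp, ← ofReal_limitMoment]
  split_ifs <;> simp

lemma limitMoment_one {c : ℝ} (hc : 0 ≤ c) (w : List (Fin 2)) :
    limitMoment c (1 :: w) = c * limitMoment c w + ((splits w).map fun t =>
      if t.2.1 = 1 then c * (limitMoment c t.1 * limitMoment c t.2.2) else 0).sum := by
  apply Complex.ofReal_injective
  have hs : ((√c : ℝ) : ℂ) ^ 2 = c := by rw [← Complex.ofReal_pow, Real.sq_sqrt hc]
  rw [ofReal_limitMoment, Fock.state_word_one, hs, ← ofReal_limitMoment, Complex.ofReal_add,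
    Complex.ofReal_mul, ← Complex.ofRealHom_eq_coe (List.sum _), map_list_sum, List.map_map]
  congr 3
  funext t
  simp only [Function.comp, ← ofReal_limitMoment]
  split_ifs <;> simp

variable {ι : Type*} {l : Filter ι} {d₁ d₂ p : ι → ℕ} {c : ℝ}

lemma BddMoments.tendsto_mul_expect {σ : ι → Type*} [∀ N, Fintype (σ N)]
    {Q : ∀ N, MvPolynomial (σ N) ℝ} (hQ : BddMoments l Q) {r : ι → ℝ} (hr : Tendsto r l (𝓝 0)) :
    Tendsto (fun N => r N * expect (Q N)) l (𝓝 0) := by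
  obtain ⟨C, hC⟩ := hQ.expect_le
  have h := (hr.abs.mul_const C)
  rw [abs_zero, zero_mul] at h
  refine squeeze_zero_norm' ?_ h
  filter_upwards [hC] with N hN
  rw [Real.norm_eq_abs, abs_mul]
  exact mul_le_mul_of_nonneg_left hN (abs_nonneg _)

/-- The weak asymptotic factorization of the normalized trace of `w` by the constant `m`. -/
def Factors (l : Filter ι) (d₁ d₂ p : ι → ℕ) (w : List (Fin 2)) (m : ℝ) : Prop :=
  ∀ Q : ∀ N, MvPolynomial (Fin (d₁ N) × Fin (d₂ N) × Fin (p N)) ℝ, DerBdd l d₁ d₂ p Q →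
    Tendsto (fun N => expect (trPoly (d₁ N) (d₂ N) (p N) w * Q N) - m * expect (Q N)) l (𝓝 0)

lemma WishartRegime.factors_nil (H : WishartRegime l d₁ d₂ p c) : Factors l d₁ d₂ p [] 1 := by
  intro Q _
  refine tendsto_const_nhds.congr' ?_
  filter_upwards [H.pos] with N ⟨h₁, h₂⟩
  have hn : (d₁ N : ℝ) * d₂ N ≠ 0 := by positivity
  have e : trPoly (d₁ N) (d₂ N) (p N) [] = 1 := by
    rw [trPoly, wordPoly, wordMat_nil, Matrix.trace_one, Fintype.card_prod, Fintype.card_fin,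
      Fintype.card_fin, MvPolynomial.smul_eq_C_mul, Nat.cast_mul,
      ← map_natCast (MvPolynomial.C (R := ℝ)), ← map_natCast (MvPolynomial.C (R := ℝ)),
      ← map_mul, ← map_mul, inv_mul_cancel₀ hn, map_one]
  rw [e, one_mul, one_mul, sub_self]

/-- The trace of `v` is absorbed into the test function, which stays in the class. Products of
traces thus factor without any variance estimate. -/
lemma Factors.comp (H : WishartRegime l d₁ d₂ p c) {u v : List (Fin 2)} {a b : ℝ}
    (hu : Factors l d₁ d₂ p u a) (hv : Factors l d₁ d₂ p v b)
    {Q : ∀ N, MvPolynomial (Fin (d₁ N) × Fin (d₂ N) × Fin (p N)) ℝ} (hQ : DerBdd l d₁ d₂ p Q) :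
    Tendsto (fun N => expect (trPoly (d₁ N) (d₂ N) (p N) u *
      (trPoly (d₁ N) (d₂ N) (p N) v * Q N)) - a * b * expect (Q N)) l (𝓝 0) := by
  have h := (hu _ ((H.derBdd_trPoly v).mul hQ)).add ((hv _ hQ).const_mul a)
  rw [mul_zero, add_zero] at h
  exact h.congr fun N => by ring

lemma WishartRegime.tendsto_ratio_mul (H : WishartRegime l d₁ d₂ p c) {F : ι → ℝ} {m : ℝ}
    {Q : ∀ N, MvPolynomial (Fin (d₁ N) × Fin (d₂ N) × Fin (p N)) ℝ} (hQ : DerBdd l d₁ d₂ p Q)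
    (hF : Tendsto (fun N => F N - m * expect (Q N)) l (𝓝 0)) :
    Tendsto (fun N => (p N : ℝ) / ((d₁ N : ℝ) * d₂ N) * F N - c * m * expect (Q N)) l (𝓝 0) := by
  have hr : Tendsto (fun N => ((p N : ℝ) / ((d₁ N : ℝ) * d₂ N) - c) * m) l (𝓝 0) := by
    have := (H.ratio.sub_const c).mul_const m
    rwa [sub_self, zero_mul] at this
  have h := (H.ratio.mul hF).add (hQ.bdd.tendsto_mul_expect hr)
  rw [mul_zero, add_zero] at h
  exact h.congr fun N => by ring

/-- Induction on the length, for all test functions at once. In both asymptotic recursions the words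
on the right are shorter, also `0 :: t.2.2`, since the cut removes a letter beyond the first one.
Comparison with the recursions for `limitMoment` closes the step. -/
lemma WishartRegime.factors (H : WishartRegime l d₁ d₂ p c) (hc : 0 ≤ c) (w : List (Fin 2)) :
    Factors l d₁ d₂ p w (limitMoment c w) := by
  induction h : w.length using Nat.strong_induction_on generalizing w with
  | _ k ih =>
    rcases w with _ | ⟨e, w⟩
    · rw [limitMoment_nil]
      exact H.factors_nil
    · have hlt : ∀ v : List (Fin 2), v.length ≤ w.length →
          Factors l d₁ d₂ p v (limitMoment c v) := fun v hv =>
        ih v.length (by rw [← h, List.length_cons]; omega) v rfl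
      intro Q hQ
      have hw := H.tendsto_ratio_mul hQ (hlt w le_rfl Q hQ)
      have key : ∀ (s : List (List (Fin 2) × Fin 2 × List (Fin 2)))
          (g : List (Fin 2) × Fin 2 × List (Fin 2) → ι → ℝ) (m : _ → ℝ),
          (∀ t ∈ s, Tendsto (fun N => g t N - m t * expect (Q N)) l (𝓝 0)) →
          Tendsto (fun N => (s.map fun t => g t N).sum - (s.map m).sum * expect (Q N)) l (𝓝 0) := by
        intro s g m hs
        refine (tendsto_list_sum_zero s _ hs).congr fun N => ?_
        have := list_sum_mul_sub s 1 (fun t => g t N) fun t => m t * expect (Q N)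
        simpa only [one_mul, List.sum_map_mul_right] using this
      fin_cases e
      · have hS := key (splits w) (fun t N => if t.2.1 = 0 then
            expect (trPoly (d₁ N) (d₂ N) (p N) t.1 *
              (trPoly (d₁ N) (d₂ N) (p N) (0 :: t.2.2) * Q N)) else 0)
            (fun t => if t.2.1 = 0 then limitMoment c t.1 * limitMoment c (0 :: t.2.2) else 0) (by
          intro t ht
          have hl := length_of_mem_splits ht
          by_cases he : t.2.1 = 0
          · simp only [he, if_true]
            exact (hlt _ (by omega)).comp H (hlt _ (by rw [List.length_cons]; omega)) hQ
          · simpa [he] using tendsto_const_nhds)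
        have hA := ((H.tendsto_step_zero hQ w).add hw).add hS
        simp only [add_zero] at hA
        refine hA.congr fun N => ?_
        simp only [Fin.zero_eta]
        rw [limitMoment_zero hc]
        ring
      · have hS := key (splits w) (fun t N => if t.2.1 = 1 then
            (p N : ℝ) / ((d₁ N : ℝ) * d₂ N) * expect (trPoly (d₁ N) (d₂ N) (p N) t.1 *
              (trPoly (d₁ N) (d₂ N) (p N) t.2.2 * Q N)) else 0)
            (fun t => if t.2.1 = 1 then c * (limitMoment c t.1 * limitMoment c t.2.2) else 0) (by
          intro t ht
          have hl := length_of_mem_splits ht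
          by_cases he : t.2.1 = 1
          · simp only [he, if_true]
            exact H.tendsto_ratio_mul hQ ((hlt _ (by omega)).comp H (hlt _ (by omega)) hQ)
          · simpa [he] using tendsto_const_nhds)
        have hA := ((H.tendsto_step_one hQ w).add hw).add hS
        simp only [add_zero] at hA
        refine hA.congr fun N => ?_
        simp only [Fin.mk_one]
        rw [limitMoment_one hc]
        ring

/-- The mixed moments of the Gaussian model converge to those of the Fock space model. -/
theorem WishartRegime.tendsto_expect_trPoly (H : WishartRegime l d₁ d₂ p c) (hc : 0 ≤ c)
    (w : List (Fin 2)) :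
    Tendsto (fun N => expect (trPoly (d₁ N) (d₂ N) (p N) w)) l (𝓝 (limitMoment c w)) := by
  have h := (H.factors hc w _ derBdd_one).add_const (limitMoment c w)
  rw [zero_add] at h
  refine h.congr fun N => ?_
  have h1 : expect (1 : MvPolynomial (Fin (d₁ N) × Fin (d₂ N) × Fin (p N)) ℝ) = 1 := expect_C 1
  rw [h1, mul_one, mul_one, sub_add_cancel]

end Limit

/-! ### Transfer to the given random matrices and conclusion. -/

lemma transpose_wishart {d₁ d₂ p : ℕ} (G : Fin d₁ → Matrix (Fin d₂) (Fin p) ℝ) :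
    (wishart G).transpose = wishart G := by
  ext a b
  simp only [wishart, Matrix.transpose_apply, Matrix.smul_apply, Matrix.of_apply, Matrix.mul_apply,
    mul_comm]

lemma leftPartialTranspose_eq_of_transpose_eq {m n R : Type*} {A : Matrix (m × n) (m × n) R}
    (h : A.transpose = A) : leftPartialTranspose A = rightPartialTranspose A := by
  ext a b
  exact congrFun (congrFun h (a.1, b.2)) (b.1, a.2)

lemma map_eval_wishartPoly {d₁ d₂ p : ℕ} (G : Fin d₁ → Matrix (Fin d₂) (Fin p) ℝ) :
    (wishartPoly (Fin d₁) (Fin d₂) (Fin p)).map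
      (MvPolynomial.eval fun q => G q.1 q.2.1 q.2.2) = wishart G := by
  ext a b
  simp [wishartPoly, wishart, Matrix.mul_apply, MvPolynomial.smul_eval]

lemma map_ofReal_wordMat {α β : Type*} [Fintype α] [Fintype β] [DecidableEq α] [DecidableEq β]
    (W : Matrix (α × β) (α × β) ℝ) (w : List (Fin 2)) :
    (w.map fun j => (letterMat W j).map Complex.ofReal).prod =
      (wordMat W w).map Complex.ofReal := by
  have h := wordMat_map Complex.ofRealHom W w
  change (wordMat W w).map Complex.ofReal = _ at h
  rw [h, wordMat]
  congr 1
  refine List.map_congr_left fun j _ => ?_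
  fin_cases j <;> rfl

/-- The normalized traces of words in `W` and its partial transpose are polynomials in the
entries of the Gaussian matrices. -/
lemma normTrace_word {d₁ d₂ p : ℕ} (G : Fin d₁ → Matrix (Fin d₂) (Fin p) ℝ) (w : List (Fin 2)) :
    normTrace (w.map fun j => (letterMat (wishart G) j).map Complex.ofReal).prod =
      (MvPolynomial.eval (fun q => G q.1 q.2.1 q.2.2) (trPoly d₁ d₂ p w) : ℝ) := by
  have e : MvPolynomial.eval (fun q : Fin d₁ × Fin d₂ × Fin p => G q.1 q.2.1 q.2.2)
      (wordPoly d₁ d₂ p w).trace = (wordMat (wishart G) w).trace := by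
    rw [← map_eval_wishartPoly, ← wordMat_map]
    simp [Matrix.trace]
  rw [map_ofReal_wordMat, normTrace, trPoly, MvPolynomial.smul_eval, e]
  simp [Matrix.trace, Matrix.map_apply]

lemma hasLaw_gaussPi {σ Ω : Type*} [Fintype σ] [MeasurableSpace Ω] {P : Measure Ω}
    [IsProbabilityMeasure P] {X : σ → Ω → ℝ} (hX : ∀ q, HasLaw (X q) (gaussianReal 0 1) P)
    (h : iIndepFun X P) : HasLaw (fun ω q => X q ω) (gaussPi σ) P where
  aemeasurable := aemeasurable_pi_iff.2 fun q => (hX q).aemeasurable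
  map_eq := by
    rw [(iIndepFun_iff_map_fun_eq_pi_map fun q => (hX q).aemeasurable).1 h, gaussPi]
    simp only [fun q => (hX q).map_eq]

lemma measurable_eval {σ : Type*} [Fintype σ] (F : MvPolynomial σ ℝ) :
    Measurable fun x : σ → ℝ => MvPolynomial.eval x F :=
  (MvPolynomial.continuous_eval F).measurable

section Transfer
variable {σ Ω : Type*} [Fintype σ] [MeasurableSpace Ω] {P : Measure Ω} {X : Ω → σ → ℝ}

lemma integrable_eval_of_hasLaw (hX : HasLaw X (gaussPi σ) P) (F : MvPolynomial σ ℝ) :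
    Integrable (fun ω => MvPolynomial.eval (X ω) F) P := by
  have h := integrable_eval F
  rw [← hX.map_eq] at h
  exact h.comp_aemeasurable hX.aemeasurable

lemma integral_eval_of_hasLaw (hX : HasLaw X (gaussPi σ) P) (F : MvPolynomial σ ℝ) :
    ∫ ω, MvPolynomial.eval (X ω) F ∂P = expect F := by
  rw [expect_def, ← hX.map_eq]
  exact (integral_map hX.aemeasurable (measurable_eval F).aestronglyMeasurable).symm

end Transfer

theorem mainTheorem5 {ι : Type*} (l : Filter ι) [l.NeBot]
    (d₁ d₂ p : ι → ℕ) (c : ℝ) (hc : 0 < c)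
    (hd₁ : Tendsto d₁ l atTop) (hd₂ : Tendsto d₂ l atTop)
    (hp : Tendsto (fun N => (p N : ℝ) / ((d₁ N : ℝ) * (d₂ N : ℝ))) l (𝓝 c))
    {Ω : ι → Type*} [∀ N, MeasurableSpace (Ω N)]
    (P : ∀ N, Measure (Ω N)) [∀ N, IsProbabilityMeasure (P N)]
    (G : ∀ N, Fin (d₁ N) → Ω N → Matrix (Fin (d₂ N)) (Fin (p N)) ℝ)
    (hlaw : ∀ N i j k, HasLaw (fun ω => G N i ω j k) (gaussianReal 0 1) (P N))
    (hindep : ∀ N, iIndepFun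
      (fun (q : Fin (d₁ N) × Fin (d₂ N) × Fin (p N)) (ω : Ω N) => G N q.1 ω q.2.1 q.2.2) (P N)) :
    (∀ N ω,
      (wishart fun i => G N i ω).transpose = wishart (fun i => G N i ω) ∧
      leftPartialTranspose (wishart fun i => G N i ω) =
        rightPartialTranspose (wishart fun i => G N i ω)) ∧
    AsymptoticallyFree l P
      (fun N => ![fun ω => (wishart fun i => G N i ω).map Complex.ofReal,
        fun ω => (rightPartialTranspose (wishart fun i => G N i ω)).map Complex.ofReal]) := by
  have hL : ∀ N, HasLaw (fun ω (q : Fin (d₁ N) × Fin (d₂ N) × Fin (p N)) => G N q.1 ω q.2.1 q.2.2)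
      (gaussPi (Fin (d₁ N) × Fin (d₂ N) × Fin (p N))) (P N) := fun N =>
    hasLaw_gaussPi (fun q => hlaw N q.1 q.2.1 q.2.2) (hindep N)
  have hX : ∀ (w : List (Fin 2)) (N : ι) (ω : Ω N), normTrace (w.map fun j =>
      (![fun ω => (wishart fun i => G N i ω).map Complex.ofReal,
        fun ω => (rightPartialTranspose (wishart fun i => G N i ω)).map Complex.ofReal] :
        Fin 2 → Ω N → _) j ω).prod =
      (MvPolynomial.eval (fun q => G N q.1 ω q.2.1 q.2.2)
        (trPoly (d₁ N) (d₂ N) (p N) w) : ℝ) := by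
    intro w N ω
    rw [← normTrace_word (fun i => G N i ω) w]
    congr 2
    refine List.map_congr_left fun j _ => ?_
    fin_cases j <;> rfl
  refine ⟨fun N ω => ⟨transpose_wishart _,
    leftPartialTranspose_eq_of_transpose_eq (transpose_wishart _)⟩, fun w N => ?_,
    -- The parameter is `√c` because the rate of the Fock space model is its square.
    Module.End ℂ Fock.Space, inferInstance, inferInstance, Fock.state, Fock.elt ((√c : ℝ) : ℂ),
    Fock.state_one, fun w => ?_, Fock.free_elt _⟩
  · simp only [hX]
    exact (integrable_eval_of_hasLaw (hL N) _).ofReal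
  · have h := (Complex.continuous_ofReal.tendsto _).comp
      (WishartRegime.tendsto_expect_trPoly ⟨hd₁, hd₂, hp⟩ hc.le w)
    rw [ofReal_limitMoment] at h
    refine h.congr fun N => ?_
    simp only [hX, integral_complex_ofReal, Function.comp]
    rw [integral_eval_of_hasLaw (hL N)]
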